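/- Let $n,N\ge 1$. For $\Xi=(\xi_1,\dots,\xi_N)\in\mathbb R^{nN}$ with $\xi_j\in\mathbb R^n$ put $\langle\Xi\rangle=(1+\sum_j|\xi_j|^2)^{1/2}$. For $m\in\mathbb R$ and $\rho\le 1$, the class $L^\infty S^m_\rho(n,N)$ consists of the functions $a:\mathbb R^n\times\mathbb R^{nN}\to\mathbb C$ such that $a(\cdot,\Xi)$ is (Lebesgue) measurable for every $\Xi$, $a(x,\cdot)$ is smooth for almost every $x$, and for each multi-index $\alpha\in\mathbb Z_+^{Nn}$ there is a constant $C_\alpha$ with $$\operatorname*{ess\,sup}_x|\partial_\Xi^\alpha a(x,\Xi)|\le C_\alpha\langle\Xi\rangle^{m-\rho|\alpha|}\qquad\text{for all }\Xi .$$ For Schwartz functions $u_1,\dots,u_N$ on $\mathbb R^n$ let $$T_a(u_1,\dots,u_N)(x)=\int_{\mathbb R^{nN}}a(x,\Xi)\prod_{j=1}^N\widehat u_j(\xi_j)e^{ix\cdot\xi_j}\,d\Xi,\qquad \widehat u(\xi)=\int_{\mathbb R^n}u(y)e^{-i\xi\cdot y}\,dy,$$ and let $M_p(u)(x)=\sup_{B\ni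 x}\bigl(\frac1{|B|}\int_B|u|^p\bigr)^{1/p}$, the supremum being over balls $B$ containing $x$. For $1<p<\infty$, $w\in A_p$ means that $w$ is locally integrable, positive almost everywhere, and $\sup_B\bigl(\frac1{|B|}\int_B w\bigr)\bigl(\frac1{|B|}\int_B w^{-1/(p-1)}\bigr)^{p-1}<\infty$. **Theorem.** Let $p_j\in[1,2]$ for $j=1,\dots,N$, let $0\le\rho\le1$ and $m<(\rho-1)\sum_{j=1}^N\frac n{p_j}$, and let $a\in L^\infty S^m_\rho(n,N)$. (i) There is a constant $C$, depending only on $n$, $N$, the $p_j$, $m$, $\rho$ and finitely many of the constants $C_\alpha$ (the finite set $S$ of multi-indices $\alpha$ involved depending only on $n,N,p_j,m,\rho$), such that for almost every $x\in\mathbb R^n$, for all Schwartz functions $u_1,\dots,u_N$, $$|T_a(u_1,\dots,u_N)(x)|\le C\prod_{j=1}^N M_{p_j}(u_j)(x).$$ Moreover, with the same $C$, this inequality holds for all Schwartz $u_1,\dots,u_N$ at every $x$ for which $a(x,\cdot)$ is smooth and $|\partial^\alpha_\Xi a(x,\Xi)|\le C_\alpha\langle\Xi\rangle^{m-\rho|\alpha|}$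 for all $\Xi$ and all $\alpha\in S$. (ii) Let $p_j<q_j\le\infty$ and let $r\in(0,\infty]$ be given by $\frac1r=\sum_{j=1}^N\frac1{q_j}$. Let $w_j\in A_{q_j/p_j}$ if $q_j<\infty$ and $w_j\equiv1$ if $q_j=\infty$, and let $\mu=\prod_{j=1}^N w_j^{r/q_j}$ (with $r/q_j=0$ when $q_j=\infty$). Then $T_a$ is bounded from $L^{q_1}_{w_1}\times\dots\times L^{q_N}_{w_N}$ to $L^r_\mu$, where $L^{q_j}_{w_j}$ is the closure of the Schwartz class in $L^{q_j}(w_j\,dx)$, and $L^r_\mu=L^r(\mu\,dx)$. That is, the Schwartz functions lie in each $L^{q_j}_{w_j}$; there is a constant $C'$ with $\|T_a(u_1,\dots,u_N)\|_{L^r_\mu}\le C'\prod_j\|u_j\|_{L^{q_j}_{w_j}}$ for all Schwartz $u_j$; and there is a unique bounded $N$-linear map $L^{q_1}_{w_1}\times\dots\times L^{q_N}_{w_N}\to L^r_\mu$ which agrees with $T_a$ on Schwartz functions. -/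

import Mathlib

open MeasureTheory Filter Topology
open scoped ENNReal NNReal SchwartzMap ContDiff

noncomputable section

namespace MultilinPsdo

/-- The Euclidean space `ℝⁿ`; a point `Ξ = (ξ₁, …, ξ_N)` of `ℝ^{nN}` is a function
`Fin N → Rn n`, whose `volume` is Lebesgue measure on `ℝ^{nN}`. -/
abbrev Rn (n : ℕ) : Type := EuclideanSpace ℝ (Fin n)

/-- Multi-indices `α ∈ ℤ₊^{Nn}`. -/
abbrev MultiIndex (n N : ℕ) : Type := Fin N × Fin n → ℕ

/-- `|α|`, the order of a multi-index. -/
def order {n N : ℕ} (α : MultiIndex n N) : ℕ := ∑ c, α c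

/-- The partial derivative in the `c.2`-th coordinate of the variable `ξ_{c.1}`. -/
def coordDeriv {n N : ℕ} (c : Fin N × Fin n) (f : (Fin N → Rn n) → ℂ) :
    (Fin N → Rn n) → ℂ :=
  fun Ξ => lineDeriv ℝ f Ξ (Pi.single c.1 (EuclideanSpace.single c.2 1))

/-- `∂^α f`: each coordinate derivative is applied `α c` times, in lexicographic order of the
coordinates. -/
def multiDeriv {n N : ℕ} (α : MultiIndex n N) (f : (Fin N → Rn n) → ℂ) :
    (Fin N → Rn n) → ℂ :=
  (List.finRange N ×ˢ List.finRange n).foldr (fun c g => (coordDeriv c)^[α c] g) f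

/-- `⟨Ξ⟩ = (1 + |Ξ|²)^{1/2}` with `|Ξ|² = ∑ |ξ_j|²`, the Euclidean norm on `ℝ^{nN}`. -/
def bracket {n N : ℕ} (Ξ : Fin N → Rn n) : ℝ := Real.sqrt (1 + ∑ j, ‖Ξ j‖ ^ 2)

/-- The estimate `|∂_Ξ^α a(x,Ξ)| ≤ C ⟨Ξ⟩^{m - ρ|α|}` at one point `(x, Ξ)`. -/
def SymbolBoundAt {n N : ℕ} (m ρ : ℝ) (a : Rn n → (Fin N → Rn n) → ℂ) (α : MultiIndex n N)
    (C : ℝ) (x : Rn n) (Ξ : Fin N → Rn n) : Prop :=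
  ‖multiDeriv α (a x) Ξ‖ ≤ C * bracket Ξ ^ (m - ρ * (order α : ℝ))

/-- The symbol class `L^∞ S^m_ρ(n,N)`: measurable in `x`, smooth in `Ξ`, and
`ess sup_x |∂_Ξ^α a(x,Ξ)| ≤ C_α ⟨Ξ⟩^{m - ρ|α|}`. -/
structure IsSymbol {n N : ℕ} (m ρ : ℝ) (a : Rn n → (Fin N → Rn n) → ℂ) : Prop where
  aestronglyMeasurable : ∀ Ξ, AEStronglyMeasurable (fun x => a x Ξ) volume
  contDiff : ∀ᵐ x, ContDiff ℝ ∞ (a x)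
  bound : ∀ α : MultiIndex n N, ∃ C : ℝ, ∀ Ξ, ∀ᵐ x, SymbolBoundAt m ρ a α C x Ξ

/-- The Fourier transform `û(ξ) = ∫ u(y) e^{-iξ·y} dy`. -/
def fourierT {n : ℕ} (u : Rn n → ℂ) (ξ : Rn n) : ℂ :=
  ∫ y : Rn n, u y * Complex.exp (-Complex.I * (inner ℝ ξ y : ℝ))

/-- The multilinear pseudodifferential operator
`T_a(u₁,…,u_N)(x) = ∫ a(x,Ξ) ∏_j û_j(ξ_j) e^{i x·ξ_j} dΞ` on Schwartz functions. -/
def psdo {n N : ℕ} (a : Rn n → (Fin N → Rn n) → ℂ) (u : Fin N → 𝓢(Rn n, ℂ)) (x : Rn n) : ℂ :=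
  ∫ Ξ : Fin N → Rn n,
    a x Ξ * ∏ j, (fourierT (u j) (Ξ j) * Complex.exp (Complex.I * (inner ℝ x (Ξ j) : ℝ)))

/-- The `L^p` maximal function: the supremum over the balls containing `x` of the `L^p` averages. -/
def maximalFn {n : ℕ} (p : ℝ) (u : Rn n → ℂ) (x : Rn n) : ℝ≥0∞ :=
  ⨆ (c : Rn n) (s : ℝ) (_ : x ∈ Metric.ball c s),
    ((∫⁻ y in Metric.ball c s, ‖u y‖ₑ ^ p) / volume (Metric.ball c s)) ^ (1 / p)

/-- The average over a ball of a nonnegative function. -/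
def ballAvg {n : ℕ} (w : Rn n → ℝ) (c : Rn n) (s : ℝ) : ℝ≥0∞ :=
  (∫⁻ y in Metric.ball c s, ENNReal.ofReal (w y)) / volume (Metric.ball c s)

/-- Muckenhoupt's class `A_p`, for `1 < p < ∞`. -/
structure IsApWeight {n : ℕ} (p : ℝ) (w : Rn n → ℝ) : Prop where
  locallyIntegrable : LocallyIntegrable w volume
  pos : ∀ᵐ x, 0 < w x
  bound : ∃ C : ℝ≥0, ∀ (c : Rn n) (s : ℝ), 0 < s →
    ballAvg w c s * ballAvg (fun y => w y ^ (-1 / (p - 1))) c s ^ (p - 1) ≤ C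

/-- The measure `w(x) dx`. -/
def weightMeasure {n : ℕ} (w : Rn n → ℝ) : Measure (Rn n) :=
  volume.withDensity (fun x => ENNReal.ofReal (w x))

/-- `L^q_w`, the closure of the Schwartz class in the norm `(∫ |u|^q w dx)^{1/q}`
(for `q = ∞`, in the essential supremum with respect to `w dx`). -/
def weightedLp {n : ℕ} (q : ℝ≥0∞) (w : Rn n → ℝ) :
    Submodule ℂ (Lp ℂ q (weightMeasure w)) where
  carrier := {f | ∃ φ : ℕ → 𝓢(Rn n, ℂ),
    Tendsto (fun k => eLpNorm (⇑f - ⇑(φ k)) q (weightMeasure w)) atTop (𝓝 0)}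
  zero_mem' := by
    refine ⟨fun _ => 0, ?_⟩
    have h : eLpNorm (⇑(0 : Lp ℂ q (weightMeasure w)) - ⇑(0 : 𝓢(Rn n, ℂ))) q
        (weightMeasure w) = 0 := by
      rw [eLpNorm_congr_ae (g := 0)]
      · simp
      · filter_upwards [Lp.coeFn_zero ℂ q (weightMeasure w)] with x hx
        change (0 : Lp ℂ q (weightMeasure w)) x - (0 : ℂ) = 0
        rw [hx, Pi.zero_apply, sub_zero]
    simp only [h]
    exact tendsto_const_nhds
  add_mem' := by
    rintro f g ⟨φ, hφ⟩ ⟨ψ, hψ⟩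
    refine ⟨fun k => φ k + ψ k, ?_⟩
    have hlim : Tendsto (fun k => ENNReal.LpAddConst q *
        (eLpNorm (⇑f - ⇑(φ k)) q (weightMeasure w) + eLpNorm (⇑g - ⇑(ψ k)) q (weightMeasure w)))
        atTop (𝓝 0) := by
      have := ENNReal.Tendsto.const_mul (a := ENNReal.LpAddConst q) (hφ.add hψ)
        (Or.inr (ENNReal.LpAddConst_lt_top q).ne)
      simpa using this
    refine tendsto_of_tendsto_of_tendsto_of_le_of_le tendsto_const_nhds hlim
      (fun _ => zero_le) (fun k => ?_)
    have hf : AEStronglyMeasurable (⇑f - ⇑(φ k)) (weightMeasure w) :=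
      (Lp.aestronglyMeasurable f).sub (φ k).continuous.aestronglyMeasurable
    have hg : AEStronglyMeasurable (⇑g - ⇑(ψ k)) (weightMeasure w) :=
      (Lp.aestronglyMeasurable g).sub (ψ k).continuous.aestronglyMeasurable
    refine le_trans (le_of_eq ?_) (eLpNorm_add_le' hf hg q)
    refine eLpNorm_congr_ae ?_
    filter_upwards [Lp.coeFn_add f g] with x hx
    change (f + g : Lp ℂ q (weightMeasure w)) x - (φ k x + ψ k x) = (f x - φ k x) + (g x - ψ k x)
    rw [hx, Pi.add_apply]
    ring
  smul_mem' := by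
    rintro c f ⟨φ, hφ⟩
    refine ⟨fun k => c • φ k, ?_⟩
    have hlim : Tendsto (fun k => ‖c‖ₑ * eLpNorm (⇑f - ⇑(φ k)) q (weightMeasure w))
        atTop (𝓝 0) := by
      have := ENNReal.Tendsto.const_mul (a := ‖c‖ₑ) hφ (Or.inr enorm_ne_top)
      simpa using this
    refine hlim.congr (fun k => ?_)
    rw [← eLpNorm_const_smul]
    refine eLpNorm_congr_ae ?_
    filter_upwards [Lp.coeFn_smul c f] with x hx
    change c * (f x - φ k x) = (c • f : Lp ℂ q (weightMeasure w)) x - c * φ k x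
    rw [hx, Pi.smul_apply, smul_eq_mul, mul_sub]

/-- `T`, initially defined on Schwartz functions, is bounded from
`L^{q₁}_{w₁} × ⋯ × L^{q_N}_{w_N}` to `L^r_μ`: the Schwartz functions lie in the domain spaces,
`T` satisfies the norm inequality on them, and `T` has a unique bounded `N`-linear
extension to `L^{q₁}_{w₁} × ⋯ × L^{q_N}_{w_N}`. -/
structure IsBoundedOp {n N : ℕ} (T : (Fin N → 𝓢(Rn n, ℂ)) → Rn n → ℂ)
    (q : Fin N → ℝ≥0∞) (w : Fin N → Rn n → ℝ) (r : ℝ≥0∞) (μ : Rn n → ℝ) : Prop where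
  schwartz_mem : ∀ (j : Fin N) (φ : 𝓢(Rn n, ℂ)), MemLp φ (q j) (weightMeasure (w j))
  norm_le : ∃ C : ℝ≥0, ∀ φ : Fin N → 𝓢(Rn n, ℂ),
    MemLp (T φ) r (weightMeasure μ) ∧
    eLpNorm (T φ) r (weightMeasure μ) ≤
      C * ∏ j, eLpNorm (φ j) (q j) (weightMeasure (w j))
  extension : ∃! F : MultilinearMap ℂ (fun j => weightedLp (q j) (w j))
      (Lp ℂ r (weightMeasure μ)),
    (∃ C : ℝ≥0, ∀ f : (j : Fin N) → weightedLp (q j) (w j),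
      ‖F f‖ ≤ C * ∏ j, ‖(f j : Lp ℂ (q j) (weightMeasure (w j)))‖) ∧
    ∀ (φ : Fin N → 𝓢(Rn n, ℂ)) (f : (j : Fin N) → weightedLp (q j) (w j)),
      (∀ j, ⇑(f j : Lp ℂ (q j) (weightMeasure (w j))) =ᵐ[weightMeasure (w j)] ⇑(φ j)) →
      ⇑(F f) =ᵐ[weightMeasure μ] T φ

end MultilinPsdo

end

/-!
# Pointwise and weighted bounds for multilinear pseudodifferential operators

**The pointwise bound.** Fix `x` and write `a(x, Ξ) = ∑_k a(x, Ξ) η(2^{-k} Ξ)` with a dyadic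
partition of unity. On the piece at frequency `t = 2^k` a derivative of the symbol costs a factor
`t^{-ρ}`, so the natural scale in physical space is `t^{-ρ}`. The function `u_j(x + y)` is divided
by `(1 + t^{2ρ}|y|²)^n`; on the Fourier side this is undone by `(1 - t^{2ρ} Δ)^n`, which integration
by parts moves to the symbol, where it is harmless (`norm_integral_mul_tensor_le`). What remains is
the `L¹` norm over `|ξ_j| ≤ 4t` of the Fourier transform of the localized function. The Hausdorff–Young
and Hölder inequalities would bound it by `t^{n/p_j}` times the `L^{p_j}` norm; since `p_j ≤ 2` a single
truncation and Plancherel's theorem suffice (`setLIntegral_enorm_fourier_le`). The localized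
`L^{p_j}` norm is at most a multiple of `t^{-ρ n/p_j} M_{p_j} u_j(x)` (`lintegral_besselDiv_le`). The
piece is therefore bounded by `t^{m + (1-ρ) ∑ n/p_j} ∏ M_{p_j} u_j(x)`
(`enorm_integral_piece_le`), and the condition on `m` says that the exponent is negative, so that the
pieces sum up (`exists_enorm_psdo_le`). Only derivatives of order at most `2nN` enter.

**The weighted bounds.** These only use the pointwise bound and the multilinearity of `T_a` at almost
every point. `M_p` is bounded on `L^q(w)` for `w ∈ A_{q/p}` by Muckenhoupt's theorem, which
follows from Lerner's pointwise inequality `IsApDensity.maxOp_rpow_le`: it dominates the maximal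
function by two maximal functions taken with respect to the doubling measures `w dx` and
`w^{-1/(p-1)} dx`, and these are bounded by Vitali's covering lemma without further `A_p` theory
(`IsBallDoubling.lintegral_maxOp_rpow_le`). Hölder's inequality
(`eLpNorm_prod_productWeight_le`) then gives the norm inequality.

**The extension.** Since `r` may be smaller than `1`, the extension is constructed pointwise. If
Schwartz functions `φ_j^k` tend to `f_j` in `L^{q_j}(w_j)`, then along a subsequence
`M_{p_j}(f_j - φ_j^k) → 0` almost everywhere, and the pointwise bound makes `T_a(φ^k)(x)` a Cauchy
sequence whose limit does not depend on the approximation (`IsMaxDominated.exists_limit`).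
Uniqueness is obtained by approximating one slot after the other
(`multilinearMap_ext_of_schwartz`).
-/

noncomputable section

namespace MultilinPsdo

/-! ### Iterated coordinate derivatives -/


variable {n N : ℕ}

/-- The coordinate vector of `ℝ^{nN}` in the direction of the coordinate `c`. -/
def coordVec (c : Fin N × Fin n) : Fin N → Rn n :=
  Pi.single c.1 (EuclideanSpace.single c.2 1)

/-- The iterated coordinate derivative along a word of coordinates; the last letter of the word
is applied first. -/
def wordDeriv (l : List (Fin N × Fin n)) (f : (Fin N → Rn n) → ℂ) : (Fin N → Rn n) → ℂ :=
  l.foldr coordDeriv f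

@[simp] lemma wordDeriv_nil (f : (Fin N → Rn n) → ℂ) : wordDeriv [] f = f := rfl

lemma wordDeriv_cons (c : Fin N × Fin n) (l : List (Fin N × Fin n)) (f : (Fin N → Rn n) → ℂ) :
    wordDeriv (c :: l) f = coordDeriv c (wordDeriv l f) := rfl

lemma wordDeriv_append (l l' : List (Fin N × Fin n)) (f : (Fin N → Rn n) → ℂ) :
    wordDeriv (l ++ l') f = wordDeriv l (wordDeriv l' f) := by
  simp [wordDeriv, List.foldr_append]

lemma coordDeriv_eq_fderiv {f : (Fin N → Rn n) → ℂ} (hf : Differentiable ℝ f)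
    (c : Fin N × Fin n) : coordDeriv c f = fun Ξ => fderiv ℝ f Ξ (coordVec c) := by
  funext Ξ
  exact (hf Ξ).lineDeriv_eq_fderiv

lemma contDiff_coordDeriv {f : (Fin N → Rn n) → ℂ} (hf : ContDiff ℝ ∞ f) (c : Fin N × Fin n) :
    ContDiff ℝ ∞ (coordDeriv c f) := by
  rw [coordDeriv_eq_fderiv (hf.differentiable (by simp))]
  exact (hf.fderiv_right (m := ∞) (by simp)).clm_apply contDiff_const

lemma contDiff_wordDeriv {f : (Fin N → Rn n) → ℂ} (hf : ContDiff ℝ ∞ f)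
    (l : List (Fin N × Fin n)) : ContDiff ℝ ∞ (wordDeriv l f) := by
  induction l with
  | nil => exact hf
  | cons c l ih => exact contDiff_coordDeriv ih c

lemma coordDeriv_comm {f : (Fin N → Rn n) → ℂ} (hf : ContDiff ℝ ∞ f) (c d : Fin N × Fin n) :
    coordDeriv c (coordDeriv d f) = coordDeriv d (coordDeriv c f) := by
  have key : ∀ c d : Fin N × Fin n, coordDeriv c (coordDeriv d f) =
      fun Ξ => fderiv ℝ (fderiv ℝ f) Ξ (coordVec c) (coordVec d) := by
    intro c d
    rw [coordDeriv_eq_fderiv ((contDiff_coordDeriv hf d).differentiable (by simp)),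
      coordDeriv_eq_fderiv (hf.differentiable (by simp))]
    funext Ξ
    have h : DifferentiableAt ℝ (fderiv ℝ f) Ξ :=
      ((hf.fderiv_right (m := ∞) (by simp)).differentiable (by simp)) Ξ
    rw [fderiv_clm_apply h (differentiableAt_const _)]
    simp
  rw [key, key]
  funext Ξ
  have := (hf.contDiffAt (x := Ξ)).isSymmSndFDerivAt 
    (by simpa using WithTop.coe_le_coe.2 (le_top : (2 : ℕ∞) ≤ ⊤))
  exact this _ _

lemma wordDeriv_perm {f : (Fin N → Rn n) → ℂ} (hf : ContDiff ℝ ∞ f)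
    {l l' : List (Fin N × Fin n)} (h : l.Perm l') : wordDeriv l f = wordDeriv l' f := by
  induction h with
  | nil => rfl
  | cons c _ ih => rw [wordDeriv_cons, wordDeriv_cons, ih]
  | swap c d l =>
    simp only [wordDeriv_cons]
    exact coordDeriv_comm (contDiff_wordDeriv hf l) _ _
  | trans _ _ ih₁ ih₂ => rw [ih₁, ih₂]

/-- The word in which the letter `c` occurs `α c` times, in the order used by `multiDeriv`. -/
def multiWord (α : MultiIndex n N) : List (Fin N × Fin n) :=
  (List.finRange N ×ˢ List.finRange n).flatMap fun c => List.replicate (α c) c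

lemma multiDeriv_eq_wordDeriv (α : MultiIndex n N) (f : (Fin N → Rn n) → ℂ) :
    multiDeriv α f = wordDeriv (multiWord α) f := by
  unfold multiDeriv multiWord
  generalize List.finRange N ×ˢ List.finRange n = L
  induction L with
  | nil => rfl
  | cons c L ih =>
    have hrep : ∀ (k : ℕ) (g : (Fin N → Rn n) → ℂ),
        (coordDeriv c)^[k] g = wordDeriv (List.replicate k c) g := by
      intro k g
      induction k with
      | zero => rfl
      | succ k ihk => rw [Function.iterate_succ_apply', ihk]; rfl
    rw [List.foldr_cons, List.flatMap_cons, wordDeriv_append, ← ih, hrep]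

lemma count_multiWord (α : MultiIndex n N) (c : Fin N × Fin n) :
    (multiWord α).count c = α c := by
  have hnd : (List.finRange N ×ˢ List.finRange n).Nodup :=
    (List.nodup_finRange N).product (List.nodup_finRange n)
  have hmem : c ∈ List.finRange N ×ˢ List.finRange n :=
    List.pair_mem_product.2 ⟨List.mem_finRange _, List.mem_finRange _⟩
  have aux : ∀ L : List (Fin N × Fin n), L.Nodup →
      (L.flatMap fun d => List.replicate (α d) d).count c = if c ∈ L then α c else 0 := by
    intro L hL
    induction L with
    | nil => simp
    | cons d L ih =>
      rw [List.flatMap_cons, List.count_append, ih (List.nodup_cons.1 hL).2, List.count_replicate]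
      by_cases h : c = d
      · subst h
        simp [(List.nodup_cons.1 hL).1]
      · simp [h, Ne.symm h]
  rw [multiWord, aux _ hnd, if_pos hmem]

lemma multiWord_count_perm (l : List (Fin N × Fin n)) :
    l.Perm (multiWord fun c => l.count c) := by
  rw [List.perm_iff_count]
  intro c
  rw [count_multiWord]

lemma order_count (l : List (Fin N × Fin n)) : order (fun c => l.count c) = l.length := by
  unfold order
  have := Multiset.sum_count_eq_card (s := Finset.univ) (m := (l : Multiset (Fin N × Fin n)))
    (by simp)
  simp only [Multiset.coe_count, Multiset.coe_card] at this
  rw [← this]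
  refine Finset.sum_congr rfl fun c _ => ?_
  congr!

lemma wordDeriv_eq_multiDeriv {f : (Fin N → Rn n) → ℂ} (hf : ContDiff ℝ ∞ f)
    (l : List (Fin N × Fin n)) : wordDeriv l f = multiDeriv (fun c => l.count c) f := by
  rw [multiDeriv_eq_wordDeriv]
  exact wordDeriv_perm hf (multiWord_count_perm l)

lemma contDiff_multiDeriv {f : (Fin N → Rn n) → ℂ} (hf : ContDiff ℝ ∞ f) (α : MultiIndex n N) :
    ContDiff ℝ ∞ (multiDeriv α f) := by
  rw [multiDeriv_eq_wordDeriv]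
  exact contDiff_wordDeriv hf _

lemma coordDeriv_add {f g : (Fin N → Rn n) → ℂ} (hf : Differentiable ℝ f)
    (hg : Differentiable ℝ g) (c : Fin N × Fin n) :
    coordDeriv c (f + g) = coordDeriv c f + coordDeriv c g := by
  rw [coordDeriv_eq_fderiv (hf.add hg), coordDeriv_eq_fderiv hf, coordDeriv_eq_fderiv hg]
  funext Ξ
  rw [fderiv_add (hf Ξ) (hg Ξ)]
  rfl

lemma coordDeriv_const_smul {f : (Fin N → Rn n) → ℂ} (hf : Differentiable ℝ f) (a : ℝ)
    (c : Fin N × Fin n) : coordDeriv c (a • f) = a • coordDeriv c f := by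
  rw [coordDeriv_eq_fderiv (hf.const_smul a), coordDeriv_eq_fderiv hf]
  funext Ξ
  rw [fderiv_const_smul (hf Ξ)]
  rfl

lemma coordDeriv_mul {f g : (Fin N → Rn n) → ℂ} (hf : Differentiable ℝ f)
    (hg : Differentiable ℝ g) (c : Fin N × Fin n) :
    coordDeriv c (f * g) = coordDeriv c f * g + f * coordDeriv c g := by
  rw [coordDeriv_eq_fderiv (hf.mul hg), coordDeriv_eq_fderiv hf, coordDeriv_eq_fderiv hg]
  funext Ξ
  rw [fderiv_mul (hf Ξ) (hg Ξ)]
  simp only [add_apply, smul_apply, smul_eq_mul,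
    Pi.add_apply, Pi.mul_apply]
  ring

lemma wordDeriv_add {f g : (Fin N → Rn n) → ℂ} (hf : ContDiff ℝ ∞ f) (hg : ContDiff ℝ ∞ g)
    (l : List (Fin N × Fin n)) : wordDeriv l (f + g) = wordDeriv l f + wordDeriv l g := by
  induction l with
  | nil => rfl
  | cons c l ih =>
    rw [wordDeriv_cons, ih, coordDeriv_add ((contDiff_wordDeriv hf l).differentiable (by simp))
      ((contDiff_wordDeriv hg l).differentiable (by simp))]
    rfl

lemma wordDeriv_const_smul {f : (Fin N → Rn n) → ℂ} (hf : ContDiff ℝ ∞ f) (a : ℝ)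
    (l : List (Fin N × Fin n)) : wordDeriv l (a • f) = a • wordDeriv l f := by
  induction l with
  | nil => rfl
  | cons c l ih =>
    rw [wordDeriv_cons, ih,
      coordDeriv_const_smul ((contDiff_wordDeriv hf l).differentiable (by simp))]
    rfl

lemma wordDeriv_sum {ι : Type*} (s : Finset ι) {f : ι → (Fin N → Rn n) → ℂ}
    (hf : ∀ i, ContDiff ℝ ∞ (f i)) (l : List (Fin N × Fin n)) :
    wordDeriv l (∑ i ∈ s, f i) = ∑ i ∈ s, wordDeriv l (f i) := by
  classical
  have h0 : wordDeriv l (0 : (Fin N → Rn n) → ℂ) = 0 := by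
    have := wordDeriv_const_smul (f := (0 : (Fin N → Rn n) → ℂ)) contDiff_const 0 l
    simpa using this
  induction s using Finset.induction_on with
  | empty => simpa using h0
  | insert i s hi ih =>
    rw [Finset.sum_insert hi, Finset.sum_insert hi, wordDeriv_add (hf i) ?_, ih]
    have : (∑ i ∈ s, f i) = fun Ξ => ∑ i ∈ s, f i Ξ := by
      funext Ξ
      simp
    rw [this]
    exact ContDiff.sum fun i _ => hf i

/-- `f` obeys the symbol-type bounds `|∂_l f(Ξ)| ≤ A r^{|l|}` at `Ξ` for words of length `≤ s`. -/
def WordBound (s : ℕ) (A r : ℝ) (f : (Fin N → Rn n) → ℂ) (Ξ : Fin N → Rn n) : Prop :=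
  ∀ l : List (Fin N × Fin n), l.length ≤ s → ‖wordDeriv l f Ξ‖ ≤ A * r ^ l.length

lemma WordBound.coordDeriv {s : ℕ} {A r : ℝ} {f : (Fin N → Rn n) → ℂ} {Ξ : Fin N → Rn n}
    (h : WordBound (s + 1) A r f Ξ) (c : Fin N × Fin n) :
    WordBound s (A * r) r (coordDeriv c f) Ξ := by
  intro l hl
  have := h (l ++ [c]) (by simpa using hl)
  rw [wordDeriv_append] at this
  refine this.trans (le_of_eq ?_)
  rw [List.length_append, List.length_singleton, pow_succ]
  ring

lemma WordBound.mono {s s' : ℕ} {A r : ℝ} {f : (Fin N → Rn n) → ℂ} {Ξ : Fin N → Rn n}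
    (h : WordBound s A r f Ξ) (hs : s' ≤ s) : WordBound s' A r f Ξ :=
  fun l hl => h l (hl.trans hs)

/-- The Leibniz rule in the form of symbol-type bounds. -/
lemma WordBound.mul {s : ℕ} {A B r : ℝ} {f g : (Fin N → Rn n) → ℂ} {Ξ : Fin N → Rn n}
    (hf : ContDiff ℝ ∞ f) (hg : ContDiff ℝ ∞ g) (hfb : WordBound s A r f Ξ)
    (hgb : WordBound s B r g Ξ) : WordBound s (A * B) (2 * r) (f * g) Ξ := by
  intro l
  induction l using List.reverseRecOn generalizing s A B f g with
  | nil =>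
    intro _
    have h1 := hfb [] (by simp)
    have h2 := hgb [] (by simp)
    simp only [wordDeriv_nil, List.length_nil, pow_zero, mul_one] at h1 h2
    simpa using mul_le_mul h1 h2 (norm_nonneg _) ((norm_nonneg _).trans h1)
  | append_singleton l c ih =>
    intro hl
    obtain ⟨s, rfl⟩ : ∃ s', s = s' + 1 := ⟨s - 1, by simp at hl; omega⟩
    have hl' : l.length ≤ s := by simpa using hl
    have e1 := ih (contDiff_coordDeriv hf c) hg (hfb.coordDeriv c) (hgb.mono s.le_succ) hl'
    have e2 := ih hf (contDiff_coordDeriv hg c) (hfb.mono s.le_succ) (hgb.coordDeriv c) hl'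
    rw [wordDeriv_append, wordDeriv_cons, wordDeriv_nil,
      coordDeriv_mul (hf.differentiable (by simp)) (hg.differentiable (by simp)),
      wordDeriv_add (f := MultilinPsdo.coordDeriv c f * g) (g := f * MultilinPsdo.coordDeriv c g)
        ((contDiff_coordDeriv hf c).mul hg) (hf.mul (contDiff_coordDeriv hg c))]
    refine (norm_add_le _ _).trans ((add_le_add e1 e2).trans (le_of_eq ?_))
    rw [List.length_append, List.length_singleton, pow_succ]
    ring

lemma tsupport_coordDeriv_subset {f : (Fin N → Rn n) → ℂ} (hf : Differentiable ℝ f)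
    (c : Fin N × Fin n) : tsupport (coordDeriv c f) ⊆ tsupport f := by
  rw [coordDeriv_eq_fderiv hf]
  exact tsupport_fderiv_apply_subset ℝ _

lemma tsupport_wordDeriv_subset {f : (Fin N → Rn n) → ℂ} (hf : ContDiff ℝ ∞ f)
    (l : List (Fin N × Fin n)) : tsupport (wordDeriv l f) ⊆ tsupport f := by
  induction l with
  | nil => exact subset_rfl
  | cons c l ih =>
    exact (tsupport_coordDeriv_subset ((contDiff_wordDeriv hf l).differentiable (by simp)) c).trans
      ih

lemma wordDeriv_comp_smul {f : (Fin N → Rn n) → ℂ} (hf : ContDiff ℝ ∞ f) (t : ℝ)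
    (l : List (Fin N × Fin n)) (Ξ : Fin N → Rn n) :
    wordDeriv l (fun Ξ => f (t • Ξ)) Ξ = t ^ l.length • wordDeriv l f (t • Ξ) := by
  induction l generalizing Ξ with
  | nil => simp
  | cons c l ih =>
    have hd := contDiff_wordDeriv hf l
    have hd' : Differentiable ℝ (wordDeriv l f) := hd.differentiable (by simp)
    have e : wordDeriv l (fun Ξ => f (t • Ξ)) =
        t ^ l.length • fun Ξ => wordDeriv l f (t • Ξ) := by
      funext Ξ
      rw [ih]
      rfl
    have hc : Differentiable ℝ fun Ξ : Fin N → Rn n => wordDeriv l f (t • Ξ) :=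
      hd'.comp (differentiable_id.const_smul t)
    rw [wordDeriv_cons, wordDeriv_cons, e, coordDeriv_const_smul hc, coordDeriv_eq_fderiv hc,
      coordDeriv_eq_fderiv hd']
    have : fderiv ℝ (fun Ξ => wordDeriv l f (t • Ξ)) Ξ (coordVec c) =
        t • fderiv ℝ (wordDeriv l f) (t • Ξ) (coordVec c) := by
      rw [fderiv_comp_smul]
      rfl
    simp only [Pi.smul_apply, this, List.length_cons, pow_succ, mul_smul]

/-- All derivatives up to a given order of a smooth compactly supported function are bounded. -/
lemma exists_wordDeriv_bound {f : (Fin N → Rn n) → ℂ} (hf : ContDiff ℝ ∞ f)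
    (hs : HasCompactSupport f) (s : ℕ) :
    ∃ C : ℝ, 0 ≤ C ∧ ∀ l : List (Fin N × Fin n), l.length ≤ s → ∀ Ξ, ‖wordDeriv l f Ξ‖ ≤ C := by
  have h1 : ∀ l : List (Fin N × Fin n), ∃ C : ℝ, ∀ Ξ, ‖wordDeriv l f Ξ‖ ≤ C := fun l =>
    (hs.mono' ((subset_tsupport _).trans (tsupport_wordDeriv_subset hf l))
      ).exists_bound_of_continuous (contDiff_wordDeriv hf l).continuous
  choose C hC using h1
  have hfin : Set.Finite {l : List (Fin N × Fin n) | l.length ≤ s} := List.finite_length_le _ _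
  refine ⟨∑ l ∈ hfin.toFinset, |C l|, Finset.sum_nonneg fun _ _ => abs_nonneg _,
    fun l hl Ξ => (hC l Ξ).trans ((le_abs_self _).trans ?_)⟩
  exact Finset.single_le_sum (f := fun l => |C l|) (fun _ _ => abs_nonneg _) (by simpa using hl)

/-! ### Plancherel's identity for integrable square-integrable functions -/


section Plancherel

open FourierTransform

variable {E : Type*} [NormedAddCommGroup E] [InnerProductSpace ℝ E] [FiniteDimensional ℝ E]
  [MeasurableSpace E] [BorelSpace E]

lemma integral_fourier_smul_schwartz {f : E → ℂ} (hf : Integrable f) (g : 𝓢(E, ℂ)) :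
    ∫ ξ, g ξ • 𝓕 f ξ = ∫ x, 𝓕 g x • f x := by
  have := VectorFourier.integral_fourierIntegral_smul_eq_flip (L := innerₗ E) (f := f)
    (g := (g : E → ℂ)) (μ := volume) (ν := volume) Real.continuous_fourierChar
    continuous_inner hf g.integrable
  rw [flip_innerₗ] at this
  simp only [smul_eq_mul] at this ⊢
  simp_rw [mul_comm (g _), mul_comm (𝓕 g _)]
  exact this

/-- On `L¹ ∩ L²` the Fourier integral represents the `L²` Fourier transform. -/
lemma fourier_toLp_ae_eq {f : E → ℂ} (hf : Integrable f) (hf2 : MemLp f 2) :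
    ⇑(𝓕 (hf2.toLp f) : Lp ℂ 2 (volume : Measure E)) =ᵐ[volume] 𝓕 f := by
  refine ae_eq_of_integral_contDiff_smul_eq ((Lp.memLp _).locallyIntegrable one_le_two)
    ?_ fun φ hφ hφs => ?_
  · refine Continuous.locallyIntegrable ?_
    exact VectorFourier.fourierIntegral_continuous Real.continuous_fourierChar
      continuous_inner hf
  · have hg₁ : HasCompactSupport (Complex.ofRealCLM ∘ φ) := hφs.comp_left rfl
    have hg₂ : ContDiff ℝ ∞ (Complex.ofRealCLM ∘ φ) := by fun_prop
    set g : 𝓢(E, ℂ) := hg₁.toSchwartzMap hg₂ with hgdef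
    have hg : ∀ x, g x = (φ x : ℂ) := fun x => rfl
    have h1 : ∀ u : E → ℂ, ∫ x, φ x • u x = ∫ x, g x • u x := by
      intro u
      simp only [hg]
      rfl
    rw [h1, h1, integral_fourier_smul_schwartz hf g,
      ← Lp.toTemperedDistribution_apply (𝓕 (hf2.toLp f)) g,
      ← Lp.fourier_toTemperedDistribution_eq, TemperedDistribution.fourier_apply,
      Lp.toTemperedDistribution_apply]
    refine integral_congr_ae ?_
    filter_upwards [hf2.coeFn_toLp] with x hx
    rw [hx]

lemma eLpNorm_fourier_eq {f : E → ℂ} (hf : Integrable f) (hf2 : MemLp f 2) :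
    eLpNorm (𝓕 f) 2 volume = eLpNorm f 2 volume := by
  rw [← eLpNorm_congr_ae (fourier_toLp_ae_eq hf hf2), ← eLpNorm_congr_ae hf2.coeFn_toLp,
    ← Lp.enorm_def, ← Lp.enorm_def, ← ofReal_norm, ← ofReal_norm,
    Lp.norm_fourier_eq]

lemma enorm_fourier_le (f : E → ℂ) (ξ : E) : ‖𝓕 f ξ‖ₑ ≤ ∫⁻ x, ‖f x‖ₑ := by
  rw [Real.fourier_eq]
  refine (enorm_integral_le_lintegral_enorm _).trans (le_of_eq ?_)
  refine lintegral_congr fun x => ?_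
  rw [← ofReal_norm, ← ofReal_norm, Circle.norm_smul]

/-- Local integrability of Fourier transforms of `L^p` functions, `1 ≤ p ≤ 2`, with the same
dependence on `|B|` as the one given by the inequalities of Hausdorff–Young and Hölder. The
function is truncated at the height `‖f‖_p |B|^{1/p}`; the trivial `L¹ → L^∞` bound applies to the
large part and Plancherel's theorem to the small part. -/
lemma setLIntegral_enorm_fourier_le {f : E → ℂ} (hfm : StronglyMeasurable f) (hf : Integrable f)
    {p : ℝ} (hp1 : 1 ≤ p) (hp2 : p ≤ 2) (hfp : ∫⁻ x, ‖f x‖ₑ ^ p ≠ ⊤) (B : Set E)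
    (hB : volume B ≠ ⊤) :
    ∫⁻ ξ in B, ‖𝓕 f ξ‖ₑ ≤ 2 * (volume B ^ (1 / p) * (∫⁻ x, ‖f x‖ₑ ^ p) ^ (1 / p)) := by
  have hp0 : 0 < p := by linarith
  set V := volume B with hV
  set F := (∫⁻ x, ‖f x‖ₑ ^ p) ^ (1 / p) with hF
  have hFp : F ^ p = ∫⁻ x, ‖f x‖ₑ ^ p := by
    rw [hF, ← ENNReal.rpow_mul, one_div_mul_cancel hp0.ne', ENNReal.rpow_one]
  have hFtop : F ≠ ⊤ := ENNReal.rpow_ne_top_of_nonneg (by positivity) hfp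
  have hmeas : Measurable fun x => ‖f x‖ₑ := hfm.enorm
  rcases eq_or_ne V 0 with hV0 | hV0
  · rw [Measure.restrict_eq_zero.2 hV0]
    simp
  rcases eq_or_ne F 0 with hF0 | hF0
  · have h0 : ∫⁻ x, ‖f x‖ₑ ^ p = 0 := by rw [← hFp, hF0, ENNReal.zero_rpow_of_pos hp0]
    have h1 : ∫⁻ x, ‖f x‖ₑ = 0 := by
      rw [lintegral_eq_zero_iff (hmeas.pow_const p)] at h0
      rw [lintegral_eq_zero_iff hmeas]
      filter_upwards [h0] with x hx
      simpa [hp0, hp0.not_gt] using hx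
    have h2 : ∀ ξ, ‖𝓕 f ξ‖ₑ = 0 := fun ξ => le_antisymm (h1 ▸ enorm_fourier_le f ξ) zero_le
    simp [h2]
  set L := F * V ^ (1 / p) with hL
  have hVp0 : V ^ (1 / p) ≠ 0 := by simp [hV0, hB]
  have hVpt : V ^ (1 / p) ≠ ⊤ := ENNReal.rpow_ne_top_of_nonneg (by positivity) hB
  have hL0 : L ≠ 0 := mul_ne_zero hF0 hVp0
  have hLt : L ≠ ⊤ := ENNReal.mul_ne_top hFtop hVpt
  have hLpow : ∀ s : ℝ, L ^ s = F ^ s * V ^ (s / p) := by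
    intro s
    rw [hL, ENNReal.mul_rpow_of_ne_top hFtop hVpt, ← ENNReal.rpow_mul V, one_div_mul_eq_div]
  set A : Set E := {x | L < ‖f x‖ₑ} with hA
  have hAm : MeasurableSet A := measurableSet_lt measurable_const hmeas
  set f1 := A.indicator f with hf1
  set f2 := Aᶜ.indicator f with hf2
  have hi1 : Integrable f1 := hf.indicator hAm
  have hi2 : Integrable f2 := hf.indicator hAm.compl
  have hsum : f = f1 + f2 := (Set.indicator_self_add_compl A f).symm
  -- the part above the height `L`
  have e1 : ∫⁻ x, ‖f1 x‖ₑ ≤ L ^ (1 - p) * F ^ p := by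
    rw [hFp, ← lintegral_const_mul _ (hmeas.pow_const p)]
    refine lintegral_mono fun x => ?_
    by_cases hx : x ∈ A
    · have hx' : L < ‖f x‖ₑ := hx
      have hx0 : ‖f x‖ₑ ≠ 0 := (hx'.trans_le' zero_le).ne'
      rw [hf1, Set.indicator_of_mem hx]
      calc ‖f x‖ₑ = ‖f x‖ₑ ^ (1 - p) * ‖f x‖ₑ ^ p := by
            rw [← ENNReal.rpow_add _ _ hx0 enorm_ne_top]; simp
        _ ≤ L ^ (1 - p) * ‖f x‖ₑ ^ p := by
            gcongr ?_ * _
            rw [show 1 - p = -(p - 1) by ring, ENNReal.rpow_neg, ENNReal.rpow_neg,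
              ENNReal.inv_le_inv]
            exact ENNReal.rpow_le_rpow hx'.le (by linarith)
    · rw [hf1, Set.indicator_of_notMem hx]
      simp
  -- the part below the height `L`
  have e2 : ∫⁻ x, ‖f2 x‖ₑ ^ (2 : ℝ) ≤ L ^ (2 - p) * F ^ p := by
    rw [hFp, ← lintegral_const_mul _ (hmeas.pow_const p)]
    refine lintegral_mono fun x => ?_
    by_cases hx : x ∈ A
    · rw [hf2, Set.indicator_of_notMem (by simpa using hx)]
      simp
    · have hx' : ‖f x‖ₑ ≤ L := not_lt.1 hx
      rw [hf2, Set.indicator_of_mem (by simpa using hx)]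
      calc ‖f x‖ₑ ^ (2 : ℝ) = ‖f x‖ₑ ^ (2 - p) * ‖f x‖ₑ ^ p := by
            rw [← ENNReal.rpow_add_of_nonneg _ _ (by linarith) hp0.le]; simp
        _ ≤ L ^ (2 - p) * ‖f x‖ₑ ^ p := by
            gcongr ?_ * _
            exact ENNReal.rpow_le_rpow hx' (by linarith)
  have hm2 : MemLp f2 2 := by
    refine ⟨hi2.aestronglyMeasurable, ?_⟩
    rw [eLpNorm_eq_lintegral_rpow_enorm_toReal (by simp) (by simp)]
    refine ENNReal.rpow_lt_top_of_nonneg (by simp) (ne_top_of_le_ne_top ?_ e2)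
    exact ENNReal.mul_ne_top (ENNReal.rpow_ne_top_of_nonneg (by linarith) hLt)
      (ENNReal.rpow_ne_top_of_nonneg hp0.le hFtop)
  have hcont : ∀ g : E → ℂ, Integrable g → Continuous (𝓕 g) := fun g hg =>
    VectorFourier.fourierIntegral_continuous Real.continuous_fourierChar continuous_inner hg
  have hadd : ∀ ξ, 𝓕 f ξ = 𝓕 f1 ξ + 𝓕 f2 ξ := by
    intro ξ
    have h1 := (Real.fourierIntegral_convergent_iff ξ).2 hi1
    have h2 := (Real.fourierIntegral_convergent_iff ξ).2 hi2
    rw [hsum, Real.fourier_eq, Real.fourier_eq, Real.fourier_eq, ← integral_add h1 h2]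
    simp only [Pi.add_apply, smul_add]
  have b1 : ∫⁻ ξ in B, ‖𝓕 f1 ξ‖ₑ ≤ V ^ (1 / p) * F := by
    calc ∫⁻ ξ in B, ‖𝓕 f1 ξ‖ₑ ≤ ∫⁻ _ in B, L ^ (1 - p) * F ^ p :=
          lintegral_mono fun ξ => (enorm_fourier_le f1 ξ).trans e1
      _ = F ^ (1 - p) * V ^ ((1 - p) / p) * F ^ p * V ^ (1 : ℝ) := by
          rw [lintegral_const, Measure.restrict_apply_univ, hLpow, ENNReal.rpow_one]
      _ = (V ^ ((1 - p) / p) * V ^ (1 : ℝ)) * (F ^ (1 - p) * F ^ p) := by ring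
      _ = V ^ (1 / p) * F := by
          rw [← ENNReal.rpow_add _ _ hV0 hB, ← ENNReal.rpow_add _ _ hF0 hFtop]
          congr 1
          · congr 1
            field_simp
            ring
          · simp
  have b2 : ∫⁻ ξ in B, ‖𝓕 f2 ξ‖ₑ ≤ V ^ (1 / p) * F := by
    have hpl : (∫⁻ ξ, ‖𝓕 f2 ξ‖ₑ ^ (2 : ℝ)) = ∫⁻ x, ‖f2 x‖ₑ ^ (2 : ℝ) := by
      have := eLpNorm_fourier_eq hi2 hm2
      rw [eLpNorm_eq_lintegral_rpow_enorm_toReal (by simp) (by simp),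
        eLpNorm_eq_lintegral_rpow_enorm_toReal (by simp) (by simp)] at this
      simpa using ENNReal.rpow_left_injective (by norm_num : (1 / (2 : ℝ)) ≠ 0) this
    have hCS := ENNReal.lintegral_mul_le_Lp_mul_Lq (volume.restrict B)
      (p := 2) (q := 2) (f := fun ξ => ‖𝓕 f2 ξ‖ₑ) (g := fun _ => 1)
      Real.HolderConjugate.two_two (hcont f2 hi2).enorm.aemeasurable aemeasurable_const
    simp only [Pi.mul_apply, mul_one, ENNReal.one_rpow, lintegral_const,
      Measure.restrict_apply_univ, one_mul] at hCS
    calc ∫⁻ ξ in B, ‖𝓕 f2 ξ‖ₑ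
        ≤ (∫⁻ ξ in B, ‖𝓕 f2 ξ‖ₑ ^ (2 : ℝ)) ^ (1 / (2 : ℝ)) * V ^ (1 / (2 : ℝ)) := hCS
      _ ≤ (L ^ (2 - p) * F ^ p) ^ (1 / (2 : ℝ)) * V ^ (1 / (2 : ℝ)) := by
          gcongr
          exact (setLIntegral_le_lintegral _ _).trans (hpl.trans_le e2)
      _ = (V ^ ((2 - p) / p) * V ^ (1 : ℝ) * (F ^ (2 - p) * F ^ p)) ^ (1 / (2 : ℝ)) := by
          rw [← ENNReal.mul_rpow_of_nonneg _ _ (by norm_num), hLpow, ENNReal.rpow_one]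
          congr 1
          ring
      _ = V ^ (1 / p) * F := by
          rw [← ENNReal.rpow_add _ _ hV0 hB, ← ENNReal.rpow_add _ _ hF0 hFtop,
            ENNReal.mul_rpow_of_nonneg _ _ (by norm_num), ← ENNReal.rpow_mul, ← ENNReal.rpow_mul]
          congr 1
          · congr 1
            field_simp
            ring
          · simp
  calc ∫⁻ ξ in B, ‖𝓕 f ξ‖ₑ ≤ ∫⁻ ξ in B, (‖𝓕 f1 ξ‖ₑ + ‖𝓕 f2 ξ‖ₑ) :=
        lintegral_mono fun ξ => by rw [hadd]; exact enorm_add_le _ _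
    _ = (∫⁻ ξ in B, ‖𝓕 f1 ξ‖ₑ) + ∫⁻ ξ in B, ‖𝓕 f2 ξ‖ₑ :=
        lintegral_add_left (hcont f1 hi1).enorm.measurable _
    _ ≤ 2 * (V ^ (1 / p) * F) := by
        rw [two_mul]
        exact add_le_add b1 b2

end Plancherel

/-! ### Fourier transforms of Schwartz functions and integration by parts -/


section FourierSchwartz

open FourierTransform LineDeriv SchwartzMap

variable {n : ℕ}

/-- The dilation `ξ ↦ ξ / 2π`, which relates the two normalizations of the Fourier transform. -/
def fourierScale (n : ℕ) : Rn n ≃L[ℝ] Rn n :=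
  (LinearEquiv.smulOfNeZero ℝ (Rn n) (2 * Real.pi)⁻¹
    (inv_ne_zero Real.two_pi_pos.ne')).toContinuousLinearEquiv

lemma fourierScale_apply (ξ : Rn n) : fourierScale n ξ = (2 * Real.pi)⁻¹ • ξ := rfl

/-- `fourierT` as a map of the Schwartz space into itself. -/
def fourierS (h : 𝓢(Rn n, ℂ)) : 𝓢(Rn n, ℂ) :=
  compCLMOfContinuousLinearEquiv ℂ (fourierScale n) (𝓕 h)

lemma fourierS_apply' (h : 𝓢(Rn n, ℂ)) (ξ : Rn n) :
    fourierS h ξ = 𝓕 (h : Rn n → ℂ) ((2 * Real.pi)⁻¹ • ξ) := rfl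

lemma fourierS_apply (h : 𝓢(Rn n, ℂ)) (ξ : Rn n) : fourierS h ξ = fourierT h ξ := by
  rw [fourierS_apply', Real.fourier_eq', fourierT]
  refine integral_congr_ae (Eventually.of_forall fun y => ?_)
  simp only [smul_eq_mul]
  rw [mul_comm]
  congr 2
  rw [inner_smul_right, real_inner_comm y ξ]
  push_cast
  have : (Real.pi : ℂ) ≠ 0 := by exact_mod_cast Real.pi_ne_zero
  field_simp

/-- The coordinate vectors of `ℝⁿ`. -/
def unitVec (c : Fin n) : Rn n := EuclideanSpace.single c 1

/-- The operator `1 - s² Δ` on Schwartz functions. -/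
def besselOp (s : ℝ) (ψ : 𝓢(Rn n, ℂ)) : 𝓢(Rn n, ℂ) :=
  ψ - s ^ 2 • ∑ c : Fin n, ∂_{unitVec c} (∂_{unitVec c} ψ)

/-- The weight `1 + s²|y|²`. -/
def besselWeight (s : ℝ) (y : Rn n) : ℝ := 1 + ‖s • y‖ ^ 2

lemma lineDeriv_fourierS (h : 𝓢(Rn n, ℂ)) (c : Fin n) :
    ∂_{unitVec c} (fourierS h) =
      fourierS (-Complex.I • smulLeftCLM ℂ (fun y : Rn n => inner ℝ y (unitVec c)) h) := by
  have h1 : (fun y : Rn n => inner ℝ y (fourierScale n (unitVec c))).HasTemperateGrowth := by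
    fun_prop
  have h2 : (fun y : Rn n => inner ℝ y (unitVec c)).HasTemperateGrowth := by fun_prop
  unfold fourierS
  rw [lineDerivOp_compCLMOfContinuousLinearEquiv, lineDerivOp_fourier_eq]
  congr 2
  ext y
  rw [_root_.smul_apply, _root_.smul_apply, smulLeftCLM_apply_apply h1,
    smulLeftCLM_apply_apply h2]
  simp only [fourierScale_apply, inner_smul_right, smul_eq_mul, Complex.real_smul]
  push_cast
  have : (Real.pi : ℂ) ≠ 0 := by exact_mod_cast Real.pi_ne_zero
  field_simp

lemma norm_sq_eq_sum_inner (y : Rn n) : ‖y‖ ^ 2 = ∑ c, inner ℝ y (unitVec c) ^ 2 := by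
  rw [EuclideanSpace.norm_sq_eq]
  refine Finset.sum_congr rfl fun c _ => ?_
  simp [unitVec, EuclideanSpace.inner_single_right]

lemma hasTemperateGrowth_besselWeight (s : ℝ) :
    (besselWeight s : Rn n → ℝ).HasTemperateGrowth := by
  unfold besselWeight
  simp_rw [norm_smul, mul_pow]
  fun_prop

lemma fourierS_add (g h : 𝓢(Rn n, ℂ)) : fourierS (g + h) = fourierS g + fourierS h := by
  unfold fourierS
  rw [FourierTransform.fourier_add, map_add]

lemma fourierS_smul (a : ℂ) (h : 𝓢(Rn n, ℂ)) : fourierS (a • h) = a • fourierS h := by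
  unfold fourierS
  rw [FourierTransform.fourier_smul, map_smul]

lemma fourierS_sum {ι : Type*} (t : Finset ι) (h : ι → 𝓢(Rn n, ℂ)) :
    fourierS (∑ i ∈ t, h i) = ∑ i ∈ t, fourierS (h i) := by
  classical
  induction t using Finset.induction_on with
  | empty => simpa using fourierS_smul 0 (0 : 𝓢(Rn n, ℂ))
  | insert i t hi ih => rw [Finset.sum_insert hi, Finset.sum_insert hi, fourierS_add, ih]

/-- On the Fourier side the operator `1 - s² Δ` is multiplication by `1 + s²|y|²`. -/
lemma besselOp_fourierS (s : ℝ) (h : 𝓢(Rn n, ℂ)) :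
    besselOp s (fourierS h) = fourierS (smulLeftCLM ℂ (besselWeight s) h) := by
  have h2 : ∀ c, (fun y : Rn n => inner ℝ y (unitVec c)).HasTemperateGrowth := fun c => by fun_prop
  have key : smulLeftCLM ℂ (besselWeight s) h = h + (-(s : ℂ) ^ 2) • ∑ c,
      (-Complex.I • smulLeftCLM ℂ (fun y : Rn n => inner ℝ y (unitVec c))
        (-Complex.I • smulLeftCLM ℂ (fun y : Rn n => inner ℝ y (unitVec c)) h)) := by
    ext y
    rw [smulLeftCLM_apply_apply (hasTemperateGrowth_besselWeight s)]
    simp only [_root_.add_apply, _root_.smul_apply, _root_.sum_apply,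
      smulLeftCLM_apply_apply (h2 _), smul_eq_mul, Complex.real_smul]
    have hsum : ∑ c, -Complex.I * (((inner ℝ y (unitVec c) : ℝ) : ℂ) *
        (-Complex.I * (((inner ℝ y (unitVec c) : ℝ) : ℂ) * h y))) = -((‖y‖ ^ 2 : ℝ) : ℂ) * h y := by
      rw [norm_sq_eq_sum_inner]
      push_cast
      rw [← Finset.sum_neg_distrib, Finset.sum_mul]
      refine Finset.sum_congr rfl fun c _ => ?_
      linear_combination ((inner ℝ y (unitVec c) : ℝ) : ℂ) ^ 2 * h y * Complex.I_sq
    rw [hsum]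
    unfold besselWeight
    rw [norm_smul, mul_pow, Real.norm_eq_abs, sq_abs]
    push_cast
    ring
  rw [key, fourierS_add, fourierS_smul, fourierS_sum]
  unfold besselOp
  simp_rw [lineDeriv_fourierS]
  ext y
  simp only [_root_.sub_apply, _root_.add_apply, _root_.smul_apply,
    smul_eq_mul, Complex.real_smul]
  push_cast
  ring

/-- Division of a Schwartz function by `(1 + s²|y|²)^k`. -/
def besselDiv (s : ℝ) (k : ℕ) (v : 𝓢(Rn n, ℂ)) : 𝓢(Rn n, ℂ) :=
  smulLeftCLM ℂ (fun y => besselWeight s y ^ (-(k : ℝ))) v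

lemma besselWeight_pos (s : ℝ) (y : Rn n) : 0 < besselWeight s y := by
  unfold besselWeight
  positivity

lemma hasTemperateGrowth_besselWeight_rpow (s r : ℝ) :
    (fun y : Rn n => besselWeight s y ^ r).HasTemperateGrowth :=
  Function.HasTemperateGrowth.comp (Function.hasTemperateGrowth_one_add_norm_sq_rpow (Rn n) r)
    (s • ContinuousLinearMap.id ℝ (Rn n)).hasTemperateGrowth

lemma besselDiv_apply (s : ℝ) (k : ℕ) (v : 𝓢(Rn n, ℂ)) (y : Rn n) :
    besselDiv s k v y = ((besselWeight s y ^ k)⁻¹ : ℝ) • v y := by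
  rw [besselDiv, smulLeftCLM_apply_apply (hasTemperateGrowth_besselWeight_rpow s _),
    Real.rpow_neg (besselWeight_pos s y).le, Real.rpow_natCast]

lemma fourierS_eq_iterate_besselOp (s : ℝ) (k : ℕ) (v : 𝓢(Rn n, ℂ)) :
    fourierS v = (besselOp s)^[k] (fourierS (besselDiv s k v)) := by
  induction k with
  | zero =>
    congr 1
    ext y
    simp [besselDiv_apply]
  | succ k ih =>
    rw [Function.iterate_succ_apply, besselOp_fourierS, ih]
    congr 2
    ext y
    rw [smulLeftCLM_apply_apply (hasTemperateGrowth_besselWeight s), besselDiv_apply,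
      besselDiv_apply, smul_smul]
    congr 1
    have := (besselWeight_pos s y).ne'
    field_simp
    ring

/-- The bound of `setLIntegral_enorm_fourier_le` in the normalization of `fourierT`. -/
lemma setLIntegral_enorm_fourierS_le (h : 𝓢(Rn n, ℂ)) {p : ℝ} (hp1 : 1 ≤ p) (hp2 : p ≤ 2)
    (R : ℝ) :
    ∫⁻ ξ in Metric.closedBall 0 R, ‖fourierS h ξ‖ₑ ≤
      ENNReal.ofReal ((2 * Real.pi) ^ n) * (2 * (volume (Metric.closedBall (0 : Rn n) R) ^ (1 / p) *
        (∫⁻ x, ‖h x‖ₑ ^ p) ^ (1 / p))) := by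
  have hp0 : 0 < p := by linarith
  set c : ℝ := (2 * Real.pi)⁻¹ with hc
  have hc0 : 0 < c := by positivity
  have hc1 : c ≤ 1 := by
    rw [hc]
    refine inv_le_one_of_one_le₀ ?_
    linarith [Real.two_le_pi]
  have hfp : ∫⁻ x, ‖h x‖ₑ ^ p ≠ ⊤ := by
    have := (h.memLp (ENNReal.ofReal p) volume).2
    rw [eLpNorm_eq_lintegral_rpow_enorm_toReal (by simpa using hp0) (by simp),
      ENNReal.toReal_ofReal hp0.le] at this
    intro htop
    rw [htop, ENNReal.top_rpow_of_pos (by positivity)] at this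
    exact lt_irrefl _ this
  have hcont : Continuous (𝓕 (h : Rn n → ℂ)) := (𝓕 h).continuous
  have hmap : ∫⁻ ξ in Metric.closedBall (0 : Rn n) R, ‖fourierS h ξ‖ₑ ≤
      ∫⁻ ξ, ((Metric.closedBall (0 : Rn n) R).indicator (fun ξ => ‖𝓕 (h : Rn n → ℂ) ξ‖ₑ))
        (c • ξ) := by
    rw [← lintegral_indicator measurableSet_closedBall]
    refine lintegral_mono fun ξ => ?_
    by_cases hξ : ξ ∈ Metric.closedBall (0 : Rn n) R
    · have hξ' : c • ξ ∈ Metric.closedBall (0 : Rn n) R := by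
        rw [mem_closedBall_zero_iff] at hξ ⊢
        rw [norm_smul, Real.norm_of_nonneg hc0.le]
        exact (mul_le_of_le_one_left (norm_nonneg _) hc1).trans hξ
      rw [Set.indicator_of_mem hξ, Set.indicator_of_mem hξ', fourierS_apply']
    · rw [Set.indicator_of_notMem hξ]
      exact zero_le
  have hm : Measurable
      ((Metric.closedBall (0 : Rn n) R).indicator (fun ξ => ‖𝓕 (h : Rn n → ℂ) ξ‖ₑ)) :=
    hcont.enorm.measurable.indicator measurableSet_closedBall
  refine hmap.trans ?_
  have hsub : ∫⁻ ξ, ((Metric.closedBall (0 : Rn n) R).indicator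
      (fun ξ => ‖𝓕 (h : Rn n → ℂ) ξ‖ₑ)) (c • ξ) = ENNReal.ofReal ((2 * Real.pi) ^ n) *
        ∫⁻ ξ in Metric.closedBall (0 : Rn n) R, ‖𝓕 (h : Rn n → ℂ) ξ‖ₑ := by
    rw [← lintegral_map hm (measurable_const_smul c), Measure.map_addHaar_smul _ hc0.ne',
      lintegral_smul_measure, lintegral_indicator measurableSet_closedBall]
    congr 2
    rw [finrank_euclideanSpace_fin, abs_of_nonneg (by positivity), hc, inv_pow, inv_inv]
  rw [hsub]
  gcongr
  exact setLIntegral_enorm_fourier_le h.continuous.stronglyMeasurable h.integrable hp1 hp2 hfp _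
    measure_closedBall_lt_top.ne

end FourierSchwartz

section IntegrationByParts

open LineDeriv SchwartzMap

variable {n N : ℕ}

/-- The tensor product `∏_j φ_j(ξ_j)`. -/
def tensor (φ : Fin N → 𝓢(Rn n, ℂ)) (Ξ : Fin N → Rn n) : ℂ := ∏ j, φ j (Ξ j)

lemma tensor_update (φ : Fin N → 𝓢(Rn n, ℂ)) (j : Fin N) (ψ : 𝓢(Rn n, ℂ)) (Ξ : Fin N → Rn n) :
    tensor (Function.update φ j ψ) Ξ = ψ (Ξ j) * ∏ l ∈ Finset.univ.erase j, φ l (Ξ l) := by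
  unfold tensor
  rw [← Finset.mul_prod_erase _ _ (Finset.mem_univ j), Function.update_self]
  congr 1
  refine Finset.prod_congr rfl fun l hl => ?_
  rw [Function.update_of_ne (Finset.ne_of_mem_erase hl)]

lemma continuous_tensor (φ : Fin N → 𝓢(Rn n, ℂ)) : Continuous (tensor φ) := by
  unfold tensor
  exact continuous_finsetProd _ fun j _ => (φ j).continuous.comp (continuous_apply j)

lemma hasLineDerivAt_tensor (φ : Fin N → 𝓢(Rn n, ℂ)) (j : Fin N) (c : Fin n)
    (ψ : 𝓢(Rn n, ℂ)) (Ξ : Fin N → Rn n) :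
    HasLineDerivAt ℝ (tensor (Function.update φ j ψ))
      (tensor (Function.update φ j (∂_{unitVec c} ψ)) Ξ) Ξ (coordVec (j, c)) := by
  have h1 : HasLineDerivAt ℝ ψ (∂_{unitVec c} ψ (Ξ j)) (Ξ j) (unitVec c) := by
    rw [lineDerivOp_apply]
    exact ψ.differentiableAt.lineDifferentiableAt.hasLineDerivAt
  have h2 := HasDerivAt.mul_const h1 (∏ l ∈ Finset.univ.erase j, φ l (Ξ l))
  rw [← tensor_update] at h2
  refine HasDerivAt.congr_of_eventuallyEq h2 (Eventually.of_forall fun t => ?_)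
  simp only [tensor_update]
  congr 1
  · simp [coordVec, unitVec]
  · refine Finset.prod_congr rfl fun l hl => ?_
    simp [coordVec, Finset.ne_of_mem_erase hl]

variable {g : (Fin N → Rn n) → ℂ}

lemma hasCompactSupport_coordDeriv (hg : ContDiff ℝ ∞ g) (hs : HasCompactSupport g)
    (c : Fin N × Fin n) : HasCompactSupport (coordDeriv c g) :=
  hs.mono' ((subset_tsupport _).trans
    (tsupport_coordDeriv_subset (hg.differentiable (by simp)) c))

lemma integrable_mul_tensor (hg : Continuous g) (hs : HasCompactSupport g)
    (φ : Fin N → 𝓢(Rn n, ℂ)) : Integrable fun Ξ => g Ξ * tensor φ Ξ :=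
  (hg.mul (continuous_tensor φ)).integrable_of_hasCompactSupport hs.mul_right

lemma integral_mul_tensor_lineDeriv (hg : ContDiff ℝ ∞ g) (hs : HasCompactSupport g)
    (φ : Fin N → 𝓢(Rn n, ℂ)) (j : Fin N) (c : Fin n) (ψ : 𝓢(Rn n, ℂ)) :
    ∫ Ξ, g Ξ * tensor (Function.update φ j (∂_{unitVec c} ψ)) Ξ =
      -∫ Ξ, coordDeriv (j, c) g Ξ * tensor (Function.update φ j ψ) Ξ := by
  have hgd : Differentiable ℝ g := hg.differentiable (by simp)
  refine integral_bilinear_hasLineDerivAt_right_eq_neg_left_of_integrable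
    (B := ContinuousLinearMap.mul ℝ ℂ) (v := coordVec (j, c)) (f := g)
    (g := tensor (Function.update φ j ψ)) (integrable_mul_tensor (contDiff_coordDeriv hg _).continuous
      (hasCompactSupport_coordDeriv hg hs _) _) (integrable_mul_tensor hg.continuous hs _)
    (integrable_mul_tensor hg.continuous hs _) (fun Ξ _ => ?_)
    (fun Ξ _ => hasLineDerivAt_tensor φ j c ψ Ξ)
  exact (hgd Ξ).lineDifferentiableAt.hasLineDerivAt

/-- The operator `1 - s² Δ` acting in the variable `ξ_j`. -/
def partialBessel (s : ℝ) (j : Fin N) (g : (Fin N → Rn n) → ℂ) : (Fin N → Rn n) → ℂ :=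
  g + (-s ^ 2) • ∑ c, coordDeriv (j, c) (coordDeriv (j, c) g)

lemma contDiff_sum_coordDeriv_coordDeriv (hg : ContDiff ℝ ∞ g) (j : Fin N) :
    ContDiff ℝ ∞ (∑ c : Fin n, coordDeriv (j, c) (coordDeriv (j, c) g)) := by
  have : (∑ c : Fin n, coordDeriv (j, c) (coordDeriv (j, c) g)) =
      fun Ξ => ∑ c, coordDeriv (j, c) (coordDeriv (j, c) g) Ξ := by
    funext Ξ
    simp
  rw [this]
  exact ContDiff.sum fun c _ => contDiff_coordDeriv (contDiff_coordDeriv hg _) _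

lemma contDiff_partialBessel (hg : ContDiff ℝ ∞ g) (s : ℝ) (j : Fin N) :
    ContDiff ℝ ∞ (partialBessel s j g) := by
  exact hg.add ((contDiff_sum_coordDeriv_coordDeriv hg j).const_smul (-s ^ 2))

lemma support_partialBessel_subset (hg : ContDiff ℝ ∞ g) (s : ℝ) (j : Fin N) :
    Function.support (partialBessel s j g) ⊆ tsupport g := by
  intro Ξ hΞ
  by_contra h
  have h0 : g Ξ = 0 := image_eq_zero_of_notMem_tsupport h
  have h1 : ∀ c, coordDeriv (j, c) (coordDeriv (j, c) g) Ξ = 0 := fun c => by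
    refine image_eq_zero_of_notMem_tsupport fun h' => h ?_
    exact tsupport_wordDeriv_subset hg [(j, c), (j, c)] h'
  exact hΞ (by simp [partialBessel, h0, h1])

lemma integral_mul_tensor_besselOp (hg : ContDiff ℝ ∞ g) (hs : HasCompactSupport g)
    (φ : Fin N → 𝓢(Rn n, ℂ)) (j : Fin N) (s : ℝ) (ψ : 𝓢(Rn n, ℂ)) :
    ∫ Ξ, g Ξ * tensor (Function.update φ j (besselOp s ψ)) Ξ =
      ∫ Ξ, partialBessel s j g Ξ * tensor (Function.update φ j ψ) Ξ := by
  have hI : ∀ χ : 𝓢(Rn n, ℂ), Integrable fun Ξ => g Ξ * tensor (Function.update φ j χ) Ξ :=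
    fun χ => integrable_mul_tensor hg.continuous hs _
  have hI2 : ∀ c, Integrable fun Ξ => coordDeriv (j, c) (coordDeriv (j, c) g) Ξ *
      tensor (Function.update φ j ψ) Ξ := fun c =>
    integrable_mul_tensor (contDiff_coordDeriv (contDiff_coordDeriv hg _) _).continuous
      (hasCompactSupport_coordDeriv (contDiff_coordDeriv hg _)
        (hasCompactSupport_coordDeriv hg hs _) _) _
  have h2 : ∀ c, ∫ Ξ, g Ξ * tensor (Function.update φ j (∂_{unitVec c} (∂_{unitVec c} ψ))) Ξ =
      ∫ Ξ, coordDeriv (j, c) (coordDeriv (j, c) g) Ξ * tensor (Function.update φ j ψ) Ξ := by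
    intro c
    rw [integral_mul_tensor_lineDeriv hg hs, integral_mul_tensor_lineDeriv
      (contDiff_coordDeriv hg _) (hasCompactSupport_coordDeriv hg hs _), neg_neg]
  have e1 : ∀ Ξ, g Ξ * tensor (Function.update φ j (besselOp s ψ)) Ξ =
      g Ξ * tensor (Function.update φ j ψ) Ξ + (-(s : ℂ) ^ 2) *
        ∑ c : Fin n, g Ξ * tensor (Function.update φ j (∂_{unitVec c} (∂_{unitVec c} ψ))) Ξ := by
    intro Ξ
    simp only [tensor_update, besselOp, _root_.sub_apply, _root_.smul_apply,
      _root_.sum_apply, Complex.real_smul]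
    rw [← Finset.mul_sum, ← Finset.sum_mul]
    push_cast
    ring
  have e2 : ∀ Ξ, partialBessel s j g Ξ * tensor (Function.update φ j ψ) Ξ =
      g Ξ * tensor (Function.update φ j ψ) Ξ + (-(s : ℂ) ^ 2) *
        ∑ c, coordDeriv (j, c) (coordDeriv (j, c) g) Ξ * tensor (Function.update φ j ψ) Ξ := by
    intro Ξ
    simp only [partialBessel, Pi.add_apply, Pi.smul_apply, Finset.sum_apply, Complex.real_smul]
    rw [← Finset.sum_mul]
    push_cast
    ring
  simp_rw [e1, e2]
  rw [integral_add (hI ψ) ((integrable_finsetSum _ fun c _ => hI _).const_mul _),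
    integral_add (hI ψ) ((integrable_finsetSum _ fun c _ => hI2 c).const_mul _),
    integral_const_mul, integral_const_mul, integral_finsetSum _ fun c _ => hI _,
    integral_finsetSum _ fun c _ => hI2 c]
  simp_rw [h2]

lemma WordBound.partialBessel {s : ℕ} {A r t : ℝ} {Ξ : Fin N → Rn n} (hg : ContDiff ℝ ∞ g)
    (h : WordBound (s + 2) A r g Ξ) (j : Fin N) :
    WordBound s (A * (1 + n * t ^ 2 * r ^ 2)) r (partialBessel t j g) Ξ := by
  intro l hl
  have hcd : ∀ c : Fin n, ContDiff ℝ ∞ (MultilinPsdo.coordDeriv (j, c)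
      (MultilinPsdo.coordDeriv (j, c) g)) := fun c =>
    contDiff_coordDeriv (contDiff_coordDeriv hg _) _
  have hsm := contDiff_sum_coordDeriv_coordDeriv hg j
  have h0 := h l (by omega)
  have h2 : ∀ c : Fin n, ‖wordDeriv l (MultilinPsdo.coordDeriv (j, c)
      (MultilinPsdo.coordDeriv (j, c) g)) Ξ‖ ≤ A * r ^ 2 * r ^ l.length := by
    intro c
    have h' := h
    refine ((h'.coordDeriv (s := s + 1) (j, c)).coordDeriv (j, c) l hl).trans (le_of_eq ?_)
    ring
  unfold MultilinPsdo.partialBessel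
  have hsm' : ContDiff ℝ ∞ ((-t ^ 2) • ∑ c : Fin n, MultilinPsdo.coordDeriv (j, c)
      (MultilinPsdo.coordDeriv (j, c) g)) := hsm.const_smul (-t ^ 2)
  rw [wordDeriv_add hg hsm', wordDeriv_const_smul hsm,
    wordDeriv_sum _ hcd]
  simp only [Pi.add_apply, Pi.smul_apply, Finset.sum_apply]
  calc _ ≤ A * r ^ l.length + t ^ 2 * (n * (A * r ^ 2 * r ^ l.length)) := by
        refine (norm_add_le _ _).trans (add_le_add h0 ?_)
        rw [norm_smul, norm_neg, Real.norm_of_nonneg (sq_nonneg t)]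
        gcongr
        refine (norm_sum_le _ _).trans ((Finset.sum_le_sum fun c _ => h2 c).trans ?_)
        simp
    _ = _ := by ring

/-- Integration by parts: powers of `1 - s² Δ` on the factors of the tensor product are moved
to `g`, after which the integral is estimated trivially. -/
lemma norm_integral_mul_tensor_le {B : Set (Rn n)} (hBm : MeasurableSet B) (hBc : IsClosed B)
    (hBb : Bornology.IsBounded B) {A r : ℝ} (hA : 0 ≤ A) (s : ℝ) (K : ℕ) :
    ∀ (k : Fin N → ℕ), ∑ j, k j = K → ∀ (g : (Fin N → Rn n) → ℂ), ContDiff ℝ ∞ g →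
      (∀ Ξ, g Ξ ≠ 0 → ∀ j, Ξ j ∈ B) → (∀ Ξ, WordBound (2 * K) A r g Ξ) →
      ∀ ψ : Fin N → 𝓢(Rn n, ℂ),
        ‖∫ Ξ, g Ξ * tensor (fun j => (besselOp s)^[k j] (ψ j)) Ξ‖ ≤
          A * (1 + n * s ^ 2 * r ^ 2) ^ K * ∏ j, ∫ ξ in B, ‖ψ j ξ‖ := by
  have hbox : IsClosed (Set.univ.pi fun _ : Fin N => B) := isClosed_set_pi fun _ _ => hBc
  induction K generalizing A with
  | zero =>
    intro k hk g hg hgs hgb ψ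
    have hk0 : ∀ j, k j = 0 := by simpa using hk
    simp only [hk0, Function.iterate_zero, id, pow_zero, mul_one]
    have hint : ∀ j, Integrable fun ξ => B.indicator (fun ξ => ‖ψ j ξ‖) ξ := fun j =>
      (ψ j).integrable.norm.indicator hBm
    calc ‖∫ Ξ, g Ξ * tensor ψ Ξ‖ ≤ ∫ Ξ : Fin N → Rn n, A * ∏ j, B.indicator (fun ξ => ‖ψ j ξ‖) (Ξ j) := by
          refine norm_integral_le_of_norm_le ((Integrable.fintype_prod hint).const_mul A)
            (Eventually.of_forall fun Ξ => ?_)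
          by_cases h0 : g Ξ = 0
          · rw [h0, zero_mul, norm_zero]
            exact mul_nonneg hA (Finset.prod_nonneg fun j _ =>
              Set.indicator_nonneg (fun _ _ => norm_nonneg _) _)
          · rw [norm_mul]
            have hb := hgb Ξ [] (by simp)
            simp only [wordDeriv_nil, List.length_nil, pow_zero, mul_one] at hb
            refine mul_le_mul hb (le_of_eq ?_) (norm_nonneg _) hA
            unfold tensor
            rw [norm_prod]
            refine Finset.prod_congr rfl fun j _ => ?_
            rw [Set.indicator_of_mem (hgs Ξ h0 j)]
      _ = A * ∏ j, ∫ ξ in B, ‖ψ j ξ‖ := by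
          rw [integral_const_mul,
            integral_fintype_prod_volume_eq_prod fun j => B.indicator fun ξ => ‖ψ j ξ‖]
          simp_rw [integral_indicator hBm]
  | succ K ih =>
    intro k hk g hg hgs hgb ψ
    obtain ⟨j, hj⟩ : ∃ j, k j ≠ 0 := by
      by_contra! h
      simp [h] at hk
    obtain ⟨i, hi⟩ := Nat.exists_eq_succ_of_ne_zero hj
    have hts : tsupport g ⊆ Set.univ.pi fun _ : Fin N => B :=
      closure_minimal (fun Ξ hΞ j _ => hgs Ξ hΞ j) hbox
    have hcs : HasCompactSupport g :=
      (Metric.isCompact_of_isClosed_isBounded hbox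
        (Bornology.IsBounded.pi fun _ => hBb)).of_isClosed_subset (isClosed_tsupport g) hts
    have e1 : (fun l => (besselOp s)^[k l] (ψ l)) =
        Function.update (fun l => (besselOp s)^[k l] (ψ l)) j
          (besselOp s ((besselOp s)^[i] (ψ j))) := by
      rw [← Function.iterate_succ_apply' (besselOp s), ← hi]
      exact (Function.update_eq_self j fun l => (besselOp s)^[k l] (ψ l)).symm
    have e2 : Function.update (fun l => (besselOp s)^[k l] (ψ l)) j ((besselOp s)^[i] (ψ j)) =
        fun l => (besselOp s)^[Function.update k j i l] (ψ l) := by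
      funext l
      by_cases hl : l = j
      · subst hl
        simp
      · simp [Function.update_of_ne hl]
    have hk' : ∑ l, Function.update k j i l = K := by
      have h1 := Finset.add_sum_erase Finset.univ k (Finset.mem_univ j)
      have h2 := Finset.add_sum_erase Finset.univ (Function.update k j i) (Finset.mem_univ j)
      have h3 : ∑ l ∈ Finset.univ.erase j, Function.update k j i l =
          ∑ l ∈ Finset.univ.erase j, k l :=
        Finset.sum_congr rfl fun l hl => Function.update_of_ne (Finset.ne_of_mem_erase hl) _ _
      rw [Function.update_self] at h2
      omega
    rw [e1, integral_mul_tensor_besselOp hg hcs, e2]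
    refine (ih (A := A * (1 + n * s ^ 2 * r ^ 2)) (by positivity) _ hk' _
      (contDiff_partialBessel hg s j)
      (fun Ξ hΞ l => hts (support_partialBessel_subset hg s j hΞ) l trivial)
      (fun Ξ => WordBound.partialBessel hg (hgb Ξ) j) ψ).trans (le_of_eq ?_)
    ring

end IntegrationByParts

/-! ### Local estimates by the maximal function -/


section WeightedNorm

open SchwartzMap

variable {n : ℕ}

lemma lintegral_ball_le_maximalFn {p : ℝ} (hp : 0 < p) (u : Rn n → ℂ) {x c : Rn n} {s : ℝ}
    (hx : x ∈ Metric.ball c s) :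
    ∫⁻ y in Metric.ball c s, ‖u y‖ₑ ^ p ≤ maximalFn p u x ^ p * volume (Metric.ball c s) := by
  have hs : 0 < s := Metric.pos_of_mem_ball hx
  have h1 : ((∫⁻ y in Metric.ball c s, ‖u y‖ₑ ^ p) / volume (Metric.ball c s)) ^ (1 / p) ≤
      maximalFn p u x :=
    le_iSup_of_le c (le_iSup_of_le s (le_iSup_of_le hx le_rfl))
  have h2 := ENNReal.rpow_le_rpow h1 hp.le
  rw [← ENNReal.rpow_mul, one_div_mul_cancel hp.ne', ENNReal.rpow_one] at h2
  rwa [ENNReal.div_le_iff (Metric.measure_ball_pos volume c hs).ne' measure_ball_lt_top.ne] at h2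

/-- On the annulus `2^{i-1} ≤ s|y| < 2^i` the weight `(1 + s²|y|²)^{-n}` is at most
`4^n 4^{-in}`. -/
lemma inv_besselWeight_pow_le (s : ℝ) (hs : 0 < s) (n : ℕ) (y : Rn n) :
    ENNReal.ofReal ((besselWeight s y ^ n)⁻¹) ≤
      ∑' i : ℕ, ENNReal.ofReal (4 ^ n * ((4 : ℝ) ^ (i * n))⁻¹) *
        (Metric.ball (0 : Rn n) (2 ^ i / s)).indicator 1 y := by
  have hex : ∃ i : ℕ, s * ‖y‖ < 2 ^ i := pow_unbounded_of_one_lt _ one_lt_two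
  classical
  let i₀ := Nat.find hex
  have h0 : s * ‖y‖ < 2 ^ i₀ := Nat.find_spec hex
  refine le_trans ?_ (ENNReal.le_tsum i₀)
  have hmem : y ∈ Metric.ball (0 : Rn n) (2 ^ i₀ / s) := by
    rw [mem_ball_zero_iff, lt_div_iff₀ hs, mul_comm]
    exact h0
  rw [Set.indicator_of_mem hmem, Pi.one_apply, mul_one]
  refine ENNReal.ofReal_le_ofReal ?_
  have hw : (4 : ℝ) ^ i₀ ≤ 4 * besselWeight s y := by
    unfold besselWeight
    rw [norm_smul, Real.norm_of_nonneg hs.le]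
    rcases Nat.eq_zero_or_pos i₀ with h | h
    · rw [h, pow_zero]
      nlinarith [sq_nonneg (s * ‖y‖)]
    · obtain ⟨k, hk⟩ := Nat.exists_eq_succ_of_ne_zero h.ne'
      have hlt : (2 : ℝ) ^ k ≤ s * ‖y‖ := by
        by_contra! hc
        exact absurd (Nat.find_min' hex hc) (by change ¬ i₀ ≤ k; omega)
      have h4 : (4 : ℝ) ^ i₀ = 4 * (2 ^ k) ^ 2 := by
        rw [hk, Nat.succ_eq_add_one, pow_succ, ← pow_mul, mul_comm k 2, pow_mul]
        norm_num
        ring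
      rw [h4]
      have : ((2 : ℝ) ^ k) ^ 2 ≤ (s * ‖y‖) ^ 2 := pow_le_pow_left₀ (by positivity) hlt 2
      linarith
  have hpos := besselWeight_pos s y
  rw [pow_mul, inv_le_iff_one_le_mul₀ (by positivity), ← div_eq_mul_inv, div_mul_eq_mul_div,
    one_le_div (by positivity), ← mul_pow]
  exact pow_le_pow_left₀ (by positivity) hw n

/-- The weighted `L^p` norm of `u(x + ·)` is controlled by the maximal function at `x`: the weight
is dominated by a sum of multiples of indicator functions of dyadic balls. -/
lemma lintegral_besselDiv_le (hn : 1 ≤ n) {p : ℝ} (hp : 1 ≤ p) {s : ℝ} (hs : 0 < s)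
    (u : 𝓢(Rn n, ℂ)) (x : Rn n) :
    ∫⁻ y, ‖besselDiv s n (u.compSubConstCLM ℂ (-x)) y‖ₑ ^ p ≤
      ENNReal.ofReal (2 * 4 ^ n * (s ^ n)⁻¹) * volume (Metric.ball (0 : Rn n) 1) *
        maximalFn p u x ^ p := by
  have hp0 : 0 < p := by linarith
  set M := maximalFn p u x with hM
  set W := volume (Metric.ball (0 : Rn n) 1) with hW
  have hc : Continuous fun y : Rn n => ‖u (y + x)‖ₑ ^ p :=
    (ENNReal.continuous_rpow_const).comp (u.continuous.comp (continuous_add_const x)).enorm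
  have hpt : ∀ y, ‖besselDiv s n (u.compSubConstCLM ℂ (-x)) y‖ₑ ^ p ≤
      ∑' i : ℕ, ENNReal.ofReal (4 ^ n * ((4 : ℝ) ^ (i * n))⁻¹) *
        (Metric.ball (0 : Rn n) (2 ^ i / s)).indicator (fun y => ‖u (y + x)‖ₑ ^ p) y := by
    intro y
    have hw1 : 1 ≤ besselWeight s y := by
      unfold besselWeight
      nlinarith [sq_nonneg ‖s • y‖]
    have hle1 : (besselWeight s y ^ n)⁻¹ ≤ 1 := inv_le_one_of_one_le₀ (one_le_pow₀ hw1)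
    have h0 : 0 ≤ (besselWeight s y ^ n)⁻¹ := inv_nonneg.2 (pow_nonneg (besselWeight_pos s y).le _)
    rw [besselDiv_apply, compSubConstCLM_apply, sub_neg_eq_add, enorm_smul,
      ENNReal.mul_rpow_of_nonneg _ _ hp0.le, Real.enorm_of_nonneg h0]
    calc _ ≤ ENNReal.ofReal ((besselWeight s y ^ n)⁻¹) * ‖u (y + x)‖ₑ ^ p := by
          gcongr
          exact ENNReal.rpow_le_self_of_le_one (by simpa using hle1) hp
      _ ≤ _ := by
          refine (mul_le_mul_left (inv_besselWeight_pow_le s hs n y) _).trans (le_of_eq ?_)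
          rw [← ENNReal.tsum_mul_right]
          refine tsum_congr fun i => ?_
          by_cases hy : y ∈ Metric.ball (0 : Rn n) (2 ^ i / s)
          · simp [Set.indicator_of_mem hy]
          · simp [Set.indicator_of_notMem hy]
  have hball : ∀ i : ℕ, ∫⁻ y in Metric.ball (0 : Rn n) (2 ^ i / s), ‖u (y + x)‖ₑ ^ p ≤
      M ^ p * (ENNReal.ofReal ((2 ^ i / s) ^ n) * W) := by
    intro i
    have hr : 0 < 2 ^ i / s := by positivity
    have h1 := lintegral_ball_le_maximalFn hp0 u (Metric.mem_ball_self (x := x) hr)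
    rw [Measure.addHaar_ball_of_pos _ _ hr, finrank_euclideanSpace_fin] at h1
    refine le_trans (le_of_eq ?_) h1
    rw [← lintegral_indicator measurableSet_ball, ← lintegral_indicator measurableSet_ball,
      ← lintegral_add_right_eq_self (fun y => (Metric.ball x (2 ^ i / s)).indicator _ y) x]
    refine lintegral_congr fun y => ?_
    have hiff : y + x ∈ Metric.ball x (2 ^ i / s) ↔ y ∈ Metric.ball (0 : Rn n) (2 ^ i / s) := by
      simp
    by_cases hy : y ∈ Metric.ball (0 : Rn n) (2 ^ i / s)
    · rw [Set.indicator_of_mem hy, Set.indicator_of_mem (hiff.2 hy)]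
    · rw [Set.indicator_of_notMem hy, Set.indicator_of_notMem fun h => hy (hiff.1 h)]
  calc _ ≤ ∫⁻ y, ∑' i : ℕ, ENNReal.ofReal (4 ^ n * ((4 : ℝ) ^ (i * n))⁻¹) *
        (Metric.ball (0 : Rn n) (2 ^ i / s)).indicator (fun y => ‖u (y + x)‖ₑ ^ p) y :=
        lintegral_mono hpt
    _ = ∑' i : ℕ, ENNReal.ofReal (4 ^ n * ((4 : ℝ) ^ (i * n))⁻¹) *
        ∫⁻ y in Metric.ball (0 : Rn n) (2 ^ i / s), ‖u (y + x)‖ₑ ^ p := by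
        rw [lintegral_tsum fun i =>
          ((hc.measurable.indicator measurableSet_ball).const_mul _).aemeasurable]
        refine tsum_congr fun i => ?_
        rw [lintegral_const_mul _ (hc.measurable.indicator measurableSet_ball),
          lintegral_indicator measurableSet_ball]
    _ ≤ ∑' i : ℕ, ENNReal.ofReal (4 ^ n * ((4 : ℝ) ^ (i * n))⁻¹) *
        (M ^ p * (ENNReal.ofReal ((2 ^ i / s) ^ n) * W)) :=
        ENNReal.tsum_le_tsum fun i => mul_le_mul_right (hball i) _
    _ ≤ ∑' i : ℕ, ENNReal.ofReal (4 ^ n * (s ^ n)⁻¹) * W * M ^ p * (2⁻¹ : ℝ≥0∞) ^ i := by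
        refine ENNReal.tsum_le_tsum fun i => ?_
        have hnum : ENNReal.ofReal (4 ^ n * ((4 : ℝ) ^ (i * n))⁻¹) *
            ENNReal.ofReal ((2 ^ i / s) ^ n) ≤
            ENNReal.ofReal (4 ^ n * (s ^ n)⁻¹) * (2⁻¹ : ℝ≥0∞) ^ i := by
          rw [← ENNReal.ofReal_mul (by positivity)]
          have h2 : (2⁻¹ : ℝ≥0∞) ^ i = ENNReal.ofReal ((2⁻¹ : ℝ) ^ i) := by
            rw [ENNReal.ofReal_pow (by positivity), ENNReal.ofReal_inv_of_pos two_pos]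
            simp
          rw [h2, ← ENNReal.ofReal_mul (by positivity)]
          refine ENNReal.ofReal_le_ofReal ?_
          have e : 4 ^ n * ((4 : ℝ) ^ (i * n))⁻¹ * (2 ^ i / s) ^ n =
              4 ^ n * (s ^ n)⁻¹ * ((2⁻¹ : ℝ) ^ i) ^ n := by
            have h4 : (4 : ℝ) ^ i = 2 ^ i * 2 ^ i := by rw [← mul_pow]; norm_num
            rw [pow_mul, h4, inv_pow, div_pow, mul_pow, inv_pow]
            field_simp
          rw [e]
          gcongr
          exact pow_le_of_le_one (by positivity) (pow_le_one₀ (by norm_num) (by norm_num))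
            (by omega)
        calc _ = (ENNReal.ofReal (4 ^ n * ((4 : ℝ) ^ (i * n))⁻¹) *
            ENNReal.ofReal ((2 ^ i / s) ^ n)) * (W * M ^ p) := by ring
          _ ≤ (ENNReal.ofReal (4 ^ n * (s ^ n)⁻¹) * (2⁻¹ : ℝ≥0∞) ^ i) * (W * M ^ p) := by gcongr
          _ = _ := by ring
    _ = _ := by
        rw [ENNReal.tsum_mul_left, ENNReal.tsum_geometric, ENNReal.one_sub_inv_two, inv_inv,
          mul_assoc 2, ENNReal.ofReal_mul (by norm_num : (0 : ℝ) ≤ 2)]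
        simp only [ENNReal.ofReal_ofNat]
        ring

/-- The constant of `setLIntegral_fourierS_besselDiv_le`. -/
def localConst (n : ℕ) (p : ℝ) : ℝ≥0∞ :=
  ENNReal.ofReal ((2 * Real.pi) ^ n) * 2 *
    (ENNReal.ofReal (2 * 4 ^ n) * volume (Metric.ball (0 : Rn n) 1) ^ 2) ^ (1 / p)

lemma localConst_ne_top (n : ℕ) {p : ℝ} (hp : 0 < p) : localConst n p ≠ ⊤ := by
  refine ENNReal.mul_ne_top (by simp [ENNReal.mul_eq_top]) ?_
  exact ENNReal.rpow_ne_top_of_nonneg (by positivity)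
    (ENNReal.mul_ne_top ENNReal.ofReal_ne_top (ENNReal.pow_ne_top measure_ball_lt_top.ne))

/-- The factor `(R/s)^{n/p}` combines the `R^{n/p}` of the frequency ball with the `s^{-n/p}` of the
localization at the scale `1/s`. -/
lemma setLIntegral_fourierS_besselDiv_le (hn : 1 ≤ n) {p : ℝ} (hp1 : 1 ≤ p) (hp2 : p ≤ 2) {s R : ℝ}
    (hs : 0 < s) (hR : 0 < R) (u : 𝓢(Rn n, ℂ)) (x : Rn n) :
    ∫⁻ ξ in Metric.closedBall 0 R, ‖fourierS (besselDiv s n (u.compSubConstCLM ℂ (-x))) ξ‖ₑ ≤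
      localConst n p * ENNReal.ofReal ((R / s) ^ ((n : ℝ) / p)) * maximalFn p u x := by
  have hp0 : 0 < p := by linarith
  refine (setLIntegral_enorm_fourierS_le _ hp1 hp2 R).trans ?_
  have h1 := ENNReal.rpow_le_rpow (lintegral_besselDiv_le hn hp1 hs u x)
    (by positivity : 0 ≤ 1 / p)
  rw [ENNReal.mul_rpow_of_nonneg _ (maximalFn p u x ^ p) (by positivity), ← ENNReal.rpow_mul,
    mul_one_div_cancel hp0.ne', ENNReal.rpow_one] at h1
  rw [Measure.addHaar_closedBall _ _ hR.le, finrank_euclideanSpace_fin]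
  have e : ENNReal.ofReal ((R / s) ^ ((n : ℝ) / p)) =
      (ENNReal.ofReal (R ^ n) * ENNReal.ofReal ((s ^ n)⁻¹)) ^ (1 / p) := by
    rw [← ENNReal.ofReal_mul (by positivity), ENNReal.ofReal_rpow_of_nonneg (by positivity)
      (by positivity), ← div_eq_mul_inv, ← div_pow, ← Real.rpow_natCast, ← Real.rpow_mul
      (by positivity), mul_one_div]
  rw [e, localConst]
  calc _ ≤ ENNReal.ofReal ((2 * Real.pi) ^ n) * (2 *
        ((ENNReal.ofReal (R ^ n) * volume (Metric.ball (0 : Rn n) 1)) ^ (1 / p) *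
        ((ENNReal.ofReal (2 * 4 ^ n * (s ^ n)⁻¹) * volume (Metric.ball (0 : Rn n) 1)) ^ (1 / p) *
        maximalFn p u x))) := by gcongr
    _ = ENNReal.ofReal ((2 * Real.pi) ^ n) * 2 *
        ((ENNReal.ofReal (R ^ n) * volume (Metric.ball (0 : Rn n) 1)) *
        (ENNReal.ofReal (2 * 4 ^ n * (s ^ n)⁻¹) * volume (Metric.ball (0 : Rn n) 1))) ^ (1 / p) *
        maximalFn p u x := by
        rw [ENNReal.mul_rpow_of_nonneg
          (ENNReal.ofReal (R ^ n) * volume (Metric.ball (0 : Rn n) 1))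
          (ENNReal.ofReal (2 * 4 ^ n * (s ^ n)⁻¹) * volume (Metric.ball (0 : Rn n) 1))
          (by positivity : 0 ≤ 1 / p)]
        ring
    _ = _ := by
        rw [mul_assoc (_ * 2) _ ((_ : ℝ≥0∞) ^ (1 / p)),
          ← ENNReal.mul_rpow_of_nonneg _ _ (by positivity : 0 ≤ 1 / p),
          ENNReal.ofReal_mul (by positivity : (0 : ℝ) ≤ 2 * 4 ^ n)]
        congr 3
        ring

end WeightedNorm

/-! ### The pointwise estimate -/


section Pointwise

open SchwartzMap

variable {n N : ℕ}

lemma norm_le_bracket (Ξ : Fin N → Rn n) : ‖Ξ‖ ≤ bracket Ξ := by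
  unfold bracket
  refine (pi_norm_le_iff_of_nonneg (Real.sqrt_nonneg _)).2 fun j => Real.le_sqrt_of_sq_le ?_
  have := Finset.single_le_sum (f := fun j => ‖Ξ j‖ ^ 2) (fun _ _ => sq_nonneg _)
    (Finset.mem_univ j)
  linarith

lemma one_le_bracket (Ξ : Fin N → Rn n) : 1 ≤ bracket Ξ := by
  unfold bracket
  rw [Real.one_le_sqrt]
  linarith [Finset.sum_nonneg fun j (_ : j ∈ Finset.univ) => sq_nonneg ‖Ξ j‖]

lemma continuous_bracket : Continuous (bracket : (Fin N → Rn n) → ℝ) := by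
  unfold bracket
  fun_prop

/-- The Fourier transform of the translate of `u` which brings `x` to the origin. -/
lemma fourierT_mul_exp (u : 𝓢(Rn n, ℂ)) (x ξ : Rn n) :
    fourierT u ξ * Complex.exp (Complex.I * (inner ℝ x ξ : ℝ)) =
      fourierS (u.compSubConstCLM ℂ (-x)) ξ := by
  rw [fourierS_apply, fourierT, fourierT, ← integral_mul_const,
    ← integral_add_right_eq_self _ x]
  refine integral_congr_ae (Eventually.of_forall fun y => ?_)
  simp only [compSubConstCLM_apply, sub_neg_eq_add]
  rw [mul_assoc, ← Complex.exp_add, inner_add_right, real_inner_comm x ξ]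
  congr 2
  push_cast
  ring

lemma psdo_eq (a : Rn n → (Fin N → Rn n) → ℂ) (u : Fin N → 𝓢(Rn n, ℂ)) (x : Rn n) :
    psdo a u x =
      ∫ Ξ, a x Ξ * tensor (fun j => fourierS ((u j).compSubConstCLM ℂ (-x))) Ξ := by
  unfold psdo tensor
  simp_rw [fourierT_mul_exp]

lemma integrable_tensor (φ : Fin N → 𝓢(Rn n, ℂ)) : Integrable (tensor φ) :=
  Integrable.fintype_prod fun j => (φ j).integrable

/-- The scaling exponent of the dyadic pieces; the hypothesis on the order `m` says that it is
negative. -/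
def scaleExp (n : ℕ) {N : ℕ} (p : Fin N → ℝ) (m ρ : ℝ) : ℝ := m + (1 - ρ) * ∑ j, (n : ℝ) / p j

/-- The constant in the estimate of a dyadic piece. -/
def pieceConst (n : ℕ) {N : ℕ} (p : Fin N → ℝ) (K : ℝ) : ℝ≥0∞ :=
  ENNReal.ofReal (K * (1 + 4 * n) ^ (N * n)) *
    ∏ j, (localConst n (p j) * ENNReal.ofReal (4 ^ ((n : ℝ) / p j)))

lemma pieceConst_ne_top (n : ℕ) {p : Fin N → ℝ} (hp : ∀ j, 1 ≤ p j) (K : ℝ) :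
    pieceConst n p K ≠ ⊤ := by
  refine ENNReal.mul_ne_top ENNReal.ofReal_ne_top (ENNReal.prod_ne_top fun j _ => ?_)
  exact ENNReal.mul_ne_top (localConst_ne_top n (by linarith [hp j])) ENNReal.ofReal_ne_top

/-- A piece of the operator living at frequencies of size `t`: the derivatives of the symbol cost
`t^{-ρ}` each, and the functions are localized to the scale `t^{-ρ}` around `x`. -/
lemma enorm_integral_piece_le (hn : 1 ≤ n) {p : Fin N → ℝ} (hp : ∀ j, 1 ≤ p j ∧ p j ≤ 2)
    {m ρ : ℝ} (hρ : ρ ≤ 1) {K C t : ℝ} (hK : 0 ≤ K) (hC : 0 ≤ C) (ht : 1 ≤ t)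
    {η : (Fin N → Rn n) → ℂ} (hη : ContDiff ℝ ∞ η)
    (hηs : ∀ Ξ, η Ξ ≠ 0 → ‖Ξ‖ ≤ 4)
    (hηb : ∀ l : List (Fin N × Fin n), l.length ≤ 2 * (N * n) → ∀ Ξ, ‖wordDeriv l η Ξ‖ ≤ C)
    {b : (Fin N → Rn n) → ℂ} (hb : ContDiff ℝ ∞ b)
    (hbb : ∀ Ξ ∈ tsupport (fun Ξ => η (t⁻¹ • Ξ)),
      WordBound (2 * (N * n)) (K * t ^ m) (t ^ (-ρ)) b Ξ)
    (u : Fin N → 𝓢(Rn n, ℂ)) (x : Rn n) :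
    ‖∫ Ξ, b Ξ * η (t⁻¹ • Ξ) * tensor (fun j => fourierS ((u j).compSubConstCLM ℂ (-x))) Ξ‖ₑ ≤
      pieceConst n p (K * C) * ENNReal.ofReal (t ^ scaleExp n p m ρ) *
        ∏ j, maximalFn (p j) (u j) x := by
  have ht0 : 0 < t := by linarith
  set s : ℝ := t ^ ρ with hs
  have hs0 : 0 < s := Real.rpow_pos_of_pos ht0 ρ
  set ηt : (Fin N → Rn n) → ℂ := fun Ξ => η (t⁻¹ • Ξ) with hηt
  have hηtc : ContDiff ℝ ∞ ηt := hη.comp (contDiff_const_smul _)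
  have hηtb : ∀ Ξ, WordBound (2 * (N * n)) C (t ^ (-ρ)) ηt Ξ := by
    intro Ξ l hl
    rw [hηt, wordDeriv_comp_smul hη, norm_smul, norm_pow, norm_inv, Real.norm_of_nonneg ht0.le,
      mul_comm]
    refine mul_le_mul (hηb l hl _) (pow_le_pow_left₀ (by positivity) ?_ _) (by positivity) hC
    rw [← Real.rpow_neg_one]
    exact Real.rpow_le_rpow_of_exponent_le ht (by linarith)
  have hgc : ContDiff ℝ ∞ (b * ηt) := hb.mul hηtc
  have hgb : ∀ Ξ, WordBound (2 * (N * n)) (K * t ^ m * C) (2 * t ^ (-ρ)) (b * ηt) Ξ := by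
    intro Ξ
    by_cases hΞ : Ξ ∈ tsupport ηt
    · exact (hbb Ξ hΞ).mul hb hηtc (hηtb Ξ)
    · intro l _
      have h1 : Ξ ∉ tsupport (b * ηt) := fun h => hΞ (tsupport_mul_subset_right h)
      have h2 : wordDeriv l (b * ηt) Ξ = 0 :=
        image_eq_zero_of_notMem_tsupport fun h => h1 (tsupport_wordDeriv_subset hgc l h)
      rw [h2, norm_zero]
      positivity
  have hgs : ∀ Ξ, (b * ηt) Ξ ≠ 0 → ∀ j, Ξ j ∈ Metric.closedBall (0 : Rn n) (4 * t) := by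
    intro Ξ hΞ j
    have h1 : η (t⁻¹ • Ξ) ≠ 0 := right_ne_zero_of_mul hΞ
    have h2 := hηs _ h1
    rw [norm_smul, norm_inv, Real.norm_of_nonneg ht0.le, inv_mul_le_iff₀ ht0] at h2
    rw [mem_closedBall_zero_iff]
    linarith [norm_le_pi_norm Ξ j]
  have hmain := norm_integral_mul_tensor_le measurableSet_closedBall Metric.isClosed_closedBall
    Metric.isBounded_closedBall (B := Metric.closedBall (0 : Rn n) (4 * t))
    (A := K * t ^ m * C) (r := 2 * t ^ (-ρ)) (by positivity) s (N * n) (fun _ => n)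
    (by simp) (b * ηt) hgc hgs hgb
    (fun j => fourierS (besselDiv s n ((u j).compSubConstCLM ℂ (-x))))
  -- integration by parts at the scale `s = t ^ ρ` costs only a constant
  have hsr : n * s ^ 2 * (2 * t ^ (-ρ)) ^ 2 = 4 * n := by
    have : s * t ^ (-ρ) = 1 := by rw [hs, ← Real.rpow_add ht0]; simp
    calc (n : ℝ) * s ^ 2 * (2 * t ^ (-ρ)) ^ 2 = 4 * n * (s * t ^ (-ρ)) ^ 2 := by ring
      _ = 4 * (n : ℝ) := by rw [this]; ring
  simp only [← fourierS_eq_iterate_besselOp, hsr, Pi.mul_apply] at hmain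
  have hfin : ∀ j, ENNReal.ofReal (∫ ξ in Metric.closedBall (0 : Rn n) (4 * t),
      ‖fourierS (besselDiv s n ((u j).compSubConstCLM ℂ (-x))) ξ‖) ≤
      localConst n (p j) * ENNReal.ofReal (4 ^ ((n : ℝ) / p j)) *
        ENNReal.ofReal (t ^ ((1 - ρ) * (n / p j))) * maximalFn (p j) (u j) x := by
    intro j
    have hpj : 0 < p j := by linarith [(hp j).1]
    rw [ofReal_integral_norm_eq_lintegral_enorm (SchwartzMap.integrable _).integrableOn]
    refine (setLIntegral_fourierS_besselDiv_le hn (hp j).1 (hp j).2 hs0 (by positivity)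
      (u j) x).trans (le_of_eq ?_)
    rw [mul_assoc (localConst n (p j)) (ENNReal.ofReal (4 ^ ((n : ℝ) / p j))),
      ← ENNReal.ofReal_mul (by positivity)]
    congr 3
    rw [mul_div_assoc, Real.mul_rpow (by norm_num) (by positivity), Real.rpow_mul ht0.le,
      Real.rpow_sub ht0, Real.rpow_one]
  have e1 : ENNReal.ofReal (K * t ^ m * C * (1 + 4 * n) ^ (N * n)) =
      ENNReal.ofReal (K * C * (1 + 4 * n) ^ (N * n)) * ENNReal.ofReal (t ^ m) := by
    rw [← ENNReal.ofReal_mul (by positivity)]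
    congr 1
    ring
  have e2 : ENNReal.ofReal (t ^ scaleExp n p m ρ) =
      ENNReal.ofReal (t ^ m) * ∏ j, ENNReal.ofReal (t ^ ((1 - ρ) * (n / p j))) := by
    rw [← ENNReal.ofReal_prod_of_nonneg fun j _ => by positivity,
      ← ENNReal.ofReal_mul (by positivity), ← Real.rpow_sum_of_pos ht0, ← Real.rpow_add ht0,
      ← Finset.mul_sum, scaleExp]
  calc _ = ENNReal.ofReal ‖∫ Ξ, b Ξ * ηt Ξ *
        tensor (fun j => fourierS ((u j).compSubConstCLM ℂ (-x))) Ξ‖ := (ofReal_norm _).symm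
    _ ≤ ENNReal.ofReal (K * t ^ m * C * (1 + 4 * n) ^ (N * n)) *
        ∏ j, ENNReal.ofReal (∫ ξ in Metric.closedBall (0 : Rn n) (4 * t),
          ‖fourierS (besselDiv s n ((u j).compSubConstCLM ℂ (-x))) ξ‖) := by
        rw [← ENNReal.ofReal_prod_of_nonneg fun j _ => by positivity,
          ← ENNReal.ofReal_mul (by positivity)]
        exact ENNReal.ofReal_le_ofReal hmain
    _ ≤ ENNReal.ofReal (K * t ^ m * C * (1 + 4 * n) ^ (N * n)) *
        ∏ j, (localConst n (p j) * ENNReal.ofReal (4 ^ ((n : ℝ) / p j)) *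
          ENNReal.ofReal (t ^ ((1 - ρ) * (n / p j))) * maximalFn (p j) (u j) x) := by
        gcongr with j
        exact hfin j
    _ = _ := by
        rw [e1, e2, Finset.prod_mul_distrib, Finset.prod_mul_distrib, pieceConst]
        ring

/-- A smooth cut-off function on `ℝ^{nN}`, equal to `1` on the unit ball and supported in the ball
of radius `2`, both with respect to the norm `max_j |ξ_j|`. -/
def cutoff (n N : ℕ) : ContDiffBump (0 : Fin N → Rn n) := ⟨1, 2, one_pos, one_lt_two⟩

/-- The cut-off function at frequency `t`. -/
def cutoffAt (t : ℝ) (Ξ : Fin N → Rn n) : ℂ := (cutoff n N (t⁻¹ • Ξ) : ℝ)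

lemma contDiff_cutoffAt (t : ℝ) : ContDiff ℝ ∞ (cutoffAt t : (Fin N → Rn n) → ℂ) :=
  Complex.ofRealCLM.contDiff.comp ((cutoff n N).contDiff.comp (contDiff_const_smul _))

lemma norm_cutoffAt_le (t : ℝ) (Ξ : Fin N → Rn n) : ‖cutoffAt t Ξ‖ ≤ 1 := by
  rw [cutoffAt, Complex.norm_real, Real.norm_of_nonneg (cutoff n N).nonneg]
  exact (cutoff n N).le_one

lemma cutoffAt_eq_one {t : ℝ} (ht : 0 < t) {Ξ : Fin N → Rn n} (h : ‖Ξ‖ ≤ t) :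
    cutoffAt t Ξ = 1 := by
  have : cutoff n N (t⁻¹ • Ξ) = 1 := by
    refine (cutoff n N).one_of_mem_closedBall ?_
    rw [mem_closedBall_zero_iff, norm_smul, norm_inv, Real.norm_of_nonneg ht.le,
      inv_mul_le_iff₀ ht]
    simpa [cutoff] using h
  rw [cutoffAt, this, Complex.ofReal_one]

lemma cutoffAt_eq_zero {t : ℝ} (ht : 0 < t) {Ξ : Fin N → Rn n} (h : 2 * t ≤ ‖Ξ‖) :
    cutoffAt t Ξ = 0 := by
  have : cutoff n N (t⁻¹ • Ξ) = 0 := by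
    refine (cutoff n N).zero_of_le_dist ?_
    rw [dist_zero_right, norm_smul, norm_inv, Real.norm_of_nonneg ht.le, le_inv_mul_iff₀ ht]
    simpa [cutoff, mul_comm] using h
  rw [cutoffAt, this, Complex.ofReal_zero]

lemma hasCompactSupport_cutoffAt {t : ℝ} (ht : 0 < t) :
    HasCompactSupport (cutoffAt t : (Fin N → Rn n) → ℂ) := by
  refine HasCompactSupport.intro (isCompact_closedBall 0 (2 * t)) fun Ξ hΞ => ?_
  rw [mem_closedBall_zero_iff, not_le] at hΞ
  exact cutoffAt_eq_zero ht hΞ.le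

lemma cutoffAt_smul (t t' : ℝ) (Ξ : Fin N → Rn n) :
    cutoffAt t (t'⁻¹ • Ξ) = cutoffAt (t * t') Ξ := by
  simp only [cutoffAt, smul_smul, mul_inv]

/-- The pointwise estimate of `T_a` at a point `x` by maximal functions, under estimates for the
derivatives of `a(x,·)` up to the order `2nN`. -/
theorem exists_enorm_psdo_le (hn : 1 ≤ n) {p : Fin N → ℝ} (hp : ∀ j, 1 ≤ p j ∧ p j ≤ 2) {m ρ : ℝ}
    (hρ0 : 0 ≤ ρ) (hρ1 : ρ ≤ 1) (hm : m < (ρ - 1) * ∑ j, (n : ℝ) / p j) {K : ℝ} (hK : 0 ≤ K) :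
    ∃ C : ℝ≥0, ∀ (a : Rn n → (Fin N → Rn n) → ℂ) (x : Rn n), ContDiff ℝ ∞ (a x) →
      (∀ l : List (Fin N × Fin n), l.length ≤ 2 * (N * n) → ∀ Ξ,
        ‖wordDeriv l (a x) Ξ‖ ≤ K * bracket Ξ ^ (m - ρ * l.length)) →
      ∀ u : Fin N → 𝓢(Rn n, ℂ), ‖psdo a u x‖ₑ ≤ C * ∏ j, maximalFn (p j) (u j) x := by
  have hδ : scaleExp n p m ρ < 0 := by
    unfold scaleExp
    linarith
  have hm0 : m ≤ 0 := by
    have : 0 ≤ ∑ j, (n : ℝ) / p j :=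
      Finset.sum_nonneg fun j _ => div_nonneg n.cast_nonneg (by linarith [(hp j).1])
    nlinarith
  set δ := scaleExp n p m ρ with hδdef
  set η : (Fin N → Rn n) → ℂ := fun Ξ => cutoffAt 2 Ξ - cutoffAt 1 Ξ with hη
  have hηc : ContDiff ℝ ∞ η := (contDiff_cutoffAt 2).sub (contDiff_cutoffAt 1)
  have hηs : HasCompactSupport η :=
    (hasCompactSupport_cutoffAt two_pos).sub (hasCompactSupport_cutoffAt one_pos)
  obtain ⟨C₁, hC₁, hηb⟩ := exists_wordDeriv_bound hηc hηs (2 * (N * n))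
  obtain ⟨C₀, hC₀, hχb⟩ := exists_wordDeriv_bound (contDiff_cutoffAt (n := n) (N := N) 1)
    (hasCompactSupport_cutoffAt one_pos) (2 * (N * n))
  set q : ℝ≥0∞ := ENNReal.ofReal (2 ^ δ) with hq
  have hq1 : q < 1 := by
    rw [hq, ENNReal.ofReal_lt_one]
    exact Real.rpow_lt_one_of_one_lt_of_neg one_lt_two hδ
  set D : ℝ≥0∞ := pieceConst n p (K * C₀) + pieceConst n p (K * C₁) * (1 - q)⁻¹ with hD
  have hDtop : D ≠ ⊤ := by
    refine ENNReal.add_ne_top.2 ⟨pieceConst_ne_top n (fun j => (hp j).1) _,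
      ENNReal.mul_ne_top (pieceConst_ne_top n (fun j => (hp j).1) _) ?_⟩
    exact ENNReal.inv_ne_top.2 (tsub_pos_of_lt hq1).ne'
  refine ⟨D.toNNReal, fun a x hax hab u => ?_⟩
  rw [ENNReal.coe_toNNReal hDtop, psdo_eq]
  set G := tensor fun j => fourierS ((u j).compSubConstCLM ℂ (-x)) with hG
  set M := ∏ j, maximalFn (p j) (u j) x with hM
  set b := a x with hbdef
  have hGi : Integrable G := integrable_tensor _
  have hbbound : ∀ Ξ, ‖b Ξ‖ ≤ K := by
    intro Ξ
    have h1 := hab [] (by simp) Ξ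
    simp only [wordDeriv_nil, List.length_nil, Nat.cast_zero, mul_zero, sub_zero] at h1
    exact h1.trans (mul_le_of_le_one_right hK
      (Real.rpow_le_one_of_one_le_of_nonpos (one_le_bracket Ξ) hm0))
  -- the factor `t ^ m` is available since `m ≤ 0` and `⟨Ξ⟩ ≥ t`
  have hword : ∀ (t : ℝ), 1 ≤ t → ∀ Ξ : Fin N → Rn n, t ≤ bracket Ξ →
      WordBound (2 * (N * n)) (K * t ^ m) (t ^ (-ρ)) b Ξ := by
    intro t ht Ξ hΞ l hl
    have ht0 : 0 < t := by linarith
    refine (hab l hl Ξ).trans ?_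
    rw [mul_assoc]
    refine mul_le_mul_of_nonneg_left ?_ hK
    rw [← Real.rpow_natCast, ← Real.rpow_mul ht0.le, ← Real.rpow_add ht0, neg_mul,
      ← sub_eq_add_neg]
    refine Real.rpow_le_rpow_of_nonpos ht0 hΞ ?_
    have : 0 ≤ ρ * (l.length : ℝ) := by positivity
    linarith
  -- the piece at low frequencies
  have hlow : ‖∫ Ξ, b Ξ * cutoffAt 1 Ξ * G Ξ‖ₑ ≤ pieceConst n p (K * C₀) * M := by
    have h := enorm_integral_piece_le (m := m) hn hp hρ1 hK hC₀ le_rfl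
      (contDiff_cutoffAt (n := n) (N := N) 1)
      (fun Ξ hΞ => by
        by_contra! hc
        exact hΞ (cutoffAt_eq_zero one_pos (by linarith))) hχb hax
      (fun Ξ _ => hword 1 le_rfl Ξ (one_le_bracket Ξ)) u x
    simpa using h
  -- the dyadic pieces
  have hpiece : ∀ k : ℕ, ‖∫ Ξ, b Ξ * η (((2 : ℝ) ^ k)⁻¹ • Ξ) * G Ξ‖ₑ ≤
      pieceConst n p (K * C₁) * q ^ k * M := by
    intro k
    have ht : (1 : ℝ) ≤ 2 ^ k := one_le_pow₀ one_le_two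
    have ht0 : (0 : ℝ) < 2 ^ k := by positivity
    have h := enorm_integral_piece_le (m := m) hn hp hρ1 hK hC₁ ht hηc
      (fun Ξ hΞ => by
        by_contra! hc
        exact hΞ (by
          simp only [hη]
          rw [cutoffAt_eq_zero one_pos (by linarith), cutoffAt_eq_zero two_pos (by linarith),
            sub_zero])) hηb hax
      (fun Ξ hΞ => by
        refine hword _ ht Ξ (le_trans ?_ (norm_le_bracket Ξ))
        have hcl : IsClosed {Ξ : Fin N → Rn n | (2 : ℝ) ^ k ≤ ‖Ξ‖} :=
          isClosed_le continuous_const continuous_norm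
        refine closure_minimal (fun Ξ hΞ => ?_) hcl hΞ
        by_contra hc
        refine hΞ ?_
        have hlt : ‖Ξ‖ ≤ 2 ^ k := (not_le.1 hc).le
        simp only [hη]
        rw [cutoffAt_smul, cutoffAt_smul, one_mul, cutoffAt_eq_one ht0 hlt,
          cutoffAt_eq_one (by positivity) (by linarith), sub_self]) u x
    refine h.trans (le_of_eq ?_)
    rw [hq, ← ENNReal.ofReal_pow (by positivity), ← Real.rpow_natCast, ← Real.rpow_natCast,
      ← Real.rpow_mul (by norm_num), ← Real.rpow_mul (by norm_num), mul_comm (k : ℝ)]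
  have hint : ∀ t : ℝ, Integrable fun Ξ => b Ξ * cutoffAt t Ξ * G Ξ := by
    intro t
    refine hGi.bdd_mul (c := K) ?_ (Eventually.of_forall fun Ξ => ?_)
    · exact (hax.continuous.mul (contDiff_cutoffAt t).continuous).aestronglyMeasurable
    · rw [norm_mul]
      exact (mul_le_of_le_one_right (norm_nonneg _) (norm_cutoffAt_le t Ξ)).trans (hbbound Ξ)
  -- the dyadic pieces are differences of consecutive cut-offs, so that the sums telescope
  have hpartial : ∀ k : ℕ, ‖∫ Ξ, b Ξ * cutoffAt (2 ^ k) Ξ * G Ξ‖ₑ ≤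
      pieceConst n p (K * C₀) * M + ∑ i ∈ Finset.range k, pieceConst n p (K * C₁) * q ^ i * M := by
    intro k
    induction k with
    | zero => simpa using hlow
    | succ k ih =>
      have hsplit : ∫ Ξ, b Ξ * cutoffAt (2 ^ (k + 1)) Ξ * G Ξ =
          (∫ Ξ, b Ξ * cutoffAt (2 ^ k) Ξ * G Ξ) +
            ∫ Ξ, b Ξ * η (((2 : ℝ) ^ k)⁻¹ • Ξ) * G Ξ := by
        have e : ∀ Ξ, b Ξ * η (((2 : ℝ) ^ k)⁻¹ • Ξ) * G Ξ =
            b Ξ * cutoffAt (2 ^ (k + 1)) Ξ * G Ξ - b Ξ * cutoffAt (2 ^ k) Ξ * G Ξ := by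
          intro Ξ
          simp only [hη]
          rw [cutoffAt_smul, cutoffAt_smul, one_mul, pow_succ' (2 : ℝ) k]
          ring
        simp_rw [e]
        rw [integral_sub (hint _) (hint _)]
        ring
      rw [hsplit, Finset.sum_range_succ, ← add_assoc]
      exact (enorm_add_le _ _).trans (add_le_add ih (hpiece k))
  have hbound : ∀ k : ℕ, ‖∫ Ξ, b Ξ * cutoffAt (2 ^ k) Ξ * G Ξ‖ₑ ≤ D * M := by
    intro k
    refine (hpartial k).trans ?_
    rw [hD, add_mul]
    gcongr
    rw [← Finset.sum_mul, ← Finset.mul_sum]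
    gcongr
    rw [← ENNReal.tsum_geometric]
    exact ENNReal.sum_le_tsum _
  have hlim : Tendsto (fun k : ℕ => ∫ Ξ, b Ξ * cutoffAt (2 ^ k) Ξ * G Ξ) atTop
      (𝓝 (∫ Ξ, b Ξ * G Ξ)) := by
    refine tendsto_integral_of_dominated_convergence (fun Ξ => K * ‖G Ξ‖)
      (fun k => (hint _).aestronglyMeasurable) (hGi.norm.const_mul K)
      (fun k => Eventually.of_forall fun Ξ => ?_) (Eventually.of_forall fun Ξ => ?_)
    · rw [norm_mul, norm_mul]
      gcongr
      exact (mul_le_of_le_one_right (norm_nonneg _) (norm_cutoffAt_le _ Ξ)).trans (hbbound Ξ)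
    · have hev : ∀ᶠ k : ℕ in atTop, ‖Ξ‖ ≤ (2 : ℝ) ^ k :=
        (tendsto_pow_atTop_atTop_of_one_lt one_lt_two).eventually_ge_atTop _
      refine tendsto_const_nhds.congr' ?_
      filter_upwards [hev] with k hk
      rw [cutoffAt_eq_one (by positivity) hk, mul_one]
  exact le_of_tendsto hlim.enorm (Eventually.of_forall hbound)

/-- The multi-indices with all entries at most `2nN`; those of order at most `2nN` are among
them. -/
def derivIndices (n N : ℕ) : Finset (MultiIndex n N) :=
  Fintype.piFinset fun _ => Finset.range (2 * (N * n) + 1)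

lemma exists_enorm_psdo_le_of_symbolBoundAt (hn : 1 ≤ n) {p : Fin N → ℝ}
    (hp : ∀ j, 1 ≤ p j ∧ p j ≤ 2) {m ρ : ℝ} (hρ0 : 0 ≤ ρ) (hρ1 : ρ ≤ 1)
    (hm : m < (ρ - 1) * ∑ j, (n : ℝ) / p j) (K : MultiIndex n N → ℝ) :
    ∃ C : ℝ≥0, ∀ (a : Rn n → (Fin N → Rn n) → ℂ) (x : Rn n), ContDiff ℝ ∞ (a x) →
      (∀ α ∈ derivIndices n N, ∀ Ξ, SymbolBoundAt m ρ a α (K α) x Ξ) →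
      ∀ u : Fin N → 𝓢(Rn n, ℂ), ‖psdo a u x‖ₑ ≤ C * ∏ j, maximalFn (p j) (u j) x := by
  obtain ⟨C, hC⟩ := exists_enorm_psdo_le (N := N) hn hp hρ0 hρ1 hm
    (K := ∑ α ∈ derivIndices n N, |K α|) (Finset.sum_nonneg fun _ _ => abs_nonneg _)
  refine ⟨C, fun a x hax hab u => hC a x hax (fun l hl Ξ => ?_) u⟩
  have hmem : (fun c => l.count c) ∈ derivIndices n N := by
    refine Fintype.mem_piFinset.2 fun c => Finset.mem_range.2 ?_
    exact Nat.lt_succ_of_le (List.count_le_length.trans hl)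
  have h := hab _ hmem Ξ
  unfold SymbolBoundAt at h
  rw [← wordDeriv_eq_multiDeriv hax, order_count] at h
  have hbr : 0 ≤ bracket Ξ ^ (m - ρ * (l.length : ℝ)) :=
    Real.rpow_nonneg (zero_le_one.trans (one_le_bracket Ξ)) _
  refine h.trans (mul_le_mul_of_nonneg_right ((le_abs_self _).trans ?_) hbr)
  exact Finset.single_le_sum (f := fun α => |K α|) (fun _ _ => abs_nonneg _) hmem

/-- A symbol estimate which holds for each `Ξ` at almost every `x` holds at almost every `x` for
all `Ξ`, by continuity in `Ξ`. -/
lemma ae_forall_symbolBoundAt {m ρ : ℝ} {a : Rn n → (Fin N → Rn n) → ℂ}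
    (ha : ∀ᵐ x, ContDiff ℝ ∞ (a x)) {α : MultiIndex n N} {C : ℝ}
    (h : ∀ Ξ, ∀ᵐ x, SymbolBoundAt m ρ a α C x Ξ) :
    ∀ᵐ x, ∀ Ξ, SymbolBoundAt m ρ a α C x Ξ := by
  have h' : ∀ᵐ x, ∀ i : ℕ, SymbolBoundAt m ρ a α C x (TopologicalSpace.denseSeq _ i) :=
    ae_all_iff.2 fun i => h _
  filter_upwards [ha, h'] with x hx hi
  have hcl : IsClosed {Ξ | SymbolBoundAt m ρ a α C x Ξ} := by
    refine isClosed_le (contDiff_multiDeriv hx α).continuous.norm (continuous_const.mul ?_)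
    exact continuous_bracket.rpow_const fun Ξ =>
      Or.inl (zero_lt_one.trans_le (one_le_bracket Ξ)).ne'
  intro Ξ
  exact (TopologicalSpace.denseRange_denseSeq (Fin N → Rn n)).induction_on Ξ hcl hi

end Pointwise

/-! ### Maximal operators of doubling measures -/


section Maximal

variable {n : ℕ}

/-- The non-centred maximal operator over balls with respect to a measure `ν`. -/
def maxOp (ν : Measure (Rn n)) (f : Rn n → ℝ≥0∞) (x : Rn n) : ℝ≥0∞ :=
  ⨆ (c : Rn n) (s : ℝ) (_ : x ∈ Metric.ball c s),
    (∫⁻ y in Metric.ball c s, f y ∂ν) / ν (Metric.ball c s)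

lemma le_maxOp (ν : Measure (Rn n)) (f : Rn n → ℝ≥0∞) {x c : Rn n} {s : ℝ}
    (hx : x ∈ Metric.ball c s) :
    (∫⁻ y in Metric.ball c s, f y ∂ν) / ν (Metric.ball c s) ≤ maxOp ν f x :=
  le_iSup_of_le c (le_iSup_of_le s (le_iSup_of_le hx le_rfl))

lemma maxOp_le {ν : Measure (Rn n)} {f : Rn n → ℝ≥0∞} {x : Rn n} {b : ℝ≥0∞}
    (h : ∀ c s, x ∈ Metric.ball c s →
      (∫⁻ y in Metric.ball c s, f y ∂ν) / ν (Metric.ball c s) ≤ b) : maxOp ν f x ≤ b :=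
  iSup_le fun c => iSup_le fun s => iSup_le fun hx => h c s hx

lemma isOpen_lt_maxOp (ν : Measure (Rn n)) (f : Rn n → ℝ≥0∞) (t : ℝ≥0∞) :
    IsOpen {x | t < maxOp ν f x} := by
  rw [isOpen_iff_mem_nhds]
  intro x hx
  simp only [Set.mem_ofPred_eq, maxOp, lt_iSup_iff] at hx
  obtain ⟨c, s, hxs, hlt⟩ := hx
  filter_upwards [Metric.isOpen_ball.mem_nhds hxs] with y hy
  exact hlt.trans_le (le_maxOp ν f hy)

lemma measurable_maxOp (ν : Measure (Rn n)) (f : Rn n → ℝ≥0∞) : Measurable (maxOp ν f) :=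
  measurable_of_Ioi fun t => (isOpen_lt_maxOp ν f t).measurableSet

/-- A measure on `ℝⁿ` for which balls have positive finite measure and which is doubling, with
enlargement factor `4`. -/
structure IsBallDoubling (ν : Measure (Rn n)) (D : ℝ≥0∞) : Prop where
  pos : ∀ (c : Rn n) (s : ℝ), 0 < s → ν (Metric.ball c s) ≠ 0
  ne_top : ∀ (c : Rn n) (s : ℝ), ν (Metric.ball c s) ≠ ⊤
  doubling : ∀ (c : Rn n) (s : ℝ), 0 < s →
    ν (Metric.ball c (4 * s)) ≤ D * ν (Metric.ball c s)

/-- The weak type `(1,1)` estimate, by Vitali's covering lemma. -/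
lemma IsBallDoubling.measure_lt_maxOp_le {ν : Measure (Rn n)} {D : ℝ≥0∞}
    (hν : IsBallDoubling ν D) (f : Rn n → ℝ≥0∞) {t : ℝ≥0∞} (ht0 : t ≠ 0) (ht : t ≠ ⊤) :
    ν {x | t < maxOp ν f x} ≤ D * t⁻¹ * ∫⁻ x, f x ∂ν := by
  set T : ℕ → Set (Rn n × ℝ) := fun R => {b | 0 < b.2 ∧ b.2 ≤ R ∧
    t * ν (Metric.ball b.1 b.2) < ∫⁻ y in Metric.ball b.1 b.2, f y ∂ν} with hT
  set U : ℕ → Set (Rn n) := fun R => ⋃ b ∈ T R, Metric.ball b.1 b.2 with hU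
  have hUmono : Monotone U := by
    intro R R' hR
    refine Set.biUnion_subset_biUnion_left fun b hb => ⟨hb.1, hb.2.1.trans ?_, hb.2.2⟩
    exact_mod_cast hR
  have hcover : {x | t < maxOp ν f x} ⊆ ⋃ R, U R := by
    intro x hx
    simp only [Set.mem_ofPred_eq, maxOp, lt_iSup_iff] at hx
    obtain ⟨c, s, hxs, hlt⟩ := hx
    have hs : 0 < s := Metric.pos_of_mem_ball hxs
    obtain ⟨R, hR⟩ := exists_nat_ge s
    refine Set.mem_iUnion.2 ⟨R, Set.mem_biUnion (x := (c, s)) ⟨hs, hR, ?_⟩ hxs⟩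
    rwa [ENNReal.lt_div_iff_mul_lt (Or.inl (hν.pos c s hs)) (Or.inl (hν.ne_top c s))] at hlt
  have hbound : ∀ R, ν (U R) ≤ D * t⁻¹ * ∫⁻ x, f x ∂ν := by
    intro R
    obtain ⟨u, huT, hdisj, hcov⟩ := Vitali.exists_disjoint_subfamily_covering_enlargement_ball
      (T R) (fun b => b.1) (fun b => b.2) R (fun b hb => hb.2.1) 4 (by norm_num)
    have hucount : u.Countable :=
      hdisj.countable_of_isOpen (fun b _ => Metric.isOpen_ball)
        (fun b hb => ⟨b.1, Metric.mem_ball_self (huT hb).1⟩)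
    have hsub : U R ⊆ ⋃ b ∈ u, Metric.ball b.1 (4 * b.2) := by
      refine Set.iUnion₂_subset fun a ha => ?_
      obtain ⟨b, hb, hab⟩ := hcov a ha
      exact hab.trans (Set.subset_biUnion_of_mem (u := fun b : Rn n × ℝ => Metric.ball b.1 (4 * b.2)) hb)
    calc ν (U R) ≤ ν (⋃ b ∈ u, Metric.ball b.1 (4 * b.2)) := measure_mono hsub
      _ ≤ ∑' b : u, ν (Metric.ball b.1.1 (4 * b.1.2)) := measure_biUnion_le _ hucount _
      _ ≤ ∑' b : u, D * t⁻¹ * ∫⁻ y in Metric.ball b.1.1 b.1.2, f y ∂ν := by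
          refine ENNReal.tsum_le_tsum fun b => ?_
          have hb := huT b.2
          refine (hν.doubling _ _ hb.1).trans ?_
          rw [mul_assoc]
          gcongr
          rw [mul_comm, ← div_eq_mul_inv, ENNReal.le_div_iff_mul_le (Or.inl ht0) (Or.inl ht),
            mul_comm]
          exact hb.2.2.le
      _ = D * t⁻¹ * ∫⁻ y in ⋃ b ∈ u, Metric.ball b.1 b.2, f y ∂ν := by
          rw [ENNReal.tsum_mul_left, lintegral_biUnion hucount (fun b _ => measurableSet_ball)
            hdisj]
      _ ≤ D * t⁻¹ * ∫⁻ x, f x ∂ν := by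
          gcongr
          exact Measure.restrict_le_self
  calc ν {x | t < maxOp ν f x} ≤ ν (⋃ R, U R) := measure_mono hcover
    _ = ⨆ R, ν (U R) := hUmono.measure_iUnion
    _ ≤ _ := iSup_le hbound

/-- The weak type estimate for the part of `f` above half of the level: the part below adds at
most `t` to the maximal function. -/
lemma IsBallDoubling.measure_lt_maxOp_le_setLIntegral {ν : Measure (Rn n)} {D : ℝ≥0∞}
    (hν : IsBallDoubling ν D) {f : Rn n → ℝ≥0∞} (hf : Measurable f) {t : ℝ≥0∞} (ht0 : t ≠ 0)
    (ht : t ≠ ⊤) :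
    ν {x | 2 * t < maxOp ν f x} ≤ D * t⁻¹ * ∫⁻ x in {x | t < f x}, f x ∂ν := by
  have hS : MeasurableSet {x | t < f x} := measurableSet_lt measurable_const hf
  rw [← lintegral_indicator hS]
  refine (measure_mono fun x hx => ?_).trans (hν.measure_lt_maxOp_le _ ht0 ht)
  simp only [Set.mem_ofPred_eq] at hx ⊢
  have hle : maxOp ν f x ≤ maxOp ν ({x | t < f x}.indicator f) x + t := by
    refine maxOp_le fun c s hxs => ?_
    have hs : 0 < s := Metric.pos_of_mem_ball hxs
    refine le_trans ?_ (add_le_add_left (le_maxOp ν _ hxs) t)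
    rw [ENNReal.div_le_iff (hν.pos c s hs) (hν.ne_top c s), add_mul,
      ENNReal.div_mul_cancel (hν.pos c s hs) (hν.ne_top c s), ← setLIntegral_const,
      ← lintegral_add_right _ measurable_const]
    refine lintegral_mono fun y => ?_
    by_cases hy : y ∈ {x | t < f x}
    · rw [Set.indicator_of_mem hy]
      exact le_self_add
    · exact (not_lt.1 hy).trans le_add_self
  by_contra! hc
  refine absurd (hx.trans_le (hle.trans (add_le_add_left hc t))) ?_
  rw [two_mul]
  exact lt_irrefl _

/-- The sum of a geometric progression over all dyadic levels below `a`. -/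
lemma tsum_dyadic_lt_le {r : ℝ} (hr : 0 < r) (a : ℝ≥0∞) :
    ∑' k : ℤ, (if (2 : ℝ≥0∞) ^ k < a then ((2 : ℝ≥0∞) ^ k) ^ r else 0) ≤
      (1 - (2⁻¹ : ℝ≥0∞) ^ r)⁻¹ * a ^ r := by
  have h20 : (2 : ℝ≥0∞) ≠ 0 := two_ne_zero
  have h2t : (2 : ℝ≥0∞) ≠ ⊤ := ENNReal.ofNat_ne_top
  rcases eq_or_ne a 0 with rfl | ha0
  · simp
  rcases eq_or_ne a ⊤ with rfl | hat
  · rw [ENNReal.top_rpow_of_pos hr, ENNReal.mul_top]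
    · exact le_top
    · exact ENNReal.inv_ne_zero.2 (ENNReal.sub_ne_top ENNReal.one_ne_top)
  obtain ⟨K, hK1, hK2⟩ := ENNReal.exists_mem_Ioc_zpow ha0 hat ENNReal.one_lt_two h2t
  have hinj : Function.Injective fun j : ℕ => K - (j : ℤ) := fun i j h => by
    simp only at h
    omega
  rw [← hinj.tsum_eq]
  · calc ∑' j : ℕ, (if (2 : ℝ≥0∞) ^ (K - (j : ℤ)) < a then ((2 : ℝ≥0∞) ^ (K - (j : ℤ))) ^ r else 0)
        ≤ ∑' j : ℕ, ((2 : ℝ≥0∞) ^ K) ^ r * ((2⁻¹ : ℝ≥0∞) ^ r) ^ j := by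
          refine ENNReal.tsum_le_tsum fun j => ?_
          split_ifs
          · rw [ENNReal.zpow_sub h20 h2t, zpow_natCast, ENNReal.mul_rpow_of_nonneg _ _ hr.le]
            refine mul_le_mul_right (le_of_eq ?_) _
            rw [ENNReal.inv_pow, ← ENNReal.rpow_natCast, ← ENNReal.rpow_natCast,
              ← ENNReal.rpow_mul, ← ENNReal.rpow_mul, mul_comm]
          · exact zero_le
      _ = ((2 : ℝ≥0∞) ^ K) ^ r * (1 - (2⁻¹ : ℝ≥0∞) ^ r)⁻¹ := by
          rw [ENNReal.tsum_mul_left, ENNReal.tsum_geometric]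
      _ ≤ _ := by
          rw [mul_comm]
          gcongr
  · intro k hk
    rw [Function.mem_support] at hk
    have hlt : (2 : ℝ≥0∞) ^ k < a := by
      by_contra hc
      exact hk (if_neg hc)
    have hkK : k ≤ K := by
      by_contra! hc
      have : (2 : ℝ≥0∞) ^ (K + 1) ≤ 2 ^ k := ENNReal.zpow_le_of_le one_le_two (by omega)
      exact absurd (hK2.trans this) (not_le.2 hlt)
    exact ⟨(K - k).toNat, by simp only; omega⟩

/-- The dyadic form of the layer cake formula; the level `2 * 2 ^ k` is the one at which the weak
type estimate for the part of a function above `2 ^ k` applies. -/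
lemma rpow_le_tsum_dyadic {p : ℝ} (hp : 0 < p) (a : ℝ≥0∞) :
    a ^ p ≤ ∑' k : ℤ, (if (2 : ℝ≥0∞) * 2 ^ k < a then (4 * (2 : ℝ≥0∞) ^ k) ^ p else 0) := by
  have h20 : (2 : ℝ≥0∞) ≠ 0 := two_ne_zero
  have h2t : (2 : ℝ≥0∞) ≠ ⊤ := ENNReal.ofNat_ne_top
  rcases eq_or_ne a 0 with rfl | ha0
  · simp [hp]
  rcases eq_or_ne a ⊤ with rfl | hat
  · have hterm : ∀ j : ℕ, ((2 : ℝ≥0∞) ^ p) ^ j ≤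
        ∑' k : ℤ, (if (2 : ℝ≥0∞) * 2 ^ k < ⊤ then (4 * (2 : ℝ≥0∞) ^ k) ^ p else 0) := by
      intro j
      refine le_trans ?_ (ENNReal.le_tsum (j : ℤ))
      have hfin : (2 : ℝ≥0∞) * 2 ^ (j : ℤ) < ⊤ := by
        rw [zpow_natCast]
        exact ENNReal.mul_lt_top h2t.lt_top (ENNReal.pow_lt_top h2t.lt_top)
      rw [if_pos hfin, zpow_natCast, ← ENNReal.rpow_natCast, ← ENNReal.rpow_mul, mul_comm,
        ENNReal.rpow_mul, ENNReal.rpow_natCast]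
      refine ENNReal.rpow_le_rpow ?_ hp.le
      exact le_mul_of_one_le_left' (by norm_num)
    have hlim : Tendsto (fun j : ℕ => ((2 : ℝ≥0∞) ^ p) ^ j) atTop (𝓝 ⊤) :=
      ENNReal.tendsto_pow_atTop_nhds_top_iff.2 (ENNReal.one_lt_rpow ENNReal.one_lt_two hp)
    exact le_top.trans (le_of_tendsto' hlim hterm)
  obtain ⟨K, hK1, hK2⟩ := ENNReal.exists_mem_Ioc_zpow ha0 hat ENNReal.one_lt_two h2t
  refine le_trans ?_ (ENNReal.le_tsum (K - 1))
  have e1 : (2 : ℝ≥0∞) * 2 ^ (K - 1) = 2 ^ K := by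
    rw [ENNReal.zpow_sub h20 h2t, zpow_one, mul_comm ((2 : ℝ≥0∞) ^ K), ← mul_assoc,
      ENNReal.mul_inv_cancel h20 h2t, one_mul]
  have e2 : (4 : ℝ≥0∞) * 2 ^ (K - 1) = 2 ^ (K + 1) := by
    rw [show (4 : ℝ≥0∞) = 2 * 2 by norm_num, mul_assoc, e1, ENNReal.zpow_add h20 h2t, zpow_one,
      mul_comm]
  rw [e1, e2, if_pos hK1]
  exact ENNReal.rpow_le_rpow hK2 hp.le

/-- The strong type estimate for the maximal operator of a doubling measure, by interpolation of
the weak type `(1,1)` estimate with the trivial `L^∞` estimate. -/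
theorem IsBallDoubling.lintegral_maxOp_rpow_le {ν : Measure (Rn n)} {D : ℝ≥0∞} (hD : D ≠ ⊤)
    (hν : IsBallDoubling ν D) {p : ℝ} (hp : 1 < p) :
    ∃ C : ℝ≥0∞, C ≠ ⊤ ∧ ∀ f : Rn n → ℝ≥0∞, Measurable f →
      ∫⁻ x, maxOp ν f x ^ p ∂ν ≤ C * ∫⁻ x, f x ^ p ∂ν := by
  have h20 : (2 : ℝ≥0∞) ≠ 0 := two_ne_zero
  have h2t : (2 : ℝ≥0∞) ≠ ⊤ := ENNReal.ofNat_ne_top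
  have hp0 : 0 < p := by linarith
  have hp1 : 0 < p - 1 := by linarith
  have hlt1 : (2⁻¹ : ℝ≥0∞) ^ (p - 1) < 1 :=
    ENNReal.rpow_lt_one (ENNReal.inv_lt_one.2 ENNReal.one_lt_two) hp1
  refine ⟨4 ^ p * D * (1 - (2⁻¹ : ℝ≥0∞) ^ (p - 1))⁻¹, ?_, fun f hf => ?_⟩
  · refine ENNReal.mul_ne_top (ENNReal.mul_ne_top
      (ENNReal.rpow_ne_top_of_nonneg hp0.le ENNReal.ofNat_ne_top) hD) ?_
    exact ENNReal.inv_ne_top.2 (tsub_pos_of_lt hlt1).ne'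
  have hk0 : ∀ k : ℤ, (2 : ℝ≥0∞) ^ k ≠ 0 := fun k => (ENNReal.zpow_pos h20 h2t k).ne'
  have hkt : ∀ k : ℤ, (2 : ℝ≥0∞) ^ k ≠ ⊤ := fun k => (ENNReal.zpow_lt_top h20 h2t k).ne
  have hS : ∀ k : ℤ, MeasurableSet {x | (2 : ℝ≥0∞) ^ k < f x} := fun k =>
    measurableSet_lt measurable_const hf
  have hS' : ∀ k : ℤ, MeasurableSet {x | (2 : ℝ≥0∞) * 2 ^ k < maxOp ν f x} := fun k =>
    measurableSet_lt measurable_const (measurable_maxOp ν f)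
  have hg : ∀ k : ℤ, Measurable fun x => f x *
      {x | (2 : ℝ≥0∞) ^ k < f x}.indicator (fun _ => ((2 : ℝ≥0∞) ^ k) ^ (p - 1)) x := fun k =>
    hf.mul (measurable_const.indicator (hS k))
  calc ∫⁻ x, maxOp ν f x ^ p ∂ν
      ≤ ∫⁻ x, ∑' k : ℤ, {x | (2 : ℝ≥0∞) * 2 ^ k < maxOp ν f x}.indicator
          (fun _ => (4 * (2 : ℝ≥0∞) ^ k) ^ p) x ∂ν := by
        refine lintegral_mono fun x => (rpow_le_tsum_dyadic hp0 _).trans (le_of_eq ?_)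
        simp only [Set.indicator_apply, Set.mem_ofPred_eq]
    _ = ∑' k : ℤ, (4 * (2 : ℝ≥0∞) ^ k) ^ p * ν {x | (2 : ℝ≥0∞) * 2 ^ k < maxOp ν f x} := by
        rw [lintegral_tsum fun k => (measurable_const.indicator (hS' k)).aemeasurable]
        simp_rw [lintegral_indicator_const (hS' _)]
    _ ≤ ∑' k : ℤ, ∫⁻ x, 4 ^ p * D * (f x *
          {x | (2 : ℝ≥0∞) ^ k < f x}.indicator (fun _ => ((2 : ℝ≥0∞) ^ k) ^ (p - 1)) x) ∂ν := by
        refine ENNReal.tsum_le_tsum fun k => ?_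
        have h1 := hν.measure_lt_maxOp_le_setLIntegral hf (hk0 k) (hkt k)
        have hpow : (4 * (2 : ℝ≥0∞) ^ k) ^ p * ((2 : ℝ≥0∞) ^ k)⁻¹ =
            4 ^ p * ((2 : ℝ≥0∞) ^ k) ^ (p - 1) := by
          rw [ENNReal.mul_rpow_of_nonneg _ _ hp0.le, mul_assoc, ENNReal.rpow_sub _ _ (hk0 k) (hkt k),
            ENNReal.rpow_one, div_eq_mul_inv]
        calc _ ≤ (4 * (2 : ℝ≥0∞) ^ k) ^ p * (D * ((2 : ℝ≥0∞) ^ k)⁻¹ *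
              ∫⁻ x in {x | (2 : ℝ≥0∞) ^ k < f x}, f x ∂ν) := by gcongr
          _ = 4 ^ p * D * (((2 : ℝ≥0∞) ^ k) ^ (p - 1) *
              ∫⁻ x in {x | (2 : ℝ≥0∞) ^ k < f x}, f x ∂ν) := by
              rw [← mul_assoc, mul_comm D, ← mul_assoc, hpow]
              ring
          _ = _ := by
              rw [lintegral_const_mul _ (hg k),
                ← lintegral_indicator (hS k), ← lintegral_const_mul _ (hf.indicator (hS k))]
              congr 1
              refine lintegral_congr fun x => ?_
              by_cases hx : x ∈ {x | (2 : ℝ≥0∞) ^ k < f x}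
              · rw [Set.indicator_of_mem hx, Set.indicator_of_mem hx, mul_comm]
              · rw [Set.indicator_of_notMem hx, Set.indicator_of_notMem hx, mul_zero, mul_zero]
    _ = ∫⁻ x, 4 ^ p * D * (f x * ∑' k : ℤ,
          (if (2 : ℝ≥0∞) ^ k < f x then ((2 : ℝ≥0∞) ^ k) ^ (p - 1) else 0)) ∂ν := by
        rw [← lintegral_tsum fun k => ((hg k).const_mul _).aemeasurable]
        refine lintegral_congr fun x => ?_
        rw [ENNReal.tsum_mul_left, ENNReal.tsum_mul_left]
        simp only [Set.indicator_apply, Set.mem_ofPred_eq]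
    _ ≤ ∫⁻ x, 4 ^ p * D * (1 - (2⁻¹ : ℝ≥0∞) ^ (p - 1))⁻¹ * f x ^ p ∂ν := by
        refine lintegral_mono fun x => ?_
        have h1 := tsum_dyadic_lt_le hp1 (f x)
        have h2 : f x * f x ^ (p - 1) = f x ^ p := by
          nth_rewrite 1 [← ENNReal.rpow_one (f x)]
          rw [← ENNReal.rpow_add_of_nonneg _ _ zero_le_one hp1.le]
          congr 1
          ring
        calc _ ≤ 4 ^ p * D * (f x * ((1 - (2⁻¹ : ℝ≥0∞) ^ (p - 1))⁻¹ * f x ^ (p - 1))) := by gcongr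
          _ = 4 ^ p * D * (1 - (2⁻¹ : ℝ≥0∞) ^ (p - 1))⁻¹ * (f x * f x ^ (p - 1)) := by ring
          _ = _ := by rw [h2]
    _ = _ := by rw [lintegral_const_mul _ (hf.pow_const p)]

end Maximal

/-! ### Muckenhoupt's theorem -/


section Muckenhoupt

variable {n : ℕ}

/-- The condition `A_p` with constant `A` for a density `W` with values in `(0, ∞)`. The average
of the dual density `W^{-1/(p-1)}` appears in the second factor. -/
structure IsApDensity (p : ℝ) (A : ℝ≥0∞) (W : Rn n → ℝ≥0∞) : Prop where
  measurable : Measurable W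
  ne_zero : ∀ x, W x ≠ 0
  ne_top : ∀ x, W x ≠ ⊤
  lintegral_ne_top : ∀ (c : Rn n) (s : ℝ), ∫⁻ y in Metric.ball c s, W y ≠ ⊤
  bound : ∀ (c : Rn n) (s : ℝ), 0 < s →
    (∫⁻ y in Metric.ball c s, W y) * (∫⁻ y in Metric.ball c s, W y ^ (-(p - 1)⁻¹)) ^ (p - 1) ≤
      A * volume (Metric.ball c s) ^ p

variable {p : ℝ} {A : ℝ≥0∞} {W : Rn n → ℝ≥0∞}

lemma volume_ball_ne_zero (c : Rn n) {s : ℝ} (hs : 0 < s) : volume (Metric.ball c s) ≠ 0 :=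
  (Metric.measure_ball_pos volume c hs).ne'

lemma volume_ball_ne_top (c : Rn n) (s : ℝ) : volume (Metric.ball c s) ≠ ⊤ :=
  measure_ball_lt_top.ne

lemma setLIntegral_ball_ne_zero (hW : Measurable W) (h0 : ∀ x, W x ≠ 0) (c : Rn n) {s : ℝ}
    (hs : 0 < s) : ∫⁻ y in Metric.ball c s, W y ≠ 0 := by
  intro h
  rw [lintegral_eq_zero_iff hW] at h
  have h1 : ∀ᵐ y ∂volume.restrict (Metric.ball c s), False := by
    filter_upwards [h] with y hy using h0 y hy
  have h2 := (ae_iff.1 h1)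
  simp only [not_false_eq_true, Set.ofPred_true, Measure.restrict_apply_univ] at h2
  exact volume_ball_ne_zero c hs h2

/-- The dual density of an `A_p` density is an `A_{p'}` density. -/
lemma IsApDensity.dual (hp : 1 < p) (hA : A ≠ ⊤) (h : IsApDensity p A W) :
    IsApDensity ((p - 1)⁻¹ + 1) (A ^ (p - 1)⁻¹) fun y => W y ^ (-(p - 1)⁻¹) := by
  have hp1 : 0 < p - 1 := by linarith
  refine ⟨h.measurable.pow_const _, fun x => ?_, fun x => ?_, fun c s => ?_, fun c s hs => ?_⟩
  · rw [ENNReal.rpow_neg]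
    exact ENNReal.inv_ne_zero.2 (ENNReal.rpow_ne_top_of_nonneg (by positivity) (h.ne_top x))
  · rw [ENNReal.rpow_neg]
    refine ENNReal.inv_ne_top.2 ?_
    simp [h.ne_zero x, h.ne_top x]
  · rcases le_or_gt s 0 with hs | hs
    · simp [Metric.ball_eq_empty.2 hs]
    · have h1 := h.bound c s hs
      intro htop
      rw [htop, ENNReal.top_rpow_of_pos hp1,
        ENNReal.mul_top (setLIntegral_ball_ne_zero h.measurable h.ne_zero c hs), top_le_iff] at h1
      exact ENNReal.mul_ne_top hA
        (ENNReal.rpow_ne_top_of_nonneg (by linarith) (volume_ball_ne_top c s)) h1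
  · have h1 := ENNReal.rpow_le_rpow (h.bound c s hs) (by positivity : 0 ≤ (p - 1)⁻¹)
    rw [ENNReal.mul_rpow_of_nonneg _ _ (by positivity), ENNReal.mul_rpow_of_nonneg _ _ (by positivity),
      ← ENNReal.rpow_mul, ← ENNReal.rpow_mul, mul_inv_cancel₀ hp1.ne', ENNReal.rpow_one,
      mul_comm] at h1
    have e1 : (p - 1)⁻¹ + 1 - 1 = (p - 1)⁻¹ := by ring
    have e2 : p * (p - 1)⁻¹ = (p - 1)⁻¹ + 1 := by
      field_simp
      ring
    rw [e2] at h1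
    rw [e1, inv_inv]
    have e3 : ∀ y, (W y ^ (-(p - 1)⁻¹)) ^ (-(p - 1)) = W y := by
      intro y
      rw [← ENNReal.rpow_mul, neg_mul_neg, inv_mul_cancel₀ hp1.ne', ENNReal.rpow_one]
    simp_rw [e3]
    exact h1

/-- The reverse of the `A_p` inequality, which is Hölder's inequality. -/
lemma volume_ball_rpow_le (hp : 1 < p) (hW : Measurable W) (h0 : ∀ x, W x ≠ 0)
    (ht : ∀ x, W x ≠ ⊤) (B : Set (Rn n)) :
    volume B ^ p ≤ (∫⁻ y in B, W y) * (∫⁻ y in B, W y ^ (-(p - 1)⁻¹)) ^ (p - 1) := by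
  have hp0 : 0 < p := by linarith
  have hp1 : 0 < p - 1 := by linarith
  have hpq : p.HolderConjugate (p / (p - 1)) := Real.HolderConjugate.conjExponent hp
  have h := ENNReal.lintegral_mul_le_Lp_mul_Lq (volume.restrict B) hpq
    (f := fun y => W y ^ p⁻¹) (g := fun y => W y ^ (-p⁻¹)) (hW.pow_const _).aemeasurable
    (hW.pow_const _).aemeasurable
  have e1 : ∀ y, W y ^ p⁻¹ * W y ^ (-p⁻¹) = 1 := by
    intro y
    rw [← ENNReal.rpow_add _ _ (h0 y) (ht y), add_neg_cancel, ENNReal.rpow_zero]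
  have e2 : ∀ y, (W y ^ p⁻¹) ^ p = W y := by
    intro y
    rw [← ENNReal.rpow_mul, inv_mul_cancel₀ hp0.ne', ENNReal.rpow_one]
  have e3 : ∀ y, (W y ^ (-p⁻¹)) ^ (p / (p - 1)) = W y ^ (-(p - 1)⁻¹) := by
    intro y
    rw [← ENNReal.rpow_mul]
    congr 1
    field_simp
  simp only [Pi.mul_apply, e1, e2, e3, lintegral_const, Measure.restrict_apply_univ,
    one_mul] at h
  have h' := ENNReal.rpow_le_rpow h hp0.le
  rw [ENNReal.mul_rpow_of_nonneg _ _ hp0.le, ← ENNReal.rpow_mul, ← ENNReal.rpow_mul,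
    one_div_mul_cancel hp0.ne', ENNReal.rpow_one] at h'
  have e4 : 1 / (p / (p - 1)) * p = p - 1 := by
    field_simp
  rwa [e4] at h'

/-- The measure of an `A_p` density is doubling. -/
lemma IsApDensity.isBallDoubling (hp : 1 < p) (h : IsApDensity p A W) :
    IsBallDoubling (volume.withDensity W) (A * (ENNReal.ofReal (4 ^ n)) ^ p) := by
  have hp0 : 0 < p := by linarith
  have hμ : ∀ (c : Rn n) (s : ℝ), volume.withDensity W (Metric.ball c s) =
      ∫⁻ y in Metric.ball c s, W y := fun c s => withDensity_apply _ measurableSet_ball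
  refine ⟨fun c s hs => ?_, fun c s => ?_, fun c s hs => ?_⟩
  · rw [hμ]
    exact setLIntegral_ball_ne_zero h.measurable h.ne_zero c hs
  · rw [hμ]
    exact h.lintegral_ne_top c s
  · rw [hμ, hμ]
    set w₁ := ∫⁻ y in Metric.ball c s, W y
    set w₄ := ∫⁻ y in Metric.ball c (4 * s), W y
    set v := volume (Metric.ball c s) with hv
    have hv0 : v ^ p ≠ 0 := by
      have := volume_ball_ne_zero c hs
      simp [hv, this, volume_ball_ne_top c s]
    have hvt : v ^ p ≠ ⊤ := ENNReal.rpow_ne_top_of_nonneg hp0.le (volume_ball_ne_top c s)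
    have hvol : volume (Metric.ball c (4 * s)) = ENNReal.ofReal (4 ^ n) * v := by
      rw [hv, Measure.addHaar_ball_mul_of_pos _ _ (by norm_num : (0 : ℝ) < 4),
        finrank_euclideanSpace_fin, Measure.addHaar_ball_center volume c s]
    have h1 := volume_ball_rpow_le hp h.measurable h.ne_zero h.ne_top (Metric.ball c s)
    have h2 := h.bound c (4 * s) (by positivity)
    have hsub : Metric.ball c s ⊆ Metric.ball c (4 * s) := Metric.ball_subset_ball (by linarith)
    have hmono : ∫⁻ y in Metric.ball c s, W y ^ (-(p - 1)⁻¹) ≤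
        ∫⁻ y in Metric.ball c (4 * s), W y ^ (-(p - 1)⁻¹) := lintegral_mono_set hsub
    rw [hvol, ENNReal.mul_rpow_of_nonneg _ _ hp0.le] at h2
    refine (ENNReal.mul_le_mul_iff_left hv0 hvt).1 ?_
    calc w₄ * v ^ p ≤ w₄ * (w₁ * (∫⁻ y in Metric.ball c s, W y ^ (-(p - 1)⁻¹)) ^ (p - 1)) := by
          gcongr
      _ ≤ w₄ * (w₁ * (∫⁻ y in Metric.ball c (4 * s), W y ^ (-(p - 1)⁻¹)) ^ (p - 1)) := by
          gcongr
      _ = w₁ * (w₄ * (∫⁻ y in Metric.ball c (4 * s), W y ^ (-(p - 1)⁻¹)) ^ (p - 1)) := by ring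
      _ ≤ w₁ * (A * (ENNReal.ofReal (4 ^ n) ^ p * v ^ p)) := by gcongr
      _ = _ := by ring

lemma doublingConst_ne_top (hp : 1 < p) (hA : A ≠ ⊤) :
    A * (ENNReal.ofReal (4 ^ n)) ^ p ≠ ⊤ :=
  ENNReal.mul_ne_top hA (ENNReal.rpow_ne_top_of_nonneg (by linarith) ENNReal.ofReal_ne_top)

/-- Lerner's pointwise inequality: with the dual density `V = W^{-1/(p-1)}`,
`(Mf)^{p-1} ≤ A · M_W((M_V(f/V))^{p-1}/W)`. On a ball `B` the `A_p` condition bounds the average of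
`f` to the power `p - 1` by `A (∫_B f / V(B))^{p-1} |B| / W(B)`, and `∫_B f / V(B)` is at most
`M_V(f/V)` at each point of `B`. -/
lemma IsApDensity.maxOp_rpow_le (hp : 1 < p) (hA : A ≠ ⊤) (h : IsApDensity p A W)
    {f : Rn n → ℝ≥0∞} (hf : Measurable f) (x : Rn n) :
    maxOp volume f x ^ (p - 1) ≤ A * maxOp (volume.withDensity W) (fun y =>
      maxOp (volume.withDensity fun y => W y ^ (-(p - 1)⁻¹)) (fun y => f y / W y ^ (-(p - 1)⁻¹)) y
        ^ (p - 1) / W y) x := by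
  have hp0 : 0 < p := by linarith
  have hp1 : 0 < p - 1 := by linarith
  set V : Rn n → ℝ≥0∞ := fun y => W y ^ (-(p - 1)⁻¹) with hV
  have hdual := h.dual hp hA
  set g : Rn n → ℝ≥0∞ := maxOp (volume.withDensity V) fun y => f y / V y with hg
  have hgm : Measurable g := measurable_maxOp _ _
  have hVm : Measurable V := hdual.measurable
  have hfVm : Measurable fun y => f y / V y := hf.div hVm
  have hgWm : Measurable fun y => g y ^ (p - 1) / W y := (hgm.pow_const _).div h.measurable
  rw [← ENNReal.le_rpow_inv_iff hp1]
  refine maxOp_le fun c s hxs => ?_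
  have hs : 0 < s := Metric.pos_of_mem_ball hxs
  set B := Metric.ball c s with hB
  have hBm : MeasurableSet B := measurableSet_ball
  set b := volume B with hb
  have hb0 : b ≠ 0 := volume_ball_ne_zero c hs
  have hbt : b ≠ ⊤ := volume_ball_ne_top c s
  set wB := ∫⁻ y in B, W y with hwB
  set vB := ∫⁻ y in B, V y with hvB
  have hw0 : wB ≠ 0 := setLIntegral_ball_ne_zero h.measurable h.ne_zero c hs
  have hwt : wB ≠ ⊤ := h.lintegral_ne_top c s
  have hv0 : vB ≠ 0 := setLIntegral_ball_ne_zero hdual.measurable hdual.ne_zero c hs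
  have hvt : vB ≠ ⊤ := hdual.lintegral_ne_top c s
  set F := ∫⁻ y in B, f y with hF
  have hfV : ∫⁻ y in B, f y / V y ∂(volume.withDensity V) = F := by
    rw [setLIntegral_withDensity_eq_setLIntegral_mul _ hVm hfVm hBm]
    refine lintegral_congr fun y => ?_
    simp only [Pi.mul_apply]
    exact ENNReal.mul_div_cancel (hdual.ne_zero y) (hdual.ne_top y)
  have hFg : ∀ y ∈ B, F / vB ≤ g y := by
    intro y hy
    have h1 := le_maxOp (volume.withDensity V) (fun y => f y / V y) hy
    rwa [hfV, withDensity_apply _ hBm] at h1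
  have hH : (F / vB) ^ (p - 1) * b / wB ≤
      maxOp (volume.withDensity W) (fun y => g y ^ (p - 1) / W y) x := by
    refine le_trans ?_ (le_maxOp (volume.withDensity W) _ hxs)
    rw [withDensity_apply _ hBm,
      setLIntegral_withDensity_eq_setLIntegral_mul _ h.measurable hgWm hBm]
    gcongr
    rw [hb, ← setLIntegral_const]
    refine setLIntegral_mono' hBm fun y hy => ?_
    rw [Pi.mul_apply, ENNReal.mul_div_cancel (h.ne_zero y) (h.ne_top y)]
    exact ENNReal.rpow_le_rpow (hFg y hy) hp1.le
  rw [ENNReal.le_rpow_inv_iff hp1]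
  refine le_trans ?_ (mul_le_mul_right hH A)
  have hbound := h.bound c s hs
  have hF' : F = F / vB * vB := (ENNReal.div_mul_cancel hv0 hvt).symm
  have hkey : F ^ (p - 1) * wB ≤ (F / vB) ^ (p - 1) * (A * b ^ p) := by
    calc F ^ (p - 1) * wB = (F / vB) ^ (p - 1) * (wB * vB ^ (p - 1)) := by
          nth_rewrite 1 [hF']
          rw [ENNReal.mul_rpow_of_nonneg _ _ hp1.le]
          ring
      _ ≤ _ := by gcongr
  have hbp0 : b ^ (p - 1) ≠ 0 := by simp [hb0, hbt]
  have hbpt : b ^ (p - 1) ≠ ⊤ := ENNReal.rpow_ne_top_of_nonneg hp1.le hbt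
  have hbp : b ^ p = b * b ^ (p - 1) := by
    nth_rewrite 2 [← ENNReal.rpow_one b]
    rw [← ENNReal.rpow_add _ _ hb0 hbt]
    congr 1
    ring
  rw [hbp] at hkey
  have hsplit : A * ((F / vB) ^ (p - 1) * b / wB) * b ^ (p - 1) =
      (F / vB) ^ (p - 1) * (A * (b * b ^ (p - 1))) / wB := by
    rw [div_eq_mul_inv, div_eq_mul_inv _ wB]
    ring
  rw [ENNReal.div_rpow_of_nonneg _ _ hp1.le, ENNReal.div_le_iff hbp0 hbpt, hsplit,
    ENNReal.le_div_iff_mul_le (Or.inl hw0) (Or.inl hwt)]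
  exact hkey

/-- Muckenhoupt's theorem: the Hardy–Littlewood maximal operator is bounded on `L^p(W)` for an
`A_p` density `W`. Both maximal operators in Lerner's inequality are taken with respect to doubling
measures, and `(p - 1) p' = p` matches the exponents. -/
theorem IsApDensity.lintegral_maxOp_rpow_le (hp : 1 < p) (hA : A ≠ ⊤) (h : IsApDensity p A W) :
    ∃ C : ℝ≥0∞, C ≠ ⊤ ∧ ∀ f : Rn n → ℝ≥0∞, Measurable f →
      ∫⁻ x, maxOp volume f x ^ p ∂(volume.withDensity W) ≤
        C * ∫⁻ x, f x ^ p ∂(volume.withDensity W) := by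
  have hp0 : 0 < p := by linarith
  have hp1 : 0 < p - 1 := by linarith
  set p' : ℝ := (p - 1)⁻¹ + 1 with hp'
  have hp'1 : 1 < p' := by
    rw [hp']
    linarith [inv_pos.2 hp1]
  have hpp' : (p - 1) * p' = p := by
    rw [hp', mul_add, mul_inv_cancel₀ hp1.ne']
    ring
  set V : Rn n → ℝ≥0∞ := fun y => W y ^ (-(p - 1)⁻¹) with hV
  have hdual : IsApDensity p' (A ^ (p - 1)⁻¹) V := h.dual hp hA
  have hA' : A ^ (p - 1)⁻¹ ≠ ⊤ := ENNReal.rpow_ne_top_of_nonneg (by positivity) hA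
  obtain ⟨C₁, hC₁, h₁⟩ := (h.isBallDoubling hp).lintegral_maxOp_rpow_le
    (doublingConst_ne_top hp hA) hp'1
  obtain ⟨C₂, hC₂, h₂⟩ := (hdual.isBallDoubling hp'1).lintegral_maxOp_rpow_le
    (doublingConst_ne_top hp'1 hA') hp
  refine ⟨A ^ p' * C₁ * C₂, ENNReal.mul_ne_top (ENNReal.mul_ne_top
    (ENNReal.rpow_ne_top_of_nonneg (by linarith) hA) hC₁) hC₂, fun f hf => ?_⟩
  set g : Rn n → ℝ≥0∞ := maxOp (volume.withDensity V) fun y => f y / V y with hg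
  have hgm : Measurable g := measurable_maxOp _ _
  set H := maxOp (volume.withDensity W) fun y => g y ^ (p - 1) / W y with hH
  have hHm : Measurable H := measurable_maxOp _ _
  have hVm : Measurable V := hdual.measurable
  have hfVm : Measurable fun y => f y / V y := hf.div hVm
  have hgWm : Measurable fun y => g y ^ (p - 1) / W y := (hgm.pow_const _).div h.measurable
  have hVW : ∀ y, (W y ^ p')⁻¹ * W y = V y := by
    intro y
    rw [← ENNReal.rpow_neg]
    nth_rewrite 2 [← ENNReal.rpow_one (W y)]
    rw [← ENNReal.rpow_add _ _ (h.ne_zero y) (h.ne_top y), hV, hp']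
    congr 1
    ring
  have hWV : ∀ y, (V y ^ p)⁻¹ * V y = W y := by
    intro y
    rw [← ENNReal.rpow_neg]
    nth_rewrite 2 [← ENNReal.rpow_one (V y)]
    rw [← ENNReal.rpow_add _ _ (hdual.ne_zero y) (hdual.ne_top y), hV, ← ENNReal.rpow_mul]
    have : -(p - 1)⁻¹ * (-p + 1) = 1 := by
      field_simp
      ring
    rw [this, ENNReal.rpow_one]
  calc ∫⁻ x, maxOp volume f x ^ p ∂(volume.withDensity W)
      ≤ ∫⁻ x, A ^ p' * H x ^ p' ∂(volume.withDensity W) := by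
        refine lintegral_mono fun x => ?_
        have h3 := ENNReal.rpow_le_rpow (h.maxOp_rpow_le hp hA hf x) (by linarith : 0 ≤ p')
        rw [← ENNReal.rpow_mul, hpp'] at h3
        exact h3.trans_eq (ENNReal.mul_rpow_of_nonneg _ _ (by linarith))
    _ = A ^ p' * ∫⁻ x, H x ^ p' ∂(volume.withDensity W) :=
        lintegral_const_mul _ (hHm.pow_const _)
    _ ≤ A ^ p' * (C₁ * ∫⁻ x, (g x ^ (p - 1) / W x) ^ p' ∂(volume.withDensity W)) := by
        gcongr
        exact h₁ _ hgWm
    _ = A ^ p' * (C₁ * ∫⁻ x, g x ^ p ∂(volume.withDensity V)) := by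
        congr 2
        rw [lintegral_withDensity_eq_lintegral_mul _ h.measurable
            (hgWm.pow_const p'),
          lintegral_withDensity_eq_lintegral_mul _ hVm (hgm.pow_const _)]
        refine lintegral_congr fun y => ?_
        simp only [Pi.mul_apply]
        rw [ENNReal.div_rpow_of_nonneg _ _ (by linarith : 0 ≤ p'), ← ENNReal.rpow_mul, hpp',
          div_eq_mul_inv, ← hVW y]
        ring
    _ ≤ A ^ p' * (C₁ * (C₂ * ∫⁻ x, (f x / V x) ^ p ∂(volume.withDensity V))) := by
        gcongr
        exact h₂ _ hfVm
    _ = A ^ p' * (C₁ * (C₂ * ∫⁻ x, f x ^ p ∂(volume.withDensity W))) := by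
        congr 3
        rw [lintegral_withDensity_eq_lintegral_mul _ hVm (hfVm.pow_const p),
          lintegral_withDensity_eq_lintegral_mul _ h.measurable (hf.pow_const _)]
        refine lintegral_congr fun y => ?_
        simp only [Pi.mul_apply]
        rw [ENNReal.div_rpow_of_nonneg _ _ hp0.le, div_eq_mul_inv, ← hWV y]
        ring
    _ = _ := by ring

end Muckenhoupt

/-! ### Maximal functions in weighted spaces -/


section Weights

variable {n : ℕ} {p : ℝ} {w : Rn n → ℝ}

/-- An `A_p` weight agrees almost everywhere with a density with values in `(0, ∞)`. -/
lemma IsApWeight.exists_isApDensity (hp : 1 < p) (h : IsApWeight p w) :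
    ∃ A : ℝ≥0∞, A ≠ ⊤ ∧ ∃ W : Rn n → ℝ≥0∞, IsApDensity p A W ∧
      (fun x => ENNReal.ofReal (w x)) =ᵐ[volume] W := by
  have hp1 : 0 < p - 1 := by linarith
  obtain ⟨C, hC⟩ := h.bound
  have hwm : AEStronglyMeasurable w volume := h.locallyIntegrable.aestronglyMeasurable
  have hm0 : Measurable (hwm.mk w) := hwm.stronglyMeasurable_mk.measurable
  set v : Rn n → ℝ := fun x => if 0 < hwm.mk w x then hwm.mk w x else 1 with hv
  have hvm : Measurable v := Measurable.ite (measurableSet_lt measurable_const hm0) hm0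
    measurable_const
  have hv0 : ∀ x, 0 < v x := by
    intro x
    simp only [hv]
    split_ifs with hx
    · exact hx
    · exact one_pos
  have hwv : w =ᵐ[volume] v := by
    filter_upwards [hwm.ae_eq_mk, h.pos] with x hx hx0
    simp only [hv]
    rw [if_pos (hx ▸ hx0), hx]
  have hW : (fun x => ENNReal.ofReal (w x)) =ᵐ[volume] fun x => ENNReal.ofReal (v x) := by
    filter_upwards [hwv] with x hx
    rw [hx]
  have hW' : (fun x => ENNReal.ofReal (w x ^ (-1 / (p - 1)))) =ᵐ[volume]
      fun x => ENNReal.ofReal (v x) ^ (-(p - 1)⁻¹) := by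
    filter_upwards [hwv] with x hx
    rw [hx, ENNReal.ofReal_rpow_of_pos (hv0 x), neg_div, one_div]
  refine ⟨C, ENNReal.coe_ne_top, fun x => ENNReal.ofReal (v x), ⟨hvm.ennreal_ofReal, fun x => ?_,
    fun x => ENNReal.ofReal_ne_top, fun c s => ?_, fun c s hs => ?_⟩, hW⟩
  · simpa using hv0 x
  · rw [← lintegral_congr_ae (ae_restrict_of_ae hW)]
    have h1 : IntegrableOn w (Metric.ball c s) volume :=
      (h.locallyIntegrable.integrableOn_isCompact (isCompact_closedBall c s)).mono_set
        Metric.ball_subset_closedBall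
    exact h1.lintegral_lt_top.ne
  · have h1 := hC c s hs
    unfold ballAvg at h1
    rw [lintegral_congr_ae (ae_restrict_of_ae hW), lintegral_congr_ae (ae_restrict_of_ae hW')] at h1
    set b := volume (Metric.ball c s) with hb
    have hb0 : b ≠ 0 := volume_ball_ne_zero c hs
    have hbt : b ≠ ⊤ := volume_ball_ne_top c s
    set X := ∫⁻ y in Metric.ball c s, ENNReal.ofReal (v y)
    set Y := ∫⁻ y in Metric.ball c s, ENNReal.ofReal (v y) ^ (-(p - 1)⁻¹)
    have hbp : b ^ p = b * b ^ (p - 1) := by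
      nth_rewrite 2 [← ENNReal.rpow_one b]
      rw [← ENNReal.rpow_add _ _ hb0 hbt]
      congr 1
      ring
    calc X * Y ^ (p - 1) = (X / b * b) * (Y / b * b) ^ (p - 1) := by
          rw [ENNReal.div_mul_cancel hb0 hbt, ENNReal.div_mul_cancel hb0 hbt]
      _ = (X / b * (Y / b) ^ (p - 1)) * (b * b ^ (p - 1)) := by
          rw [ENNReal.mul_rpow_of_nonneg _ _ hp1.le]
          ring
      _ ≤ C * b ^ p := by
          rw [hbp]
          gcongr

lemma IsApWeight.aemeasurable (h : IsApWeight p w) : AEMeasurable w :=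
  h.locallyIntegrable.aestronglyMeasurable.aemeasurable

lemma weightMeasure_one : weightMeasure (fun _ : Rn n => 1) = volume := by
  unfold weightMeasure
  simp

lemma weightMeasure_absolutelyContinuous (w : Rn n → ℝ) : weightMeasure w ≪ volume :=
  withDensity_absolutelyContinuous _ _

lemma absolutelyContinuous_weightMeasure (hw : AEMeasurable w) (h : ∀ᵐ x, 0 < w x) :
    volume ≪ weightMeasure w :=
  withDensity_absolutelyContinuous' hw.ennreal_ofReal (by
    filter_upwards [h] with x hx
    simpa using hx)

end Weights

section MaximalFunction

variable {n : ℕ} {p : ℝ}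

lemma maximalFn_eq (hp : 0 < p) (u : Rn n → ℂ) (x : Rn n) :
    maximalFn p u x = maxOp volume (fun y => ‖u y‖ₑ ^ p) x ^ (1 / p) := by
  have h : ∀ y : ℝ≥0∞, y ^ (1 / p) = ENNReal.orderIsoRpow (1 / p) (by positivity) y :=
    fun y => rfl
  unfold maximalFn maxOp
  simp only [h, OrderIso.map_iSup]

lemma measurable_maximalFn (hp : 0 < p) (u : Rn n → ℂ) : Measurable (maximalFn p u) := by
  have : maximalFn p u = fun x => maxOp volume (fun y => ‖u y‖ₑ ^ p) x ^ (1 / p) :=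
    funext (maximalFn_eq hp u)
  rw [this]
  exact (measurable_maxOp _ _).pow_const _

lemma maximalFn_congr_ae {u v : Rn n → ℂ} (h : u =ᵐ[volume] v) : maximalFn p u = maximalFn p v := by
  funext x
  unfold maximalFn
  congr! 7 with c s hx
  refine lintegral_congr_ae (ae_restrict_of_ae ?_)
  filter_upwards [h] with y hy
  rw [hy]

lemma maximalFn_zero (hp : 0 < p) (x : Rn n) : maximalFn p (0 : Rn n → ℂ) x = 0 := by
  simp [maximalFn, hp]

lemma maximalFn_neg (u : Rn n → ℂ) : maximalFn p (-u) = maximalFn p u := by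
  funext x
  simp [maximalFn]

/-- Minkowski's inequality for the averages makes the maximal function subadditive. -/
lemma maximalFn_add_le (hp : 1 ≤ p) {u v : Rn n → ℂ} (hu : AEStronglyMeasurable u)
    (hv : AEStronglyMeasurable v) (x : Rn n) :
    maximalFn p (u + v) x ≤ maximalFn p u x + maximalFn p v x := by
  have hp0 : 0 < p := by linarith
  refine iSup_le fun c => iSup_le fun s => iSup_le fun hx => ?_
  have h1 : ∀ f : Rn n → ℂ, ((∫⁻ y in Metric.ball c s, ‖f y‖ₑ ^ p) /
      volume (Metric.ball c s)) ^ (1 / p) =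
      (∫⁻ y in Metric.ball c s, ‖f y‖ₑ ^ p) ^ (1 / p) / volume (Metric.ball c s) ^ (1 / p) :=
    fun f => ENNReal.div_rpow_of_nonneg _ _ (by positivity)
  have h2 : ∀ f : Rn n → ℂ, (∫⁻ y in Metric.ball c s, ‖f y‖ₑ ^ p) ^ (1 / p) /
      volume (Metric.ball c s) ^ (1 / p) ≤ maximalFn p f x := fun f => by
    rw [← h1]
    exact le_iSup_of_le c (le_iSup_of_le s (le_iSup_of_le hx le_rfl))
  rw [h1]
  refine le_trans ?_ (add_le_add (h2 u) (h2 v))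
  rw [← ENNReal.add_div]
  gcongr
  refine le_trans ?_ (ENNReal.lintegral_Lp_add_le (hu.restrict.enorm) (hv.restrict.enorm) hp)
  gcongr with y
  exact enorm_add_le _ _

lemma maximalFn_const_smul (hp : 0 < p) (c : ℂ) (u : Rn n → ℂ) (x : Rn n) :
    maximalFn p (c • u) x = ‖c‖ₑ * maximalFn p u x := by
  unfold maximalFn
  simp only [ENNReal.mul_iSup]
  congr! 6 with b s hx
  have h : ∀ y, ‖(c • u) y‖ₑ ^ p = ‖c‖ₑ ^ p * ‖u y‖ₑ ^ p := fun y => by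
    rw [Pi.smul_apply, enorm_smul, ENNReal.mul_rpow_of_nonneg _ _ hp.le]
  simp_rw [h]
  rw [lintegral_const_mul' _ _ (ENNReal.rpow_ne_top_of_nonneg hp.le enorm_ne_top), mul_div_assoc,
    ENNReal.mul_rpow_of_nonneg _ _ (by positivity), ← ENNReal.rpow_mul, mul_one_div_cancel hp.ne',
    ENNReal.rpow_one]

lemma maximalFn_le_eLpNorm_top (hp : 0 < p) (u : Rn n → ℂ) (x : Rn n) :
    maximalFn p u x ≤ eLpNorm u ⊤ volume := by
  refine iSup_le fun c => iSup_le fun s => iSup_le fun hx => ?_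
  have hs : 0 < s := Metric.pos_of_mem_ball hx
  have h : (∫⁻ y in Metric.ball c s, ‖u y‖ₑ ^ p) ≤
      eLpNorm u ⊤ volume ^ p * volume (Metric.ball c s) := by
    rw [← setLIntegral_const]
    refine lintegral_mono_ae (ae_restrict_of_ae ?_)
    filter_upwards [ae_le_eLpNormEssSup (f := u) (μ := volume)] with y hy
    rw [eLpNorm_exponent_top]
    exact ENNReal.rpow_le_rpow hy hp.le
  rw [one_div, ENNReal.rpow_inv_le_iff hp]
  exact ENNReal.div_le_of_le_mul h

/-- The maximal function `M_p` is bounded on `L^q(w)` for `q > p` and `w ∈ A_{q/p}`. -/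
lemma exists_eLpNorm_maximalFn_le (hp : 1 ≤ p) {q : ℝ≥0∞} (hq : ENNReal.ofReal p < q)
    {w : Rn n → ℝ} (hw : q ≠ ⊤ → IsApWeight (q.toReal / p) w) (hw' : q = ⊤ → w = fun _ => 1) :
    ∃ C : ℝ≥0, ∀ u : Rn n → ℂ, AEStronglyMeasurable u →
      eLpNorm (maximalFn p u) q (weightMeasure w) ≤ C * eLpNorm u q (weightMeasure w) := by
  have hp0 : 0 < p := by linarith
  by_cases hqt : q = ⊤
  · refine ⟨1, fun u _ => ?_⟩
    rw [hqt, hw' hqt, weightMeasure_one, ENNReal.coe_one, one_mul]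
    refine eLpNormEssSup_le_of_ae_enorm_bound (Eventually.of_forall fun x => ?_)
    exact maximalFn_le_eLpNorm_top hp0 u x
  · have hq0 : q ≠ 0 := (bot_le.trans_lt hq).ne'
    have hqp : p < q.toReal := (ENNReal.ofReal_lt_iff_lt_toReal hp0.le hqt).1 hq
    have hqr : 0 < q.toReal := hp0.trans hqp
    have hs : 1 < q.toReal / p := (one_lt_div hp0).2 hqp
    obtain ⟨A, hA, W, hW, hwW⟩ := (hw hqt).exists_isApDensity hs
    obtain ⟨C, hC, hCf⟩ := hW.lintegral_maxOp_rpow_le hs hA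
    have hμ : weightMeasure w = volume.withDensity W := withDensity_congr_ae hwW
    refine ⟨(C ^ (1 / q.toReal)).toNNReal, fun u hu => ?_⟩
    rw [ENNReal.coe_toNNReal (ENNReal.rpow_ne_top_of_nonneg (by positivity) hC)]
    -- replace `u` by a measurable representative
    have hum := hu.stronglyMeasurable_mk.measurable
    rw [maximalFn_congr_ae hu.ae_eq_mk, eLpNorm_congr_ae
      ((weightMeasure_absolutelyContinuous w).ae_eq hu.ae_eq_mk)]
    set v := hu.mk u
    rw [eLpNorm_eq_lintegral_rpow_enorm_toReal hq0 hqt,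
      eLpNorm_eq_lintegral_rpow_enorm_toReal hq0 hqt, ← ENNReal.mul_rpow_of_nonneg _ _ (by positivity)]
    refine ENNReal.rpow_le_rpow ?_ (by positivity)
    have h1 := hCf (fun y => ‖v y‖ₑ ^ p) (hum.enorm.pow_const p)
    rw [hμ]
    refine le_trans (le_of_eq ?_) (h1.trans (le_of_eq ?_))
    · refine lintegral_congr fun x => ?_
      rw [maximalFn_eq hp0, enorm_eq_self, ← ENNReal.rpow_mul]
      congr 1
      ring
    · congr 1
      refine lintegral_congr fun x => ?_
      rw [← ENNReal.rpow_mul]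
      congr 1
      field_simp

/-- Schwartz functions are dominated by the maximal function of the indicator function of the unit
ball. -/
lemma exists_enorm_le_maximalFn_indicator (hp : 1 ≤ p) (φ : 𝓢(Rn n, ℂ)) :
    ∃ C : ℝ≥0, ∀ x, ‖φ x‖ₑ ≤
      C * maximalFn p ((Metric.ball (0 : Rn n) 1).indicator fun _ => (1 : ℂ)) x := by
  have hp0 : 0 < p := by linarith
  obtain ⟨C, hC⟩ : ∃ C : ℝ, ∀ x, (1 + ‖x‖) ^ n * ‖φ x‖ ≤ C := by
    have h := fun x => SchwartzMap.one_add_le_sup_seminorm_apply (𝕜 := ℝ) (m := (n, 0))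
      le_rfl le_rfl φ x
    simp only [norm_iteratedFDeriv_zero] at h
    exact ⟨_, h⟩
  refine ⟨C.toNNReal, fun x => ?_⟩
  have hx1 : 0 < 1 + ‖x‖ := by positivity
  set b := volume (Metric.ball (0 : Rn n) 1) with hb
  have hb0 : b ≠ 0 := volume_ball_ne_zero 0 one_pos
  have hbt : b ≠ ⊤ := volume_ball_ne_top 0 1
  have hmem : x ∈ Metric.ball (0 : Rn n) (1 + ‖x‖) := by
    rw [mem_ball_zero_iff]
    linarith
  have hM : ENNReal.ofReal ((1 + ‖x‖) ^ n)⁻¹ ≤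
      maximalFn p ((Metric.ball (0 : Rn n) 1).indicator fun _ => (1 : ℂ)) x := by
    refine le_trans ?_ (le_iSup_of_le 0 (le_iSup_of_le (1 + ‖x‖) (le_iSup_of_le hmem le_rfl)))
    have h1 : ∫⁻ y in Metric.ball (0 : Rn n) (1 + ‖x‖),
        ‖(Metric.ball (0 : Rn n) 1).indicator (fun _ => (1 : ℂ)) y‖ₑ ^ p = b := by
      have : ∀ y : Rn n, ‖(Metric.ball (0 : Rn n) 1).indicator (fun _ => (1 : ℂ)) y‖ₑ ^ p =
          (Metric.ball (0 : Rn n) 1).indicator 1 y := by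
        intro y
        by_cases hy : y ∈ Metric.ball (0 : Rn n) 1
        · simp [Set.indicator_of_mem hy]
        · simp [Set.indicator_of_notMem hy, hp0]
      simp_rw [this]
      rw [lintegral_indicator_one measurableSet_ball,
        Measure.restrict_apply measurableSet_ball, Set.inter_eq_left.2]
      exact Metric.ball_subset_ball (by linarith [norm_nonneg x])
    have h2 : volume (Metric.ball (0 : Rn n) (1 + ‖x‖)) = ENNReal.ofReal ((1 + ‖x‖) ^ n) * b := by
      have := Measure.addHaar_ball_of_pos volume (0 : Rn n) hx1
      rwa [finrank_euclideanSpace_fin] at this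
    have h3 : b / (ENNReal.ofReal ((1 + ‖x‖) ^ n) * b) = ENNReal.ofReal ((1 + ‖x‖) ^ n)⁻¹ := by
      rw [mul_comm, ENNReal.div_eq_inv_mul, ENNReal.mul_inv (Or.inl hb0) (Or.inl hbt), mul_right_comm,
        ENNReal.inv_mul_cancel hb0 hbt, one_mul, ENNReal.ofReal_inv_of_pos (by positivity)]
    rw [h1, h2, h3]
    -- the number is at most `1`, and `1 / p ≤ 1`
    nth_rewrite 1 [← ENNReal.rpow_one (ENNReal.ofReal ((1 + ‖x‖) ^ n)⁻¹)]
    refine ENNReal.rpow_le_rpow_of_exponent_ge ?_ ((div_le_one hp0).2 hp)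
    rw [ENNReal.ofReal_le_one]
    exact inv_le_one_of_one_le₀ (one_le_pow₀ (by linarith [norm_nonneg x]))
  refine le_trans ?_ (mul_le_mul_right hM _)
  rw [← ENNReal.ofReal, ← ENNReal.ofReal_mul' (by positivity), ← ofReal_norm]
  refine ENNReal.ofReal_le_ofReal ?_
  rw [← div_eq_mul_inv, le_div_iff₀ (by positivity), mul_comm]
  exact hC x

lemma memLp_schwartz (hp : 1 ≤ p) {q : ℝ≥0∞} (hq : ENNReal.ofReal p < q)
    {w : Rn n → ℝ} (hw : q ≠ ⊤ → IsApWeight (q.toReal / p) w) (hw' : q = ⊤ → w = fun _ => 1)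
    (φ : 𝓢(Rn n, ℂ)) : MemLp φ q (weightMeasure w) := by
  by_cases hqt : q = ⊤
  · rw [hqt, hw' hqt, weightMeasure_one]
    exact φ.memLp _ _
  · have hq0 : q ≠ 0 := (bot_le.trans_lt hq).ne'
    refine ⟨φ.continuous.aestronglyMeasurable, ?_⟩
    obtain ⟨C, hC⟩ := exists_eLpNorm_maximalFn_le hp hq hw hw'
    obtain ⟨C', hC'⟩ := exists_enorm_le_maximalFn_indicator hp φ
    set g : Rn n → ℂ := (Metric.ball (0 : Rn n) 1).indicator fun _ => (1 : ℂ) with hg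
    have hgm : AEStronglyMeasurable g :=
      (stronglyMeasurable_const.indicator measurableSet_ball).aestronglyMeasurable
    have hball : weightMeasure w (Metric.ball 0 1) ≠ ⊤ := by
      rw [weightMeasure, withDensity_apply _ measurableSet_ball]
      have h1 : IntegrableOn w (Metric.ball 0 1) volume :=
        ((hw hqt).locallyIntegrable.integrableOn_isCompact (isCompact_closedBall 0 1)).mono_set
          Metric.ball_subset_closedBall
      exact h1.lintegral_lt_top.ne
    have hgL : eLpNorm g q (weightMeasure w) < ⊤ :=
      (memLp_indicator_const q measurableSet_ball (1 : ℂ) (Or.inr hball)).2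
    calc eLpNorm φ q (weightMeasure w)
        ≤ C' * eLpNorm (maximalFn p g) q (weightMeasure w) :=
          eLpNorm_le_nnreal_smul_eLpNorm_of_ae_le_mul' (Eventually.of_forall hC') q
      _ ≤ C' * (C * eLpNorm g q (weightMeasure w)) := by
          gcongr
          exact hC g hgm
      _ < ⊤ := ENNReal.mul_lt_top ENNReal.coe_lt_top (ENNReal.mul_lt_top ENNReal.coe_lt_top hgL)

end MaximalFunction

/-! ### Measurability and multilinearity of the operator -/


section Operator

open SchwartzMap

variable {n N : ℕ} {a : Rn n → (Fin N → Rn n) → ℂ}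

lemma multiDeriv_zero (f : (Fin N → Rn n) → ℂ) : multiDeriv 0 f = f := by
  unfold multiDeriv
  simp only [Pi.zero_apply, Function.iterate_zero, id_eq]
  exact List.foldr_fixed' (fun _ => rfl) _

/-- A symbol of nonpositive order is bounded in `Ξ`, for almost every `x`. -/
lemma IsSymbol.ae_bounded {m ρ : ℝ} (hm : m ≤ 0) (ha : IsSymbol m ρ a) :
    ∃ C : ℝ, ∀ᵐ x, ∀ Ξ, ‖a x Ξ‖ ≤ C := by
  obtain ⟨C, hC⟩ := ha.bound 0
  refine ⟨C, ?_⟩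
  filter_upwards [ae_forall_symbolBoundAt ha.contDiff hC] with x hx Ξ
  have h1 := hx Ξ
  simp only [SymbolBoundAt, multiDeriv_zero, order, Pi.zero_apply, Finset.sum_const_zero,
    Nat.cast_zero, mul_zero, sub_zero] at h1
  have hb : bracket Ξ ^ m ≤ 1 := Real.rpow_le_one_of_one_le_of_nonpos (one_le_bracket Ξ) hm
  have hb0 : 0 < bracket Ξ ^ m := Real.rpow_pos_of_pos (by linarith [one_le_bracket Ξ]) _
  have hC0 : 0 ≤ C := by
    by_contra! hc
    nlinarith [norm_nonneg (a x Ξ)]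
  nlinarith

lemma integrable_symbol_mul_tensor {b : (Fin N → Rn n) → ℂ} (hb : Continuous b) {C : ℝ}
    (hC : ∀ Ξ, ‖b Ξ‖ ≤ C) (φ : Fin N → 𝓢(Rn n, ℂ)) : Integrable fun Ξ => b Ξ * tensor φ Ξ :=
  (integrable_tensor φ).bdd_mul hb.aestronglyMeasurable (Eventually.of_forall hC)

/-- The operator is multilinear at each point `x` at which the symbol is continuous and bounded. -/
lemma exists_multilinearMap_eq_psdo {x : Rn n} (hb : Continuous (a x)) {C : ℝ}
    (hC : ∀ Ξ, ‖a x Ξ‖ ≤ C) :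
    ∃ L : MultilinearMap ℂ (fun _ : Fin N => 𝓢(Rn n, ℂ)) ℂ, ∀ u, L u = psdo a u x := by
  set g : 𝓢(Rn n, ℂ) → 𝓢(Rn n, ℂ) := fun v => fourierS (v.compSubConstCLM ℂ (-x)) with hg
  have hup : ∀ (u : Fin N → 𝓢(Rn n, ℂ)) i v,
      (fun j => g (Function.update u i v j)) = Function.update (fun j => g (u j)) i (g v) := by
    intro u i v
    funext j
    exact Function.apply_update (fun _ => g) u i v j
  have hI : ∀ φ : Fin N → 𝓢(Rn n, ℂ), Integrable fun Ξ => a x Ξ * tensor φ Ξ :=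
    integrable_symbol_mul_tensor hb hC
  refine ⟨⟨fun u => ∫ Ξ, a x Ξ * tensor (fun j => g (u j)) Ξ, ?_, ?_⟩, fun u => (psdo_eq a u x).symm⟩
  · intro hd u i v v'
    have hd' : hd = instDecidableEqFin N := Subsingleton.elim _ _
    subst hd'
    simp only [hup]
    rw [← integral_add (hI _) (hI _)]
    refine integral_congr_ae (Eventually.of_forall fun Ξ => ?_)
    simp only [tensor_update, hg, map_add, fourierS_add, _root_.add_apply]
    ring
  · intro hd u i c v
    have hd' : hd = instDecidableEqFin N := Subsingleton.elim _ _
    subst hd'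
    simp only [hup]
    rw [smul_eq_mul, ← integral_const_mul]
    refine integral_congr_ae (Eventually.of_forall fun Ξ => ?_)
    simp only [tensor_update, hg, map_smul, fourierS_smul, _root_.smul_apply, smul_eq_mul]
    ring

/-- A function measurable in `x` and, for almost every `x`, continuous in `Ξ` agrees for almost every
`x` with a jointly measurable function: the exceptional sets of countably many `Ξ` are removed. -/
lemma exists_stronglyMeasurable_uncurry (hm : ∀ Ξ, AEStronglyMeasurable (fun x => a x Ξ) volume)
    (hc : ∀ᵐ x, Continuous (a x)) :
    ∃ b : Rn n → (Fin N → Rn n) → ℂ, StronglyMeasurable (Function.uncurry b) ∧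
      ∀ᵐ x, a x = b x := by
  set d := TopologicalSpace.denseSeq (Fin N → Rn n) with hd
  have hG : ∀ᵐ x, Continuous (a x) ∧ ∀ i, a x (d i) = (hm (d i)).mk _ x :=
    hc.and (ae_all_iff.2 fun i => (hm (d i)).ae_eq_mk)
  obtain ⟨G, hGs, hGm, hGae⟩ : ∃ G ⊆ {x | Continuous (a x) ∧ ∀ i, a x (d i) = (hm (d i)).mk _ x},
      MeasurableSet G ∧ G ∈ ae volume := by
    obtain ⟨t, ht1, ht2, ht3⟩ := exists_measurable_superset_of_null (ae_iff.1 hG)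
    refine ⟨tᶜ, ?_, ht2.compl, compl_mem_ae_iff.2 ht3⟩
    intro x hx
    by_contra hc
    exact hx (ht1 hc)
  classical
  set b : Rn n → (Fin N → Rn n) → ℂ := fun x Ξ => if x ∈ G then a x Ξ else 0 with hb
  have hbc : ∀ x, Continuous (b x) := by
    intro x
    by_cases hx : x ∈ G
    · simpa only [hb, if_pos hx] using (hGs hx).1
    · simpa only [hb, if_neg hx] using continuous_const
  have hbd : ∀ i, StronglyMeasurable fun x => b x (d i) := by
    intro i
    have : (fun x => b x (d i)) = G.indicator ((hm (d i)).mk _) := by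
      funext x
      by_cases hx : x ∈ G
      · simp only [hb, if_pos hx, Set.indicator_of_mem hx, (hGs hx).2 i]
      · simp only [hb, if_neg hx, Set.indicator_of_notMem hx]
    rw [this]
    exact (hm (d i)).stronglyMeasurable_mk.indicator hGm
  have hbm : ∀ Ξ, StronglyMeasurable fun x => b x Ξ := by
    intro Ξ
    have hcl : Ξ ∈ closure (Set.range d) := (TopologicalSpace.denseRange_denseSeq _) Ξ
    obtain ⟨s, hs, hlim⟩ := mem_closure_iff_seq_limit.1 hcl
    choose i hi using hs
    refine stronglyMeasurable_of_tendsto atTop (f := fun k x => b x (s k)) (fun k => ?_) ?_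
    · simp_rw [← hi k]
      exact hbd (i k)
    · exact tendsto_pi_nhds.2 fun x => ((hbc x).tendsto Ξ).comp hlim
  refine ⟨b, ?_, ?_⟩
  · exact (stronglyMeasurable_uncurry_of_continuous_of_stronglyMeasurable (u := fun Ξ x => b x Ξ)
      hbc hbm).comp_measurable measurable_swap
  · filter_upwards [hGae] with x hx
    simp only [hb, if_pos hx]

lemma continuous_fourierT (u : 𝓢(Rn n, ℂ)) : Continuous (fourierT u) := by
  have : fourierT u = fourierS u := funext fun ξ => (fourierS_apply u ξ).symm
  rw [this]
  exact (fourierS u).continuous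

lemma aestronglyMeasurable_psdo (hm : ∀ Ξ, AEStronglyMeasurable (fun x => a x Ξ) volume)
    (hc : ∀ᵐ x, Continuous (a x)) (u : Fin N → 𝓢(Rn n, ℂ)) :
    AEStronglyMeasurable (psdo a u) volume := by
  obtain ⟨b, hb, hab⟩ := exists_stronglyMeasurable_uncurry hm hc
  have h1 : StronglyMeasurable (psdo b u) := by
    unfold psdo
    refine StronglyMeasurable.integral_prod_right' (f := fun z : Rn n × (Fin N → Rn n) =>
      b z.1 z.2 * ∏ j, (fourierT (u j) (z.2 j) *
        Complex.exp (Complex.I * (inner ℝ z.1 (z.2 j) : ℝ)))) ?_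
    refine hb.mul (Continuous.stronglyMeasurable ?_)
    refine continuous_finsetProd _ fun j _ => ?_
    have := continuous_fourierT (u j)
    fun_prop
  refine ⟨psdo b u, h1, ?_⟩
  filter_upwards [hab] with x hx
  simp only [psdo, hx]

end Operator

section Telescoping

/-- A bounded multilinear map takes tuples at small distance to values at small distance, in terms
of arbitrary gauges `s j` and along a filter. -/
lemma tendsto_enorm_multilinearMap_sub {ι κ V : Type*} [Fintype ι] [AddCommGroup V]
    [Module ℂ V] {L : MultilinearMap ℂ (fun _ : ι => V) ℂ} {s : ι → V → ℝ≥0∞} {C : ℝ≥0}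
    (hL : ∀ u, ‖L u‖ₑ ≤ C * ∏ j, s j (u j)) {l : Filter κ} {φ ψ : κ → ι → V} {B : ι → ℝ≥0∞}
    (hB : ∀ j, B j ≠ ⊤) (hφ : ∀ j, ∀ᶠ k in l, s j (φ k j) ≤ B j)
    (hψ : ∀ j, ∀ᶠ k in l, s j (ψ k j) ≤ B j)
    (hlim : ∀ j, Tendsto (fun k => s j (φ k j - ψ k j)) l (𝓝 0)) :
    Tendsto (fun k => ‖L (φ k) - L (ψ k)‖ₑ) l (𝓝 0) := by
  classical
  -- the slots are exchanged one after the other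
  have key : ∀ t : Finset ι,
      Tendsto (fun k => ‖L (φ k) - L (t.piecewise (ψ k) (φ k))‖ₑ) l (𝓝 0) := by
    intro t
    induction t using Finset.induction with
    | empty => simpa using tendsto_const_nhds
    | insert i t hi ih =>
      have hstep : Tendsto (fun k => (C : ℝ≥0∞) * ((∏ j ∈ Finset.univ.erase i, B j) *
          s i (φ k i - ψ k i))) l (𝓝 0) := by
        have h1 : (∏ j ∈ Finset.univ.erase i, B j) ≠ ⊤ := ENNReal.prod_ne_top fun j _ => hB j
        have h2 := ENNReal.Tendsto.const_mul (a := (C : ℝ≥0∞))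
          (ENNReal.Tendsto.const_mul (hlim i) (Or.inr h1)) (Or.inr ENNReal.coe_ne_top)
        simpa using h2
      have hsum := ih.add hstep
      rw [add_zero] at hsum
      refine tendsto_of_tendsto_of_tendsto_of_le_of_le' tendsto_const_nhds hsum
        (Eventually.of_forall fun _ => zero_le) ?_
      filter_upwards [eventually_all.2 hφ, eventually_all.2 hψ] with k h1 h2
      have e1 : L (t.piecewise (ψ k) (φ k)) - L ((insert i t).piecewise (ψ k) (φ k)) =
          L (Function.update (t.piecewise (ψ k) (φ k)) i (φ k i - ψ k i)) := by
        rw [Finset.piecewise_insert, L.map_update_sub]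
        congr 2
        conv_lhs => rw [← Function.update_eq_self i (t.piecewise (ψ k) (φ k))]
        rw [Finset.piecewise_eq_of_notMem _ _ _ hi]
      have e2 : L (φ k) - L ((insert i t).piecewise (ψ k) (φ k)) =
          (L (φ k) - L (t.piecewise (ψ k) (φ k))) +
            L (Function.update (t.piecewise (ψ k) (φ k)) i (φ k i - ψ k i)) := by
        rw [← e1]
        ring
      rw [e2]
      refine (enorm_add_le _ _).trans ?_
      gcongr
      refine (hL _).trans ?_
      gcongr
      rw [← Finset.prod_erase_mul _ _ (Finset.mem_univ i), Function.update_self]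
      gcongr with j hj
      rw [Function.update_of_ne (Finset.ne_of_mem_erase hj)]
      by_cases hjt : j ∈ t
      · rw [Finset.piecewise_eq_of_mem _ _ _ hjt]
        exact h2 j
      · rw [Finset.piecewise_eq_of_notMem _ _ _ hjt]
        exact h1 j
  simpa using key Finset.univ

end Telescoping

/-! ### Hölder inequality with product weights -/


section Holder

variable {n N : ℕ}

/-- The weight `∏ w_j^{r/q_j}` of the target space; in `ℝ≥0∞` the quotient `r / q_j` is `0` for
`q_j = ∞`, also when `r = ∞`. -/
def productWeight (w : Fin N → Rn n → ℝ) (q : Fin N → ℝ≥0∞) (r : ℝ≥0∞) (x : Rn n) : ℝ :=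
  ∏ j, w j x ^ (r / q j).toReal

lemma aemeasurable_productWeight {w : Fin N → Rn n → ℝ} {q : Fin N → ℝ≥0∞} {r : ℝ≥0∞}
    (hw : ∀ j, AEMeasurable (w j)) : AEMeasurable (productWeight w q r) :=
  Finset.aemeasurable_fun_prod _ fun j _ => (hw j).pow_const _

lemma productWeight_pos {w : Fin N → Rn n → ℝ} {q : Fin N → ℝ≥0∞} {r : ℝ≥0∞}
    (hw : ∀ j, ∀ᵐ x, 0 < w j x) : ∀ᵐ x, 0 < productWeight w q r x := by
  filter_upwards [ae_all_iff.2 hw] with x hx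
  exact Finset.prod_pos fun j _ => Real.rpow_pos_of_pos (hx j) _

/-- Hölder's inequality for products of functions in weighted spaces. For `r < ∞` it is applied with
the exponents `r / q_j`, whose sum is `1`, to the functions `g_j^{q_j} w_j`. -/
lemma eLpNorm_prod_productWeight_le {w : Fin N → Rn n → ℝ} {q : Fin N → ℝ≥0∞} {r : ℝ≥0∞}
    (hw : ∀ j, AEMeasurable (w j)) (hw0 : ∀ j, ∀ᵐ x, 0 < w j x)
    (hw1 : ∀ j, q j = ⊤ → w j = fun _ => 1) (hq : ∀ j, q j ≠ 0) (hr : 0 < r)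
    (hrq : r⁻¹ = ∑ j, (q j)⁻¹) {g : Fin N → Rn n → ℝ≥0∞} (hg : ∀ j, Measurable (g j)) :
    eLpNorm (fun x => ∏ j, g j x) r (weightMeasure (productWeight w q r)) ≤
      ∏ j, eLpNorm (g j) (q j) (weightMeasure (w j)) := by
  classical
  by_cases hrt : r = ⊤
  · have hqt : ∀ j, q j = ⊤ := by
      intro j
      rw [hrt, ENNReal.inv_top] at hrq
      have := (Finset.sum_eq_zero_iff.1 hrq.symm) j (Finset.mem_univ j)
      exact ENNReal.inv_eq_zero.1 this
    have hμ : weightMeasure (productWeight w q r) = volume := by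
      rw [← weightMeasure_one]
      congr 1
      funext x
      simp [productWeight, hqt]
    rw [hμ, hrt]
    simp only [hqt, hw1 _ (hqt _), weightMeasure_one, eLpNorm_exponent_top]
    refine eLpNormEssSup_le_of_ae_enorm_bound ?_
    filter_upwards [ae_all_iff.2 fun j => ae_le_eLpNormEssSup (f := g j) (μ := volume)] with x hx
    rw [enorm_eq_self]
    exact Finset.prod_le_prod' fun j _ => hx j
  · set R := r.toReal with hR
    have hR0 : 0 < R := ENNReal.toReal_pos hr.ne' hrt
    set θ : Fin N → ℝ := fun j => (r / q j).toReal with hθ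
    have hθ0 : ∀ j, 0 ≤ θ j := fun j => ENNReal.toReal_nonneg
    have hθt : ∀ j, q j = ⊤ → θ j = 0 := fun j hj => by simp [hθ, hj]
    have hθq : ∀ j, q j ≠ ⊤ → θ j = R / (q j).toReal := fun j _ => ENNReal.toReal_div _ _
    have hqR : ∀ j, q j ≠ ⊤ → 0 < (q j).toReal := fun j hj => ENNReal.toReal_pos (hq j) hj
    have hθsum : ∑ j, θ j = 1 := by
      rw [hθ, ← ENNReal.toReal_sum fun j _ => ENNReal.div_ne_top hrt (hq j)]
      simp only [div_eq_mul_inv]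
      rw [← Finset.mul_sum, ← hrq, ENNReal.mul_inv_cancel hr.ne' hrt, ENNReal.toReal_one]
    set F : Finset (Fin N) := Finset.univ.filter fun j => q j ≠ ⊤ with hF
    have hθsumF : ∑ j ∈ F, θ j = 1 := by
      rw [← hθsum, hF, Finset.sum_filter]
      refine Finset.sum_congr rfl fun j _ => ?_
      split_ifs with h
      · rfl
      · exact (hθt j (not_not.1 h)).symm
    set h : Fin N → Rn n → ℝ≥0∞ := fun j x =>
      ENNReal.ofReal (w j x) * g j x ^ (q j).toReal with hh
    have hhm : ∀ j, AEMeasurable (h j) := fun j =>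
      (hw j).ennreal_ofReal.mul ((hg j).pow_const _).aemeasurable
    set E : Fin N → ℝ≥0∞ := fun j => eLpNorm (g j) (q j) (weightMeasure (w j))
    have hE : ∀ j, E j = eLpNorm (g j) (q j) (weightMeasure (w j)) := fun _ => rfl
    have hint : ∀ j ∈ F, (∫⁻ x, h j x) ^ θ j = E j ^ R := by
      intro j hj
      have hjt : q j ≠ ⊤ := (Finset.mem_filter.1 hj).2
      rw [hE, eLpNorm_eq_lintegral_rpow_enorm_toReal (hq j) hjt, ← ENNReal.rpow_mul, hθq j hjt,
        weightMeasure, lintegral_withDensity_eq_lintegral_mul₀ (hw j).ennreal_ofReal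
          (((hg j).enorm.pow_const _).aemeasurable)]
      simp only [Pi.mul_apply, enorm_eq_self, hh]
      congr 1
      ring
    -- the pointwise bound, in which the factors with `q j = ∞` are replaced by their suprema
    have hpt : ∀ᵐ x, ENNReal.ofReal (productWeight w q r x) * (∏ j, g j x) ^ R ≤
        (∏ j ∈ Fᶜ, E j ^ R) * ∏ j ∈ F, h j x ^ θ j := by
      have hsup : ∀ᵐ x, ∀ j, q j = ⊤ → g j x ≤ E j := by
        refine ae_all_iff.2 fun j => ?_
        by_cases hj : q j = ⊤
        · filter_upwards [ae_le_eLpNormEssSup (f := g j) (μ := volume)] with x hx _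
          rw [hE, hj, hw1 j hj, weightMeasure_one, eLpNorm_exponent_top]
          exact hx
        · exact Eventually.of_forall fun x hx => absurd hx hj
      filter_upwards [ae_all_iff.2 hw0, hsup] with x hx hs
      have e1 : ENNReal.ofReal (productWeight w q r x) = ∏ j, ENNReal.ofReal (w j x) ^ θ j := by
        rw [productWeight, ENNReal.ofReal_prod_of_nonneg fun j _ => (Real.rpow_pos_of_pos (hx j) _).le]
        exact Finset.prod_congr rfl fun j _ => (ENNReal.ofReal_rpow_of_pos (hx j)).symm
      rw [e1, ← ENNReal.prod_rpow_of_nonneg hR0.le, ← Finset.prod_mul_distrib,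
        ← Finset.prod_compl_mul_prod F]
      refine mul_le_mul' (Finset.prod_le_prod' fun j hj => ?_) (Finset.prod_le_prod' fun j hj => ?_)
      · have hjt : q j = ⊤ := by
          by_contra hc
          exact (Finset.mem_compl.1 hj) (Finset.mem_filter.2 ⟨Finset.mem_univ j, hc⟩)
        rw [hθt j hjt, ENNReal.rpow_zero, one_mul]
        exact ENNReal.rpow_le_rpow (hs j hjt) hR0.le
      · have hjt : q j ≠ ⊤ := (Finset.mem_filter.1 hj).2
        rw [hh]
        simp only
        rw [ENNReal.mul_rpow_of_nonneg _ _ (hθ0 j), ← ENNReal.rpow_mul, hθq j hjt,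
          mul_div_cancel₀ _ (hqR j hjt).ne']
    have hmain : ∫⁻ x, (∏ j, g j x) ^ R ∂weightMeasure (productWeight w q r) ≤
        ∏ j, E j ^ R := by
      rw [weightMeasure, lintegral_withDensity_eq_lintegral_mul₀
        (aemeasurable_productWeight hw).ennreal_ofReal
        ((Finset.measurable_fun_prod _ fun j _ => hg j).pow_const _).aemeasurable]
      refine (lintegral_mono_ae hpt).trans ?_
      rw [lintegral_const_mul'' _ (Finset.aemeasurable_fun_prod _ fun j _ => (hhm j).pow_const _),
        ← Finset.prod_compl_mul_prod F]
      gcongr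
      refine (ENNReal.lintegral_prod_norm_pow_le F (fun j _ => hhm j) hθsumF
        fun j _ => hθ0 j).trans (le_of_eq ?_)
      exact Finset.prod_congr rfl hint
    rw [eLpNorm_eq_lintegral_rpow_enorm_toReal hr.ne' hrt]
    simp only [enorm_eq_self]
    rw [one_div, ENNReal.rpow_inv_le_iff hR0, ← ENNReal.prod_rpow_of_nonneg hR0.le]
    exact hmain

end Holder

/-! ### Approximation by Schwartz functions -/


section Admissible

variable {n : ℕ} {p : ℝ} {q : ℝ≥0∞} {w : Rn n → ℝ}

/-- The condition on the exponents and the weight in one slot: `1 ≤ p < q`, and `w ∈ A_{q/p}` if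
`q < ∞`, while `w = 1` if `q = ∞`. -/
structure IsAdmissible (p : ℝ) (q : ℝ≥0∞) (w : Rn n → ℝ) : Prop where
  one_le : 1 ≤ p
  lt : ENNReal.ofReal p < q
  isApWeight : q ≠ ⊤ → IsApWeight (q.toReal / p) w
  eq_one : q = ⊤ → w = fun _ => 1

lemma IsAdmissible.ne_zero (h : IsAdmissible p q w) : q ≠ 0 := (bot_le.trans_lt h.lt).ne'

lemma IsAdmissible.aemeasurable (h : IsAdmissible p q w) : AEMeasurable w := by
  by_cases hq : q = ⊤
  · rw [h.eq_one hq]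
    exact aemeasurable_const
  · exact (h.isApWeight hq).aemeasurable

lemma IsAdmissible.ae_pos (h : IsAdmissible p q w) : ∀ᵐ x, 0 < w x := by
  by_cases hq : q = ⊤
  · rw [h.eq_one hq]
    exact Eventually.of_forall fun _ => one_pos
  · exact (h.isApWeight hq).pos

lemma IsAdmissible.absolutelyContinuous (h : IsAdmissible p q w) : volume ≪ weightMeasure w :=
  absolutelyContinuous_weightMeasure h.aemeasurable h.ae_pos

lemma IsAdmissible.memLp (h : IsAdmissible p q w) (φ : 𝓢(Rn n, ℂ)) :
    MemLp φ q (weightMeasure w) :=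
  memLp_schwartz h.one_le h.lt h.isApWeight h.eq_one φ

lemma IsAdmissible.aestronglyMeasurable (h : IsAdmissible p q w) {f : Rn n → ℂ}
    (hf : MemLp f q (weightMeasure w)) : AEStronglyMeasurable f volume :=
  hf.1.mono_ac h.absolutelyContinuous

lemma IsAdmissible.eLpNorm_maximalFn_lt_top (h : IsAdmissible p q w) {f : Rn n → ℂ}
    (hf : MemLp f q (weightMeasure w)) :
    eLpNorm (maximalFn p f) q (weightMeasure w) < ⊤ := by
  obtain ⟨C, hC⟩ := exists_eLpNorm_maximalFn_le h.one_le h.lt h.isApWeight h.eq_one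
  exact (hC f (h.aestronglyMeasurable hf)).trans_lt (ENNReal.mul_lt_top ENNReal.coe_lt_top hf.2)

lemma ae_ne_top_of_eLpNorm_lt_top {α : Type*} [MeasurableSpace α] {ν : Measure α}
    {g : α → ℝ≥0∞} (hg : Measurable g) (hq : q ≠ 0) (h : eLpNorm g q ν < ⊤) :
    ∀ᵐ x ∂ν, g x ≠ ⊤ := by
  by_cases hqt : q = ⊤
  · rw [hqt, eLpNorm_exponent_top] at h
    filter_upwards [ae_le_eLpNormEssSup (f := g) (μ := ν)] with x hx
    exact (hx.trans_lt h).ne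
  · have h1 := lintegral_rpow_enorm_lt_top_of_eLpNorm_lt_top hq hqt h
    filter_upwards [ae_lt_top (hg.enorm.pow_const _) h1.ne] with x hx hx'
    rw [enorm_eq_self, hx', ENNReal.top_rpow_of_pos (ENNReal.toReal_pos hq hqt)] at hx
    exact lt_irrefl _ hx

lemma IsAdmissible.ae_maximalFn_ne_top (h : IsAdmissible p q w) {f : Rn n → ℂ}
    (hf : MemLp f q (weightMeasure w)) : ∀ᵐ x, maximalFn p f x ≠ ⊤ :=
  h.absolutelyContinuous.ae_le (ae_ne_top_of_eLpNorm_lt_top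
    (measurable_maximalFn (by linarith [h.one_le]) f) h.ne_zero (h.eLpNorm_maximalFn_lt_top hf))

/-- A sequence of Schwartz functions approximates `f` in the sense of maximal functions, almost
everywhere. -/
def IsMaxApprox (p : ℝ) (f : Rn n → ℂ) (φ : ℕ → 𝓢(Rn n, ℂ)) : Prop :=
  ∀ᵐ x, Tendsto (fun k => maximalFn p (f - ⇑(φ k)) x) atTop (𝓝 0)

/-- Norm approximation implies approximation in the sense of maximal functions, along a
subsequence, by the boundedness of the maximal function. -/
lemma IsAdmissible.exists_isMaxApprox (h : IsAdmissible p q w) {f : Rn n → ℂ}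
    (hf : MemLp f q (weightMeasure w)) {φ : ℕ → 𝓢(Rn n, ℂ)}
    (hφ : Tendsto (fun k => eLpNorm (f - ⇑(φ k)) q (weightMeasure w)) atTop (𝓝 0)) :
    ∃ ψ : ℕ → 𝓢(Rn n, ℂ), IsMaxApprox p f ψ := by
  have hp0 : 0 < p := by linarith [h.one_le]
  obtain ⟨C, hC⟩ := exists_eLpNorm_maximalFn_le h.one_le h.lt h.isApWeight h.eq_one
  have hmem : ∀ k, MemLp (f - ⇑(φ k)) q (weightMeasure w) := fun k => hf.sub (h.memLp _)
  set g : ℕ → Rn n → ℝ := fun k x => (maximalFn p (f - ⇑(φ k)) x).toReal with hg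
  have hgm : ∀ k, Measurable (g k) := fun k => (measurable_maximalFn hp0 _).ennreal_toReal
  have hlim : Tendsto (fun k => eLpNorm (g k - 0) q (weightMeasure w)) atTop (𝓝 0) := by
    have h1 := ENNReal.Tendsto.const_mul (a := (C : ℝ≥0∞)) hφ (Or.inr ENNReal.coe_ne_top)
    rw [mul_zero] at h1
    refine tendsto_of_tendsto_of_tendsto_of_le_of_le tendsto_const_nhds h1 (fun _ => zero_le)
      fun k => ?_
    refine le_trans ?_ (hC _ (h.aestronglyMeasurable (hmem k)))
    refine eLpNorm_mono_enorm fun x => ?_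
    rw [sub_zero, enorm_eq_self, Real.enorm_eq_ofReal ENNReal.toReal_nonneg]
    exact ENNReal.ofReal_toReal_le
  obtain ⟨ns, -, hns⟩ := (tendstoInMeasure_of_tendsto_eLpNorm h.ne_zero
    (fun k => (hgm k).aestronglyMeasurable) aestronglyMeasurable_const hlim).exists_seq_tendsto_ae
  refine ⟨fun k => φ (ns k), ?_⟩
  filter_upwards [h.absolutelyContinuous.ae_le hns,
    ae_all_iff.2 fun k => h.ae_maximalFn_ne_top (hmem k)] with x hx hx'
  have h2 : Tendsto (fun k => ENNReal.ofReal (g (ns k) x)) atTop (𝓝 (ENNReal.ofReal 0)) :=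
    ENNReal.tendsto_ofReal hx
  rw [ENNReal.ofReal_zero] at h2
  exact h2.congr fun k => ENNReal.ofReal_toReal (hx' _)

lemma isMaxApprox_const (hp : 0 < p) {f : Rn n → ℂ} {φ : 𝓢(Rn n, ℂ)} (h : f =ᵐ[volume] φ) :
    IsMaxApprox p f fun _ => φ := by
  have : maximalFn p (f - ⇑φ) = maximalFn p (0 : Rn n → ℂ) := by
    refine maximalFn_congr_ae ?_
    filter_upwards [h] with x hx
    simp [hx]
  refine Eventually.of_forall fun x => ?_
  simp only [this, maximalFn_zero hp]
  exact tendsto_const_nhds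

lemma IsMaxApprox.congr {f g : Rn n → ℂ} {φ : ℕ → 𝓢(Rn n, ℂ)} (h : IsMaxApprox p f φ)
    (hfg : f =ᵐ[volume] g) : IsMaxApprox p g φ := by
  unfold IsMaxApprox at h ⊢
  have : ∀ k, maximalFn p (g - ⇑(φ k)) = maximalFn p (f - ⇑(φ k)) := fun k =>
    maximalFn_congr_ae (by
      filter_upwards [hfg] with x hx
      simp [hx])
  simpa only [this] using h

lemma IsMaxApprox.add (hp : 1 ≤ p) {f g : Rn n → ℂ} {φ ψ : ℕ → 𝓢(Rn n, ℂ)}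
    (hf : AEStronglyMeasurable f volume) (hg : AEStronglyMeasurable g volume)
    (h : IsMaxApprox p f φ) (h' : IsMaxApprox p g ψ) : IsMaxApprox p (f + g) fun k => φ k + ψ k := by
  filter_upwards [h, h'] with x hx hx'
  have h1 := hx.add hx'
  rw [add_zero] at h1
  refine tendsto_of_tendsto_of_tendsto_of_le_of_le tendsto_const_nhds h1 (fun _ => zero_le)
    fun k => ?_
  have e : f + g - ⇑(φ k + ψ k) = (f - ⇑(φ k)) + (g - ⇑(ψ k)) := by
    funext y
    simp only [Pi.sub_apply, Pi.add_apply, _root_.add_apply]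
    ring
  simp only [e]
  exact maximalFn_add_le hp (hf.sub (φ k).continuous.aestronglyMeasurable)
    (hg.sub (ψ k).continuous.aestronglyMeasurable) x

lemma IsMaxApprox.const_smul (hp : 0 < p) {f : Rn n → ℂ} {φ : ℕ → 𝓢(Rn n, ℂ)} (c : ℂ)
    (h : IsMaxApprox p f φ) : IsMaxApprox p (c • f) fun k => c • φ k := by
  filter_upwards [h] with x hx
  have h1 := ENNReal.Tendsto.const_mul (a := ‖c‖ₑ) hx (Or.inr enorm_ne_top)
  rw [mul_zero] at h1
  refine h1.congr fun k => ?_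
  have e : c • f - ⇑(c • φ k) = c • (f - ⇑(φ k)) := by
    funext y
    simp only [Pi.sub_apply, Pi.smul_apply, _root_.smul_apply, smul_sub]
  rw [e, maximalFn_const_smul hp]

end Admissible

section Limit

variable {n N : ℕ} {p : Fin N → ℝ} {T : (Fin N → 𝓢(Rn n, ℂ)) → Rn n → ℂ} {C : ℝ≥0}

/-- At almost every point, `T` is multilinear and dominated by the maximal functions. This is all
that the weighted theory uses about the operator. -/
structure IsMaxDominated (p : Fin N → ℝ) (C : ℝ≥0) (T : (Fin N → 𝓢(Rn n, ℂ)) → Rn n → ℂ) :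
    Prop where
  aestronglyMeasurable : ∀ φ, AEStronglyMeasurable (T φ) volume
  ae_multilinear : ∀ᵐ x, ∃ L : MultilinearMap ℂ (fun _ : Fin N => 𝓢(Rn n, ℂ)) ℂ,
    (∀ u, L u = T u x) ∧ ∀ u : Fin N → 𝓢(Rn n, ℂ), ‖L u‖ₑ ≤ C * ∏ j, maximalFn (p j) (u j) x

lemma maximalFn_sub_le {p : ℝ} (hp : 1 ≤ p) {u v : Rn n → ℂ} (hu : AEStronglyMeasurable u)
    (hv : AEStronglyMeasurable v) (x : Rn n) :
    maximalFn p (u - v) x ≤ maximalFn p u x + maximalFn p v x := by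
  rw [sub_eq_add_neg, ← maximalFn_neg v]
  exact maximalFn_add_le hp hu hv.neg x

lemma maximalFn_schwartz_le {p : ℝ} (hp : 1 ≤ p) {f : Rn n → ℂ}
    (hf : AEStronglyMeasurable f volume) (φ : 𝓢(Rn n, ℂ)) (x : Rn n) :
    maximalFn p φ x ≤ maximalFn p f x + maximalFn p (f - ⇑φ) x := by
  have h := maximalFn_sub_le hp hf (hf.sub φ.continuous.aestronglyMeasurable) x
  rwa [sub_sub_cancel] at h

/-- Along approximating sequences the difference of the values of `T` tends to zero. -/
lemma tendsto_enorm_sub_of_approx {κ : Type*} {l : Filter κ} {x : Rn n} (hp : ∀ j, 1 ≤ p j)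
    {L : MultilinearMap ℂ (fun _ : Fin N => 𝓢(Rn n, ℂ)) ℂ}
    (hL : ∀ u : Fin N → 𝓢(Rn n, ℂ), ‖L u‖ₑ ≤ C * ∏ j, maximalFn (p j) (u j) x)
    {f : Fin N → Rn n → ℂ} (hf : ∀ j, AEStronglyMeasurable (f j) volume)
    (hfin : ∀ j, maximalFn (p j) (f j) x ≠ ⊤) {φ ψ : κ → Fin N → 𝓢(Rn n, ℂ)}
    (hφ : ∀ j, Tendsto (fun k => maximalFn (p j) (f j - ⇑(φ k j)) x) l (𝓝 0))
    (hψ : ∀ j, Tendsto (fun k => maximalFn (p j) (f j - ⇑(ψ k j)) x) l (𝓝 0)) :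
    Tendsto (fun k => ‖L (φ k) - L (ψ k)‖ₑ) l (𝓝 0) := by
  have hB : ∀ χ : κ → Fin N → 𝓢(Rn n, ℂ),
      (∀ j, Tendsto (fun k => maximalFn (p j) (f j - ⇑(χ k j)) x) l (𝓝 0)) →
      ∀ j, ∀ᶠ k in l, maximalFn (p j) (χ k j) x ≤ maximalFn (p j) (f j) x + 1 := by
    intro χ hχ j
    filter_upwards [(hχ j).eventually (ge_mem_nhds one_pos)] with k hk
    exact (maximalFn_schwartz_le (hp j) (hf j) (χ k j) x).trans (by gcongr)
  refine tendsto_enorm_multilinearMap_sub (s := fun j (v : 𝓢(Rn n, ℂ)) => maximalFn (p j) v x) hL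
    (fun j => ENNReal.add_ne_top.2 ⟨hfin j, ENNReal.one_ne_top⟩) (hB φ hφ) (hB ψ hψ) fun j => ?_
  have h1 := (hψ j).add (hφ j)
  rw [add_zero] at h1
  refine tendsto_of_tendsto_of_tendsto_of_le_of_le tendsto_const_nhds h1 (fun _ => zero_le)
    fun k => ?_
  have e : ⇑(φ k j - ψ k j) = (f j - ⇑(ψ k j)) - (f j - ⇑(φ k j)) := by
    funext y
    simp only [Pi.sub_apply, _root_.sub_apply]
    ring
  simp only [e]
  exact maximalFn_sub_le (hp j) ((hf j).sub (ψ k j).continuous.aestronglyMeasurable)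
    ((hf j).sub (φ k j).continuous.aestronglyMeasurable) x

/-- The extension of `T` to a tuple of approximable functions: the almost everywhere limit along
every approximating sequence. -/
lemma IsMaxDominated.exists_limit (hT : IsMaxDominated p C T) (hp : ∀ j, 1 ≤ p j)
    {f : Fin N → Rn n → ℂ} (hf : ∀ j, AEStronglyMeasurable (f j) volume)
    (hfin : ∀ j, ∀ᵐ x, maximalFn (p j) (f j) x ≠ ⊤)
    (hex : ∀ j, ∃ φ : ℕ → 𝓢(Rn n, ℂ), IsMaxApprox (p j) (f j) φ) :
    ∃ g : Rn n → ℂ, AEStronglyMeasurable g volume ∧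
      (∀ φ : Fin N → ℕ → 𝓢(Rn n, ℂ), (∀ j, IsMaxApprox (p j) (f j) (φ j)) →
        ∀ᵐ x, Tendsto (fun k => T (fun j => φ j k) x) atTop (𝓝 (g x))) ∧
      ∀ᵐ x, ‖g x‖ₑ ≤ C * ∏ j, maximalFn (p j) (f j) x := by
  choose φ hφ using hex
  set g : Rn n → ℂ := fun x => limUnder atTop fun k => T (fun j => φ j k) x with hg
  have hlim : ∀ᵐ x, Tendsto (fun k => T (fun j => φ j k) x) atTop (𝓝 (g x)) := by
    filter_upwards [hT.ae_multilinear, ae_all_iff.2 hfin, ae_all_iff.2 hφ] with x ⟨L, hLT, hL⟩ hx hφx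
    refine CauchySeq.tendsto_limUnder ?_
    rw [cauchySeq_iff_tendsto_dist_atTop_0, ← prod_atTop_atTop_eq]
    have h1 := tendsto_enorm_sub_of_approx (l := atTop ×ˢ atTop) hp hL hf hx
      (φ := fun k : ℕ × ℕ => fun j => φ j k.1) (ψ := fun k : ℕ × ℕ => fun j => φ j k.2)
      (fun j => (hφx j).comp tendsto_fst) (fun j => (hφx j).comp tendsto_snd)
    have h2 := (ENNReal.tendsto_toReal ENNReal.zero_ne_top).comp h1
    rw [ENNReal.toReal_zero] at h2
    refine h2.congr fun k => ?_
    simp only [Function.comp_apply, toReal_enorm, hLT, dist_eq_norm]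
  refine ⟨g, aestronglyMeasurable_of_tendsto_ae atTop
    (fun k => hT.aestronglyMeasurable fun j => φ j k) hlim, fun ψ hψ => ?_, ?_⟩
  · filter_upwards [hT.ae_multilinear, ae_all_iff.2 hfin, ae_all_iff.2 hφ, ae_all_iff.2 hψ, hlim]
      with x ⟨L, hLT, hL⟩ hx hφx hψx hlx
    have h1 := tendsto_enorm_sub_of_approx hp hL hf hx
      (φ := fun k : ℕ => fun j => φ j k) (ψ := fun k : ℕ => fun j => ψ j k) hφx hψx
    simp only [hLT] at h1
    have h2 := tendsto_zero_iff_enorm_tendsto_zero.2 h1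
    simpa using hlx.sub h2
  · filter_upwards [hT.ae_multilinear, ae_all_iff.2 hfin, ae_all_iff.2 hφ, hlim]
      with x ⟨L, hLT, hL⟩ hx hφx hlx
    have h1 : Tendsto (fun k => (C : ℝ≥0∞) * ∏ j, (maximalFn (p j) (f j) x +
        maximalFn (p j) (f j - ⇑(φ j k)) x)) atTop (𝓝 (C * ∏ j, maximalFn (p j) (f j) x)) := by
      refine ENNReal.Tendsto.const_mul ?_ (Or.inr ENNReal.coe_ne_top)
      refine ENNReal.tendsto_finsetProd_of_ne_top _ (fun j _ => ?_) fun j _ => hx j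
      simpa using (tendsto_const_nhds (x := maximalFn (p j) (f j) x)).add (hφx j)
    refine le_of_tendsto_of_tendsto' hlx.enorm h1 fun k => ?_
    rw [← hLT]
    refine (hL _).trans ?_
    gcongr with j
    exact maximalFn_schwartz_le (hp j) (hf j) _ x

end Limit

/-! ### The bounded multilinear extension -/


section Extension

variable {n N : ℕ} {p : Fin N → ℝ} {T : (Fin N → 𝓢(Rn n, ℂ)) → Rn n → ℂ} {C : ℝ≥0}
  {q : Fin N → ℝ≥0∞} {r : ℝ≥0∞} {w : Fin N → Rn n → ℝ}

/-- Hölder's inequality and the boundedness of the maximal functions turn the pointwise domination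
into a norm inequality. -/
lemma exists_eLpNorm_le_of_le_prod_maximalFn (hw : ∀ j, IsAdmissible (p j) (q j) (w j))
    (hr : 0 < r) (hrq : r⁻¹ = ∑ j, (q j)⁻¹) (C : ℝ≥0) :
    ∃ C' : ℝ≥0, ∀ (f : Fin N → Rn n → ℂ) (g : Rn n → ℂ),
      (∀ j, AEStronglyMeasurable (f j) volume) →
      (∀ᵐ x, ‖g x‖ₑ ≤ C * ∏ j, maximalFn (p j) (f j) x) →
      eLpNorm g r (weightMeasure (productWeight w q r)) ≤
        C' * ∏ j, eLpNorm (f j) (q j) (weightMeasure (w j)) := by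
  choose D hD using fun j => exists_eLpNorm_maximalFn_le (hw j).one_le (hw j).lt (hw j).isApWeight
    (hw j).eq_one
  refine ⟨C * ∏ j, D j, fun f g hf hg => ?_⟩
  calc eLpNorm g r (weightMeasure (productWeight w q r))
      ≤ C * eLpNorm (fun x => ∏ j, maximalFn (p j) (f j) x) r
          (weightMeasure (productWeight w q r)) := by
        refine eLpNorm_le_nnreal_smul_eLpNorm_of_ae_le_mul' ?_ r
        filter_upwards [(weightMeasure_absolutelyContinuous _).ae_le hg] with x hx
        rwa [enorm_eq_self]
    _ ≤ C * ∏ j, eLpNorm (maximalFn (p j) (f j)) (q j) (weightMeasure (w j)) := by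
        gcongr
        exact eLpNorm_prod_productWeight_le (fun j => (hw j).aemeasurable) (fun j => (hw j).ae_pos)
          (fun j => (hw j).eq_one) (fun j => (hw j).ne_zero) hr hrq
          fun j => measurable_maximalFn (by linarith [(hw j).one_le]) _
    _ ≤ C * ∏ j, (D j * eLpNorm (f j) (q j) (weightMeasure (w j))) := by
        gcongr with j
        exact hD j _ (hf j)
    _ = _ := by
        rw [Finset.prod_mul_distrib, ENNReal.coe_mul, ENNReal.ofNNReal_finsetProd, mul_assoc]

/-- Updating a tuple of approximated functions in one slot. -/
lemma isMaxApprox_update {f : (j : Fin N) → weightedLp (q j) (w j)}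
    {φ : Fin N → ℕ → 𝓢(Rn n, ℂ)}
    (hφ : ∀ j, IsMaxApprox (p j) (f j : Lp ℂ (q j) (weightMeasure (w j))) (φ j)) {i : Fin N}
    {v : weightedLp (q i) (w i)} {α : ℕ → 𝓢(Rn n, ℂ)}
    (hα : IsMaxApprox (p i) (v : Lp ℂ (q i) (weightMeasure (w i))) α) (j : Fin N) :
    IsMaxApprox (p j) (Function.update f i v j : Lp ℂ (q j) (weightMeasure (w j)))
      (Function.update φ i α j) := by
  by_cases h : j = i
  · subst h
    simpa only [Function.update_self] using hα
  · simpa only [Function.update_of_ne h] using hφ j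

lemma update_apply_seq (φ : Fin N → ℕ → 𝓢(Rn n, ℂ)) (i : Fin N) (α : ℕ → 𝓢(Rn n, ℂ)) (k : ℕ) :
    (fun j => Function.update φ i α j k) = Function.update (fun j => φ j k) i (α k) := by
  funext j
  by_cases h : j = i
  · subst h
    simp only [Function.update_self]
  · simp only [Function.update_of_ne h]

/-- The pointwise extension of `T`, as a family of functions indexed by tuples of elements of the
domain spaces; it is additive and homogeneous in each slot, almost everywhere. -/
lemma IsMaxDominated.exists_pointwise_extension (hT : IsMaxDominated p C T)
    (hw : ∀ j, IsAdmissible (p j) (q j) (w j)) :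
    ∃ g : ((j : Fin N) → weightedLp (q j) (w j)) → Rn n → ℂ,
      (∀ f, AEStronglyMeasurable (g f) volume) ∧
      (∀ f, ∀ᵐ x, ‖g f x‖ₑ ≤
        C * ∏ j, maximalFn (p j) (f j : Lp ℂ (q j) (weightMeasure (w j))) x) ∧
      (∀ f i (v v' : weightedLp (q i) (w i)), g (Function.update f i (v + v')) =ᵐ[volume]
        g (Function.update f i v) + g (Function.update f i v')) ∧
      (∀ f i (c : ℂ) (v : weightedLp (q i) (w i)), g (Function.update f i (c • v)) =ᵐ[volume]
        c • g (Function.update f i v)) ∧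
      ∀ (φ : Fin N → 𝓢(Rn n, ℂ)) f,
        (∀ j, ⇑(f j : Lp ℂ (q j) (weightMeasure (w j))) =ᵐ[weightMeasure (w j)] ⇑(φ j)) →
        g f =ᵐ[volume] T φ := by
  have hp : ∀ j, 1 ≤ p j := fun j => (hw j).one_le
  have hp0 : ∀ j, 0 < p j := fun j => by linarith [hp j]
  have hmem : ∀ j (v : weightedLp (q j) (w j)),
      MemLp (v : Lp ℂ (q j) (weightMeasure (w j))) (q j) (weightMeasure (w j)) :=
    fun j v => Lp.memLp _
  have hmeas : ∀ j (v : weightedLp (q j) (w j)),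
      AEStronglyMeasurable (v : Lp ℂ (q j) (weightMeasure (w j))) volume :=
    fun j v => (hw j).aestronglyMeasurable (hmem j v)
  have happ : ∀ j (v : weightedLp (q j) (w j)), ∃ φ : ℕ → 𝓢(Rn n, ℂ),
      IsMaxApprox (p j) (v : Lp ℂ (q j) (weightMeasure (w j))) φ := by
    intro j v
    obtain ⟨φ, hφ⟩ := v.2
    exact (hw j).exists_isMaxApprox (hmem j v) hφ
  have hex := fun f : (j : Fin N) → weightedLp (q j) (w j) =>
    hT.exists_limit hp (fun j => hmeas j (f j)) (fun j => (hw j).ae_maximalFn_ne_top (hmem j (f j)))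
      fun j => happ j (f j)
  choose g hgm hglim hgle using hex
  refine ⟨g, hgm, hgle, ?_, ?_, ?_⟩
  · intro f i v v'
    choose φ hφ using fun j => happ j (f j)
    obtain ⟨α, hα⟩ := happ i v
    obtain ⟨β, hβ⟩ := happ i v'
    have hαβ : IsMaxApprox (p i)
        ((v + v' : weightedLp (q i) (w i)) : Lp ℂ (q i) (weightMeasure (w i)))
        fun k => α k + β k :=
      (hα.add (hp i) (hmeas i v) (hmeas i v') hβ).congr
        ((hw i).absolutelyContinuous.ae_eq (Lp.coeFn_add _ _).symm)
    have h1 := hglim _ _ (isMaxApprox_update hφ hα)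
    have h2 := hglim _ _ (isMaxApprox_update hφ hβ)
    have h3 := hglim _ _ (isMaxApprox_update hφ hαβ)
    simp only [update_apply_seq] at h1 h2 h3
    filter_upwards [h1, h2, h3, hT.ae_multilinear] with x h1 h2 h3 ⟨L, hLT, _⟩
    refine tendsto_nhds_unique h3 ((h1.add h2).congr fun k => ?_)
    rw [← hLT, ← hLT, ← hLT]
    exact (L.map_update_add _ i _ _).symm
  · intro f i c v
    choose φ hφ using fun j => happ j (f j)
    obtain ⟨α, hα⟩ := happ i v
    have hcα : IsMaxApprox (p i)
        ((c • v : weightedLp (q i) (w i)) : Lp ℂ (q i) (weightMeasure (w i)))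
        fun k => c • α k :=
      (hα.const_smul (hp0 i) c).congr
        ((hw i).absolutelyContinuous.ae_eq (Lp.coeFn_smul _ _).symm)
    have h1 := hglim _ _ (isMaxApprox_update hφ hα)
    have h2 := hglim _ _ (isMaxApprox_update hφ hcα)
    simp only [update_apply_seq] at h1 h2
    filter_upwards [h1, h2, hT.ae_multilinear] with x h1 h2 ⟨L, hLT, _⟩
    refine tendsto_nhds_unique h2 ((h1.const_smul c).congr fun k => ?_)
    rw [← hLT, ← hLT]
    exact (L.map_update_smul _ i _ _).symm
  · intro φ f hφ
    have h1 := hglim f (fun j _ => φ j) fun j =>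
      isMaxApprox_const (hp0 j) ((hw j).absolutelyContinuous.ae_eq (hφ j))
    filter_upwards [h1] with x hx
    exact tendsto_nhds_unique hx tendsto_const_nhds

/-- The bounded multilinear extension. The target space need not be normed: `r < 1` is allowed. -/
lemma IsMaxDominated.exists_extension (hT : IsMaxDominated p C T)
    (hw : ∀ j, IsAdmissible (p j) (q j) (w j)) (hr : 0 < r) (hrq : r⁻¹ = ∑ j, (q j)⁻¹) :
    ∃ F : MultilinearMap ℂ (fun j => weightedLp (q j) (w j))
        (Lp ℂ r (weightMeasure (productWeight w q r))),
      (∃ C : ℝ≥0, ∀ f : (j : Fin N) → weightedLp (q j) (w j),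
        ‖F f‖ ≤ C * ∏ j, ‖(f j : Lp ℂ (q j) (weightMeasure (w j)))‖) ∧
      ∀ (φ : Fin N → 𝓢(Rn n, ℂ)) (f : (j : Fin N) → weightedLp (q j) (w j)),
        (∀ j, ⇑(f j : Lp ℂ (q j) (weightMeasure (w j))) =ᵐ[weightMeasure (w j)] ⇑(φ j)) →
        ⇑(F f) =ᵐ[weightMeasure (productWeight w q r)] T φ := by
  have hac := weightMeasure_absolutelyContinuous (productWeight w q r)
  obtain ⟨C', hC'⟩ := exists_eLpNorm_le_of_le_prod_maximalFn hw hr hrq C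
  obtain ⟨g, hgm, hgle, hadd, hsmul, hφ⟩ := hT.exists_pointwise_extension hw
  have hgn : ∀ f, eLpNorm (g f) r (weightMeasure (productWeight w q r)) ≤
      C' * ∏ j, eLpNorm (f j : Lp ℂ (q j) (weightMeasure (w j))) (q j) (weightMeasure (w j)) :=
    fun f => hC' _ _ (fun j => (hw j).aestronglyMeasurable (Lp.memLp _)) (hgle f)
  have hfin : ∀ f : (j : Fin N) → weightedLp (q j) (w j), C' * ∏ j,
      eLpNorm (f j : Lp ℂ (q j) (weightMeasure (w j))) (q j) (weightMeasure (w j)) < ⊤ := fun f =>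
    ENNReal.mul_lt_top ENNReal.coe_lt_top (ENNReal.prod_lt_top fun j _ => Lp.eLpNorm_lt_top _)
  have hgL : ∀ f, MemLp (g f) r (weightMeasure (productWeight w q r)) := fun f =>
    ⟨(hgm f).mono_ac hac, (hgn f).trans_lt (hfin f)⟩
  refine ⟨⟨fun f => (hgL f).toLp, ?_, ?_⟩, ⟨C', fun f => ?_⟩, fun φ f hf => ?_⟩
  · intro hd f i v v'
    have hd' : hd = instDecidableEqFin N := Subsingleton.elim _ _
    subst hd'
    rw [← MemLp.toLp_add, MemLp.toLp_eq_toLp_iff]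
    exact hac.ae_eq (hadd f i v v')
  · intro hd f i c v
    have hd' : hd = instDecidableEqFin N := Subsingleton.elim _ _
    subst hd'
    rw [← MemLp.toLp_const_smul, MemLp.toLp_eq_toLp_iff]
    exact hac.ae_eq (hsmul f i c v)
  · change ‖(hgL f).toLp‖ ≤ _
    rw [Lp.norm_toLp]
    have h1 := ENNReal.toReal_mono (hfin f).ne (hgn f)
    rwa [ENNReal.toReal_mul, ENNReal.toReal_prod, ENNReal.coe_toReal] at h1
  · exact (MemLp.coeFn_toLp (hgL f)).trans (hac.ae_eq (hφ φ f hf))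

/-- Two bounded multilinear maps which agree on Schwartz functions are equal: the slots are
approximated by Schwartz functions one after the other. -/
lemma multilinearMap_ext_of_schwartz {ν : Measure (Rn n)} (hr : r ≠ 0)
    (hmem : ∀ j (φ : 𝓢(Rn n, ℂ)), MemLp φ (q j) (weightMeasure (w j)))
    {F G : MultilinearMap ℂ (fun j => weightedLp (q j) (w j)) (Lp ℂ r ν)}
    (hF : ∃ C : ℝ≥0, ∀ f : (j : Fin N) → weightedLp (q j) (w j),
      ‖F f‖ ≤ C * ∏ j, ‖(f j : Lp ℂ (q j) (weightMeasure (w j)))‖)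
    (hG : ∃ C : ℝ≥0, ∀ f : (j : Fin N) → weightedLp (q j) (w j),
      ‖G f‖ ≤ C * ∏ j, ‖(f j : Lp ℂ (q j) (weightMeasure (w j)))‖)
    (h : ∀ (φ : Fin N → 𝓢(Rn n, ℂ)) (f : (j : Fin N) → weightedLp (q j) (w j)),
      (∀ j, ⇑(f j : Lp ℂ (q j) (weightMeasure (w j))) =ᵐ[weightMeasure (w j)] ⇑(φ j)) →
      F f = G f) : F = G := by
  have key : ∀ (s : Finset (Fin N)) (f : (j : Fin N) → weightedLp (q j) (w j)),
      (∀ j ∉ s, ∃ φ : 𝓢(Rn n, ℂ),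
        ⇑(f j : Lp ℂ (q j) (weightMeasure (w j))) =ᵐ[weightMeasure (w j)] ⇑φ) → F f = G f := by
    intro s
    induction s using Finset.induction with
    | empty =>
      intro f hf
      choose φ hφ using fun j => hf j (Finset.notMem_empty j)
      exact h φ f hφ
    | insert i s hi ih =>
      intro f hf
      obtain ⟨φ, hφ⟩ := (f i).2
      -- the Schwartz functions as elements of the domain space
      let e : ℕ → weightedLp (q i) (w i) := fun k =>
        ⟨(hmem i (φ k)).toLp, fun _ => φ k, by
          have h0 : eLpNorm (⇑((hmem i (φ k)).toLp) - ⇑(φ k)) (q i) (weightMeasure (w i)) = 0 := by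
            rw [eLpNorm_congr_ae (g := 0)]
            · simp
            · filter_upwards [(hmem i (φ k)).coeFn_toLp] with x hx
              simp [hx]
          simp only [h0]
          exact tendsto_const_nhds⟩
      have he : Tendsto (fun k => ‖((f i - e k : weightedLp (q i) (w i)) :
          Lp ℂ (q i) (weightMeasure (w i)))‖) atTop (𝓝 0) := by
        have h1 := (ENNReal.tendsto_toReal ENNReal.zero_ne_top).comp hφ
        rw [ENNReal.toReal_zero] at h1
        refine h1.congr fun k => ?_
        rw [Submodule.coe_sub, Lp.norm_def, Function.comp_apply]
        congr 1
        refine eLpNorm_congr_ae ?_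
        filter_upwards [Lp.coeFn_sub (f i : Lp ℂ (q i) (weightMeasure (w i))) (e k),
          (hmem i (φ k)).coeFn_toLp] with x hx hx'
        rw [hx, Pi.sub_apply, Pi.sub_apply, hx']
      have hstep : ∀ k, F (Function.update f i (e k)) = G (Function.update f i (e k)) := by
        intro k
        refine ih _ fun j hj => ?_
        by_cases hji : j = i
        · subst hji
          refine ⟨φ k, ?_⟩
          simp only [Function.update_self]
          exact (hmem j (φ k)).coeFn_toLp
        · simp only [Function.update_of_ne hji]
          exact hf j fun hj' => (Finset.mem_insert.1 hj').elim hji hj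
      have hlim : ∀ H : MultilinearMap ℂ (fun j => weightedLp (q j) (w j)) (Lp ℂ r ν),
          (∃ C : ℝ≥0, ∀ f : (j : Fin N) → weightedLp (q j) (w j),
            ‖H f‖ ≤ C * ∏ j, ‖(f j : Lp ℂ (q j) (weightMeasure (w j)))‖) →
          Tendsto (fun k => ‖H f - H (Function.update f i (e k))‖) atTop (𝓝 0) := by
        rintro H ⟨C, hC⟩
        have h1 := (he.mul_const (∏ j ∈ Finset.univ.erase i,
          ‖(f j : Lp ℂ (q j) (weightMeasure (w j)))‖)).const_mul (C : ℝ)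
        rw [zero_mul, mul_zero] at h1
        refine squeeze_zero (fun _ => ENNReal.toReal_nonneg) (fun k => ?_) h1
        have e1 : H f - H (Function.update f i (e k)) = H (Function.update f i (f i - e k)) := by
          rw [H.map_update_sub, Function.update_eq_self]
        rw [e1]
        refine (hC _).trans (le_of_eq ?_)
        rw [← Finset.mul_prod_erase _ _ (Finset.mem_univ i), Function.update_self]
        congr 2
        refine Finset.prod_congr rfl fun j hj => ?_
        rw [Function.update_of_ne (Finset.ne_of_mem_erase hj)]
      -- the quasi-triangle inequality, valid for all exponents
      have hle : ∀ k, ‖F f - G f‖ₑ ≤ ENNReal.LpAddConst r *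
          (‖F f - F (Function.update f i (e k))‖ₑ + ‖G f - G (Function.update f i (e k))‖ₑ) := by
        intro k
        have e2 : F f - G f = (F f - F (Function.update f i (e k))) -
            (G f - G (Function.update f i (e k))) := by
          rw [hstep k]
          abel
        rw [e2]
        simp only [Lp.enorm_def]
        rw [eLpNorm_congr_ae (Lp.coeFn_sub _ _)]
        exact eLpNorm_sub_le' (Lp.aestronglyMeasurable _) (Lp.aestronglyMeasurable _) r
      have h0 : ‖F f - G f‖ₑ = 0 := by
        have hF' := (hlim F hF)
        have hG' := (hlim G hG)
        have hconv : ∀ u : ℕ → Lp ℂ r ν, Tendsto (fun k => ‖u k‖) atTop (𝓝 0) →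
            Tendsto (fun k => ‖u k‖ₑ) atTop (𝓝 0) := by
          intro u hu
          have h1 := ENNReal.tendsto_ofReal hu
          rw [ENNReal.ofReal_zero] at h1
          refine h1.congr fun k => ?_
          rw [Lp.norm_def, ENNReal.ofReal_toReal (Lp.eLpNorm_ne_top _), Lp.enorm_def]
        have h2 := ENNReal.Tendsto.const_mul (a := ENNReal.LpAddConst r)
          ((hconv _ hF').add (hconv _ hG')) (Or.inr (ENNReal.LpAddConst_lt_top r).ne)
        rw [add_zero, mul_zero] at h2
        exact le_antisymm (ge_of_tendsto' h2 hle) bot_le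
      rw [Lp.enorm_def, eLpNorm_eq_zero_iff (Lp.aestronglyMeasurable _) hr] at h0
      exact sub_eq_zero.1 ((Lp.eq_zero_iff_ae_eq_zero).2 h0)
  ext1 f
  exact key Finset.univ f fun j hj => absurd (Finset.mem_univ j) hj

/-- Pointwise domination by maximal functions implies the weighted norm inequalities. -/
theorem IsMaxDominated.isBoundedOp (hT : IsMaxDominated p C T)
    (hw : ∀ j, IsAdmissible (p j) (q j) (w j)) (hr : 0 < r) (hrq : r⁻¹ = ∑ j, (q j)⁻¹) :
    IsBoundedOp T q w r (productWeight w q r) := by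
  have hac := weightMeasure_absolutelyContinuous (productWeight w q r)
  have hμ : volume ≪ weightMeasure (productWeight w q r) :=
    absolutelyContinuous_weightMeasure (aemeasurable_productWeight fun j => (hw j).aemeasurable)
      (productWeight_pos fun j => (hw j).ae_pos)
  refine ⟨fun j φ => (hw j).memLp φ, ?_, ?_⟩
  · obtain ⟨C', hC'⟩ := exists_eLpNorm_le_of_le_prod_maximalFn hw hr hrq C
    refine ⟨C', fun φ => ?_⟩
    have h1 := hC' (fun j => φ j) (T φ) (fun j => (φ j).continuous.aestronglyMeasurable) (by
      filter_upwards [hT.ae_multilinear] with x ⟨L, hLT, hL⟩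
      rw [← hLT]
      exact hL φ)
    exact ⟨⟨(hT.aestronglyMeasurable φ).mono_ac hac, h1.trans_lt (ENNReal.mul_lt_top
      ENNReal.coe_lt_top (ENNReal.prod_lt_top fun j _ => ((hw j).memLp (φ j)).2))⟩, h1⟩
  · obtain ⟨F, hF, hFT⟩ := hT.exists_extension hw hr hrq
    refine ⟨F, ⟨hF, hFT⟩, fun G hG => ?_⟩
    refine multilinearMap_ext_of_schwartz hr.ne' (fun j φ => (hw j).memLp φ) hG.1 hF fun φ f hφ => ?_
    exact Lp.ext ((hG.2 φ f hφ).trans (hFT φ f hφ).symm)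

end Extension

end MultilinPsdo

end

/-! ### Pointwise and weighted bounds for the operator -/

theorem theorem3p3 (n N : ℕ) (hn : 1 ≤ n) (hN : 1 ≤ N) (p : Fin N → ℝ)
    (hp : ∀ j, 1 ≤ p j ∧ p j ≤ 2) (m ρ : ℝ) (hρ0 : 0 ≤ ρ) (hρ1 : ρ ≤ 1)
    (hm : m < (ρ - 1) * ∑ j, (n : ℝ) / p j) :
    (∃ S : Finset (MultilinPsdo.MultiIndex n N), ∀ K : MultilinPsdo.MultiIndex n N → ℝ,
      ∃ C : ℝ≥0, ∀ a : MultilinPsdo.Rn n → (Fin N → MultilinPsdo.Rn n) → ℂ,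
        MultilinPsdo.IsSymbol m ρ a →
        (∀ α ∈ S, ∀ Ξ, ∀ᵐ x, MultilinPsdo.SymbolBoundAt m ρ a α (K α) x Ξ) →
        (∀ᵐ x, ∀ u : Fin N → 𝓢(MultilinPsdo.Rn n, ℂ),
          ‖MultilinPsdo.psdo a u x‖ₑ ≤ C * ∏ j, MultilinPsdo.maximalFn (p j) (u j) x) ∧
        (∀ x, ContDiff ℝ ∞ (a x) →
          (∀ α ∈ S, ∀ Ξ, MultilinPsdo.SymbolBoundAt m ρ a α (K α) x Ξ) →
          ∀ u : Fin N → 𝓢(MultilinPsdo.Rn n, ℂ),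
            ‖MultilinPsdo.psdo a u x‖ₑ ≤ C * ∏ j, MultilinPsdo.maximalFn (p j) (u j) x)) ∧
    (∀ a : MultilinPsdo.Rn n → (Fin N → MultilinPsdo.Rn n) → ℂ,
      MultilinPsdo.IsSymbol m ρ a →
      ∀ (q : Fin N → ℝ≥0∞) (r : ℝ≥0∞) (w : Fin N → MultilinPsdo.Rn n → ℝ),
        (∀ j, ENNReal.ofReal (p j) < q j) →
        0 < r → r⁻¹ = ∑ j, (q j)⁻¹ →
        (∀ j, q j ≠ ⊤ → MultilinPsdo.IsApWeight ((q j).toReal / p j) (w j)) →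
        (∀ j, q j = ⊤ → w j = fun _ => 1) →
        MultilinPsdo.IsBoundedOp (MultilinPsdo.psdo a) q w r
          (fun x => ∏ j, w j x ^ (r / q j).toReal)) := by
  refine ⟨⟨MultilinPsdo.derivIndices n N, fun K => ?_⟩, fun a ha q r w hq hr hrq hw hw1 => ?_⟩
  · obtain ⟨C, hC⟩ := MultilinPsdo.exists_enorm_psdo_le_of_symbolBoundAt hn hp hρ0 hρ1 hm K
    refine ⟨C, fun a ha hK => ⟨?_, fun x hx hxK u => hC a x hx hxK u⟩⟩
    filter_upwards [ha.contDiff, (Finset.eventually_all _).2 fun α hα =>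
      MultilinPsdo.ae_forall_symbolBoundAt ha.contDiff (hK α hα)] with x hx hxK u
    exact hC a x hx hxK u
  · have hm0 : m ≤ 0 := by
      have h1 : 0 ≤ ∑ j, (n : ℝ) / p j := Finset.sum_nonneg fun j _ =>
        div_nonneg (Nat.cast_nonneg n) (by linarith [(hp j).1])
      nlinarith
    choose K hK using ha.bound
    obtain ⟨C, hC⟩ := MultilinPsdo.exists_enorm_psdo_le_of_symbolBoundAt hn hp hρ0 hρ1 hm K
    obtain ⟨C₀, hC₀⟩ := ha.ae_bounded hm0
    have hT : MultilinPsdo.IsMaxDominated p C (MultilinPsdo.psdo a) := by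
      refine ⟨fun φ => MultilinPsdo.aestronglyMeasurable_psdo ha.aestronglyMeasurable
        (ha.contDiff.mono fun x hx => hx.continuous) φ, ?_⟩
      filter_upwards [ha.contDiff, hC₀, (Finset.eventually_all (MultilinPsdo.derivIndices n N)).2
        fun α _ => MultilinPsdo.ae_forall_symbolBoundAt ha.contDiff (hK α)] with x hx hx₀ hxK
      obtain ⟨L, hL⟩ := MultilinPsdo.exists_multilinearMap_eq_psdo hx.continuous hx₀
      exact ⟨L, hL, fun u => (hL u).symm ▸ hC a x hx hxK u⟩
    exact hT.isBoundedOp (fun j => ⟨(hp j).1, hq j, hw j, hw1 j⟩) hr hrq
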